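/- Let $\mathbb{B}=\{u+\mathbf{j}v : u,v\in\mathbb{C}\}$ be the algebra of bicomplex numbers ($\mathbf{j}^2=-1$, $\mathbf{j}i=i\mathbf{j}$), with $\operatorname{Sc}(u+\mathbf{j}v)=u$, $\operatorname{Vec}(u+\mathbf{j}v)=v$, conjugation $\overline{u+\mathbf{j}v}=u-\mathbf{j}v$ and inner product $\langle W,V\rangle_{\mathbb{B}}=\operatorname{Sc}W(\operatorname{Sc}V)^*+\operatorname{Vec}W(\operatorname{Vec}V)^*$, where $^*$ is complex conjugation. For $z=x+iy$ put $\widehat z=x+\mathbf{j}y$ and $\overline{\boldsymbol\partial}=\frac12(\partial_x+\mathbf{j}\partial_y)$. Let $\varrho>0$, $\Omega=B_\varrho(0)\subset\mathbb{C}$, let $q_f\in C^1([0,\varrho];\mathbb{C})$, and let $f\in C^2([0,\varrho];\mathbb{C})$ be a nowhere vanishing solution of $f''+\frac1r f'-q_f f=0$ on $(0,\varrho)$ with $f(0)=1$. Put $q_{1/f}=2(f'/f)^2-q_f$ and write $f(z)=f(|z|)$. The pseudoanalytic Bergman space $\mathcal{A}_f^2(\Omega;\mathbb{B})$ consists of the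 $W\in C^1(\Omega;\mathbb{B})\cap L_2(\Omega;\mathbb{B})$ with $\overline{\boldsymbol\partial}W=\frac{\overline{\boldsymbol\partial}f}{f}\overline W$ in $\Omega$; it carries the inner product $\langle F,G\rangle_{L_2(\Omega;\mathbb{B})}=\iint_\Omega\langle F(z),G(z)\rangle_{\mathbb{B}}\,dA_z$. For $g\in\{f,1/f\}$ the following objects exist and are unique: * the kernel $G^g\in C([0,\varrho]\times[0,1])\cap C^2((0,\varrho)\times(0,1))$ with $r(G^g_{rr}-q_gG^g)-G^g_r+2(1-t)G^g_{rt}=0$ in $(0,\varrho)\times(0,1)$, $G^g(r,0)=\int_0^r\tau q_g(\tau)\,d\tau$ and $G^g(0,t)=0$; * for each $n\ge0$, the function $y_n^g\in C[0,\varrho]\cap C^2(0,\varrho)$ with $-y''+\frac{(n-\frac12)(n+\frac12)}{r^2}y+q_gy=0$ on $(0,\varrho)$, $y\sim r^{n+\frac12}$ and $y'\sim(n+\frac12)r^{n-\frac12}$ as $r\to0^+$. Put $\phi_g^{(n)}(r)=y_n^g(r)/r^{n+\frac12}$, $\mathbf{T}_gh(z)=h(z)+\int_0^1\sigma\,G^g(|z|,1-\sigma^2)\,h(\sigma^2z)\,d\sigma$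 and $\mathcal{T}_fW=\mathbf{T}_f[\operatorname{Sc}W]+\mathbf{j}\,\mathbf{T}_{1/f}[\operatorname{Vec}W]$, and define the basic radial formal powers $\mathcal{Z}_f^{(n)}(\Lambda;z)=\mathcal{T}_f[\Lambda\widehat z^{\,n}](z)$ for $\Lambda\in\{1,\mathbf{j}\}$, $n\ge0$. Then every $\mathcal{Z}_f^{(n)}(\Lambda;\cdot)$ belongs to $\mathcal{A}_f^2(\Omega;\mathbb{B})$, and for $\Lambda\in\{1,\mathbf{j}\}$ $$\langle\mathcal{Z}_f^{(n)}(1;\cdot),\mathcal{Z}_f^{(m)}(\mathbf{j};\cdot)\rangle_{L_2(\Omega;\mathbb{B})}=0\qquad(n,m\ge0),$$ $$\langle\mathcal{Z}_f^{(n)}(\Lambda;\cdot),\mathcal{Z}_f^{(m)}(\Lambda;\cdot)\rangle_{L_2(\Omega;\mathbb{B})}=\pi\Big(\|\phi_f^{(n)}\|^2_{L_2(0,\varrho;\,r^{2n+1}dr)}+\|\phi_{1/f}^{(n)}\|^2_{L_2(0,\varrho;\,r^{2n+1}dr)}\Big)\delta_{n,m}\qquad(n,m\ge1),$$ $$\langle\mathcal{Z}_f^{(0)}(1;\cdot),\mathcal{Z}_f^{(m)}(\Lambda;\cdot)\rangle_{L_2(\Omega;\mathbb{B})}=\langle\mathcal{Z}_f^{(0)}(\mathbf{j};\cdot),\mathcal{Z}_f^{(m)}(\Lambda;\cdot)\rangle_{L_2(\Omega;\mathbb{B})}=0\qquad(m\ge1),$$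 while $\|\mathcal{Z}_f^{(0)}(1;\cdot)\|^2=2\pi\|\phi_f^{(0)}\|^2_{L_2(0,\varrho;\,r\,dr)}$ and $\|\mathcal{Z}_f^{(0)}(\mathbf{j};\cdot)\|^2=2\pi\|\phi_{1/f}^{(0)}\|^2_{L_2(0,\varrho;\,r\,dr)}$. Moreover $\{\mathcal{Z}_f^{(n)}(1;\cdot),\mathcal{Z}_f^{(n)}(\mathbf{j};\cdot)\}_{n\ge0}$ is an orthogonal basis of the complex Hilbert space $\mathcal{A}_f^2(\Omega;\mathbb{B})$: after normalisation it is a Hilbert (complete orthonormal) basis. -/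

import Mathlib

open MeasureTheory Filter Topology Set

noncomputable section

/-- The bicomplex numbers `u + 𝐣 v` with `u, v : ℂ`, as the Hermitian space `ℂ²`
(Euclidean norm `√(|u|² + |v|²)`); the product is installed below. -/
abbrev Bicomplex : Type := WithLp 2 (ℂ × ℂ)

namespace Bicomplex

/-- `u + 𝐣 v`. -/
def ofParts (u v : ℂ) : Bicomplex := WithLp.toLp 2 (u, v)

/-- The scalar part. -/
def sc (W : Bicomplex) : ℂ := W.fst

/-- The vectorial part. -/
def vec (W : Bicomplex) : ℂ := W.snd

theorem ext' {W V : Bicomplex} (h₁ : W.sc = V.sc) (h₂ : W.vec = V.vec) : W = V :=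
  WithLp.ofLp_injective 2 (Prod.ext h₁ h₂)

instance : Mul Bicomplex :=
  ⟨fun W V => ofParts (W.sc * V.sc - W.vec * V.vec) (W.sc * V.vec + W.vec * V.sc)⟩

instance : One Bicomplex := ⟨ofParts 1 0⟩

theorem sc_mul (W V : Bicomplex) : (W * V).sc = W.sc * V.sc - W.vec * V.vec := rfl
theorem vec_mul (W V : Bicomplex) : (W * V).vec = W.sc * V.vec + W.vec * V.sc := rfl
theorem sc_one : (1 : Bicomplex).sc = 1 := rfl
theorem vec_one : (1 : Bicomplex).vec = 0 := rfl
theorem sc_zero : (0 : Bicomplex).sc = 0 := rfl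
theorem vec_zero : (0 : Bicomplex).vec = 0 := rfl
theorem sc_add (W V : Bicomplex) : (W + V).sc = W.sc + V.sc := rfl
theorem vec_add (W V : Bicomplex) : (W + V).vec = W.vec + V.vec := rfl
theorem sc_smul (c : ℂ) (W : Bicomplex) : (c • W).sc = c * W.sc := rfl
theorem vec_smul (c : ℂ) (W : Bicomplex) : (c • W).vec = c * W.vec := rfl

instance : CommRing Bicomplex :=
  { (inferInstance : AddCommGroup Bicomplex) with
    mul := (· * ·)
    one := 1
    mul_assoc := fun a b c => by
      apply ext' <;> simp only [sc_mul, vec_mul] <;> ring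
    one_mul := fun a => by
      apply ext' <;> simp only [sc_mul, vec_mul, sc_one, vec_one] <;> ring
    mul_one := fun a => by
      apply ext' <;> simp only [sc_mul, vec_mul, sc_one, vec_one] <;> ring
    zero_mul := fun a => by
      apply ext' <;> simp only [sc_mul, vec_mul, sc_zero, vec_zero] <;> ring
    mul_zero := fun a => by
      apply ext' <;> simp only [sc_mul, vec_mul, sc_zero, vec_zero] <;> ring
    left_distrib := fun a b c => by
      apply ext' <;> simp only [sc_mul, vec_mul, sc_add, vec_add] <;> ring
    right_distrib := fun a b c => by
      apply ext' <;> simp only [sc_mul, vec_mul, sc_add, vec_add] <;> ring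
    mul_comm := fun a b => by
      apply ext' <;> simp only [sc_mul, vec_mul] <;> ring }

/-- The unit `𝐣`, with `𝐣² = -1`. -/
def j : Bicomplex := ofParts 0 1

/-- The bicomplex conjugate `u - 𝐣 v`. -/
def bar (W : Bicomplex) : Bicomplex := ofParts W.sc (-W.vec)

/-- The involution `u* - 𝐣 v*`. -/
def dagger (W : Bicomplex) : Bicomplex :=
  ofParts (starRingEnd ℂ W.sc) (-(starRingEnd ℂ W.vec))

/-- The complex inner product `⟨W, V⟩ = Sc (W V†)`, linear in the first argument. -/
def pairing (W V : Bicomplex) : ℂ := (W * dagger V).sc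

/-- It is the inner product carried by `Bicomplex`, which Mathlib makes linear in the
second argument. -/
theorem pairing_eq_inner (W V : Bicomplex) : pairing W V = inner ℂ V W := by
  rw [WithLp.prod_inner_apply]
  change W.sc * starRingEnd ℂ V.sc - W.vec * -(starRingEnd ℂ V.vec) =
    W.sc * starRingEnd ℂ V.sc + W.vec * starRingEnd ℂ V.vec
  ring

/-- `ẑ = x + 𝐣 y` for `z = x + i y`. -/
def hat (z : ℂ) : Bicomplex := ofParts (z.re : ℂ) (z.im : ℂ)

/-- The bicomplex Cauchy–Riemann operator `½ (∂/∂x + 𝐣 ∂/∂y)`. -/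
def dbar (W : ℂ → Bicomplex) (z : ℂ) : Bicomplex :=
  (1 / 2 : ℂ) • (fderiv ℝ W z 1 + j * fderiv ℝ W z Complex.I)

theorem mul_smul' (c : ℂ) (W V : Bicomplex) : W * (c • V) = c • (W * V) := by
  apply ext' <;> simp only [sc_mul, vec_mul, sc_smul, vec_smul] <;> ring

theorem bar_add (W V : Bicomplex) : bar (W + V) = bar W + bar V := by
  apply ext'
  · rfl
  · change -(W.vec + V.vec) = -W.vec + -V.vec
    ring

theorem bar_smul (c : ℂ) (W : Bicomplex) : bar (c • W) = c • bar W := by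
  apply ext'
  · rfl
  · change -(c * W.vec) = c * -W.vec
    ring

theorem dbar_add {W V : ℂ → Bicomplex} {z : ℂ} (hW : DifferentiableAt ℝ W z)
    (hV : DifferentiableAt ℝ V z) : dbar (W + V) z = dbar W z + dbar V z := by
  unfold dbar
  rw [fderiv_add hW hV, ← smul_add]
  congr 1
  change _ + j * (fderiv ℝ W z Complex.I + fderiv ℝ V z Complex.I) = _
  rw [mul_add]
  exact add_add_add_comm _ _ _ _

theorem dbar_smul {W : ℂ → Bicomplex} {z : ℂ} (c : ℂ) (hW : DifferentiableAt ℝ W z) :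
    dbar (c • W) z = c • dbar W z := by
  unfold dbar
  rw [fderiv_const_smul hW]
  change (1 / 2 : ℂ) • (c • fderiv ℝ W z 1 + j * (c • fderiv ℝ W z Complex.I)) = _
  rw [mul_smul', ← smul_add, smul_comm]

end Bicomplex

open Bicomplex

/-- Lebesgue measure on the disk of radius `ρ` about `0`. -/
abbrev diskMeasure (ρ : ℝ) : Measure ℂ := volume.restrict (Metric.ball (0 : ℂ) ρ)

/-- `⟨F, G⟩` in `L₂(B_ρ(0); 𝔹)`. -/
def l2Inner (ρ : ℝ) (F G : ℂ → Bicomplex) : ℂ :=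
  ∫ z, pairing (F z) (G z) ∂diskMeasure ρ

/-- `‖F‖` in `L₂(B_ρ(0); 𝔹)`. -/
def l2Norm (ρ : ℝ) (F : ℂ → Bicomplex) : ℝ :=
  Real.sqrt (∫ z, ‖F z‖ ^ 2 ∂diskMeasure ρ)

/-- `W` is a `C¹` solution on `B_ρ(0)` of the main Vekua equation
`∂̄W = (∂̄f / f) W̄` with the radial coefficient `f(|z|)`. -/
def IsVekuaSolution (f : ℝ → ℂ) (ρ : ℝ) (W : ℂ → Bicomplex) : Prop :=
  ContDiffOn ℝ 1 W (Metric.ball 0 ρ) ∧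
    ∀ z ∈ Metric.ball (0 : ℂ) ρ,
      dbar W z = (f ‖z‖)⁻¹ • (dbar (fun w => ofParts (f ‖w‖) 0) z * bar (W z))

/-- The pseudoanalytic Bergman space of square integrable solutions, as a complex subspace
of `L₂(B_ρ(0); 𝔹)`. -/
def bergmanSpace (f : ℝ → ℂ) (ρ : ℝ) : Submodule ℂ (Lp Bicomplex 2 (diskMeasure ρ)) where
  carrier := {F | ∃ W : ℂ → Bicomplex, IsVekuaSolution f ρ W ∧ F =ᵐ[diskMeasure ρ] W}
  zero_mem' := by
    refine ⟨0, ⟨contDiffOn_const, fun z _ => ?_⟩, Lp.coeFn_zero _ _ _⟩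
    have h1 : dbar (0 : ℂ → Bicomplex) z = 0 := by
      have := dbar_smul (W := (0 : ℂ → Bicomplex)) (z := z) 0 (differentiableAt_const _)
      simpa using this
    have h2 : bar ((0 : ℂ → Bicomplex) z) = 0 := by
      simpa using bar_smul 0 (0 : Bicomplex)
    rw [h1, h2, mul_zero, smul_zero]
  add_mem' := by
    rintro F G ⟨W, ⟨hW, hW'⟩, hFW⟩ ⟨V, ⟨hV, hV'⟩, hGV⟩
    refine ⟨W + V, ⟨hW.add hV, fun z hz => ?_⟩, ?_⟩
    · have hn := Metric.isOpen_ball.mem_nhds hz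
      rw [dbar_add ((hW.differentiableOn one_ne_zero).differentiableAt hn)
        ((hV.differentiableOn one_ne_zero).differentiableAt hn), hW' z hz, hV' z hz,
        Pi.add_apply, bar_add, mul_add, smul_add]
    · filter_upwards [Lp.coeFn_add F G, hFW, hGV] with z h1 h2 h3
      rw [h1, Pi.add_apply, h2, h3, Pi.add_apply]
  smul_mem' := by
    rintro c F ⟨W, ⟨hW, hW'⟩, hFW⟩
    refine ⟨c • W, ⟨hW.const_smul c, fun z hz => ?_⟩, ?_⟩
    · have hn := Metric.isOpen_ball.mem_nhds hz
      rw [dbar_smul c ((hW.differentiableOn one_ne_zero).differentiableAt hn), hW' z hz,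
        Pi.smul_apply, bar_smul, mul_smul', smul_comm]
    · filter_upwards [Lp.coeFn_smul c F, hFW] with z h1 h2
      rw [h1, Pi.smul_apply, h2, Pi.smul_apply]

/-- The Darboux transformed potential `q_{1/f} = 2 (f'/f)² - q_f` on `[0, ρ]`. -/
def darbouxPotential (f q : ℝ → ℂ) (ρ : ℝ) (r : ℝ) : ℂ :=
  2 * (derivWithin f (Icc 0 ρ) r / f r) ^ 2 - q r

/-- `G` is the kernel of the transmutation operator for the radial potential `q` on `[0, ρ]`:
`r (G_rr - q G) - G_r + 2 (1 - t) G_rt = 0`, `G(r, 0) = ∫₀^r τ q(τ) dτ`, `G(0, t) = 0`.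
It is `C²` inside the rectangle and continuous up to the boundary: for a potential that is no
better than `C¹` (for instance `q(r) = 1 + r`) it is not differentiable at `t = 1`. -/
structure IsTransmutationKernel (q : ℝ → ℂ) (ρ : ℝ) (G : ℝ → ℝ → ℂ) : Prop where
  continuousOn : ContinuousOn (Function.uncurry G) (Icc 0 ρ ×ˢ Icc 0 1)
  contDiffOn : ContDiffOn ℝ 2 (Function.uncurry G) (Ioo 0 ρ ×ˢ Ioo 0 1)
  pde : ∀ r ∈ Ioo 0 ρ, ∀ t ∈ Ioo (0 : ℝ) 1,
    (r : ℂ) * (deriv (deriv fun s => G s t) r - q r * G r t) - deriv (fun s => G s t) r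
      + 2 * (1 - (t : ℂ)) * deriv (fun τ => deriv (fun s => G s τ) r) t = 0
  init_t : ∀ r ∈ Icc 0 ρ, G r 0 = ∫ τ in (0 : ℝ)..r, (τ : ℂ) * q τ
  init_r : ∀ t ∈ Icc (0 : ℝ) 1, G 0 t = 0

/-- The transmutation kernel for the potential `q` on `[0, ρ]`. -/
def transmutationKernel (q : ℝ → ℂ) (ρ : ℝ) : ℝ → ℝ → ℂ :=
  Classical.epsilon (IsTransmutationKernel q ρ)

/-- The operator `𝐓 h(z) = h(z) + ∫₀¹ σ G(|z|, 1 - σ²) h(σ² z) dσ`. -/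
def transmute (q : ℝ → ℂ) (ρ : ℝ) (h : ℂ → ℂ) (z : ℂ) : ℂ :=
  h z + ∫ σ in (0 : ℝ)..1,
    (σ : ℂ) * transmutationKernel q ρ ‖z‖ (1 - σ ^ 2) * h ((σ : ℂ) ^ 2 * z)

/-- The operator `𝒯_f = 𝐓_f Sc + 𝐣 𝐓_{1/f} Vec`, where `q` is the potential of `f`. -/
def vekuaTransmute (f q : ℝ → ℂ) (ρ : ℝ) (W : ℂ → Bicomplex) (z : ℂ) : Bicomplex :=
  ofParts (transmute q ρ (fun w => (W w).sc) z)
    (transmute (darbouxPotential f q ρ) ρ (fun w => (W w).vec) z)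

/-- The radial formal power `𝒵_f^{(n)}(Λ; z) = 𝒯_f[Λ ẑⁿ](z)`. -/
def formalPower (f q : ℝ → ℂ) (ρ : ℝ) (n : ℕ) (Λ : Bicomplex) : ℂ → Bicomplex :=
  vekuaTransmute f q ρ fun w => Λ * hat w ^ n

/-- `y` is the regular solution on `[0, ρ]` of the perturbed Bessel equation
`-y'' + (n - 1/2)(n + 1/2) r⁻² y + q y = 0`, normalised by
`y ~ r^{n+1/2}` and `y' ~ (n + 1/2) r^{n-1/2}` as `r → 0+`. -/
structure IsRegularBesselSolution (q : ℝ → ℂ) (ρ : ℝ) (n : ℕ) (y : ℝ → ℂ) : Prop where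
  continuousOn : ContinuousOn y (Icc 0 ρ)
  contDiffOn : ContDiffOn ℝ 2 y (Ioo 0 ρ)
  ode : ∀ r ∈ Ioo 0 ρ,
    -deriv (deriv y) r + ((n : ℂ) - 1 / 2) * ((n : ℂ) + 1 / 2) / (r : ℂ) ^ 2 * y r
      + q r * y r = 0
  asymp : Tendsto (fun r : ℝ => y r / ((r ^ ((n : ℝ) + 1 / 2) : ℝ) : ℂ)) (𝓝[>] 0) (𝓝 1)
  asymp_deriv : Tendsto
    (fun r : ℝ => deriv y r / ((((n : ℝ) + 1 / 2) * r ^ ((n : ℝ) - 1 / 2) : ℝ) : ℂ))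
    (𝓝[>] 0) (𝓝 1)

/-- The regular solution of the perturbed Bessel equation. -/
def besselSolution (q : ℝ → ℂ) (ρ : ℝ) (n : ℕ) : ℝ → ℂ :=
  Classical.epsilon (IsRegularBesselSolution q ρ n)

/-- `φ^{(n)}(r) = y_n(r) / r^{n+1/2}`. -/
def phi (q : ℝ → ℂ) (ρ : ℝ) (n : ℕ) (r : ℝ) : ℂ :=
  besselSolution q ρ n r / ((r ^ ((n : ℝ) + 1 / 2) : ℝ) : ℂ)

/-- The squared norm of `g` in `L₂(0, ρ; r^k dr)`. -/
def weightedNormSq (ρ : ℝ) (k : ℕ) (g : ℝ → ℂ) : ℝ :=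
  ∫ r in (0 : ℝ)..ρ, ‖g r‖ ^ 2 * r ^ k

/-- The potential `q` determines its transmutation kernel and its regular Bessel solutions:
each exists and is unique on its domain. -/
def WellDefined (q : ℝ → ℂ) (ρ : ℝ) : Prop :=
  (IsTransmutationKernel q ρ (transmutationKernel q ρ) ∧
    ∀ G, IsTransmutationKernel q ρ G →
      ∀ r ∈ Icc 0 ρ, ∀ t ∈ Icc (0 : ℝ) 1, G r t = transmutationKernel q ρ r t) ∧
  ∀ n, IsRegularBesselSolution q ρ n (besselSolution q ρ n) ∧
    ∀ y, IsRegularBesselSolution q ρ n y → ∀ r ∈ Icc 0 ρ, y r = besselSolution q ρ n r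

end

/-! ### Weighted contractions and smoothness of iterated integrals. -/

section Analysis

/-! On a function with h(s²z) = s²ⁿ h(z), the operator 𝐓_g is multiplication by a radial factor
φ(|z|), where φ(r) = 1 + ∫₀¹ σ²ⁿ⁺¹ G^g(r, 1 - σ²) dσ. Integrating the equation of the kernel gives
φ'' + (2n+1)φ'/r = q_g φ with φ(0) = 1, so φ is φ_g^{(n)}. Since z ↦ ẑ is multiplicative and sends i
to 𝐣, Λẑⁿ is the image of c zⁿ with c = 1 or c = i. Hence the formal power is φ_f^{(n)}(|z|) Re(c
zⁿ) + 𝐣 φ_{1/f}^{(n)}(|z|) Im(c zⁿ) (`formalPower_eq`), and everything else is about these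
functions.

The kernel. Put σ = √(1 - t), x = 1/σ, y = rσ. Then E = σ²G solves the Goursat problem E_xy = P(xy)
E with P(s) = s q(s), E(1, y) = ∫₀^y P and E(x, 0) = 0. Its integral equation gives interior
regularity and uniqueness. The edge t = 1 is sent to x = ∞, so continuity up to that edge comes from
the same equation rewritten for g = G/r² in the variables (r, σ), where it is a contraction
(`radialMap`). The moments of the kernel are computed from that integral equation, so no derivative
at t = 1 is used.

The Vekua equation. For functions of the above form it reduces to the first order system r(φ' -
(f'/f)φ) = n(ψ - φ), r(ψ' + (f'/f)ψ) = n(φ - ψ). This is the Darboux transformation between the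
potentials q_f and q_{1/f} (`IsRadialCoefficient.system`). Orthogonality is then orthogonality of
trigonometric functions; degree zero is exceptional because Im 1 = 0 and Re i = 0.

Completeness. The Fourier coefficients on circles of any solution W satisfy the same system. They
are bounded at the origin, which leaves only the multiples of (rⁿφ, rⁿψ)
(`IsVekuaSolution.exists_means_eq`; in degree zero the two equations decouple). The inner product of
W with a formal power is such a multiple times a positive norm, so a solution orthogonal to all
formal powers has no Fourier coefficients and vanishes.

That the Bergman space is closed in L₂ is obtained from the basis rather than from interior
estimates. The norms of the formal powers are at least ερⁿ/(n+1), so a normalised series with square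
summable coefficients converges locally uniformly together with its derivatives, and its sum is a
solution. Thus the isometric image of ℓ² lies in the space; conversely an element minus its
projection onto that image is orthogonal to all powers, hence zero (`completeSpace_bergmanSpace`).
-/

/-- Contraction principle for continuous functions in a weighted supremum norm. -/
theorem exists_fixedPoint_of_weighted_contraction {X : Type*} [TopologicalSpace X]
    {w : X → ℝ} (hw : Continuous w) (hpos : ∀ x, 0 < w x) {K : (X → ℂ) → X → ℂ}
    (hKc : ∀ u, Continuous u → (∃ N, ∀ x, ‖u x‖ ≤ N * w x) → Continuous (K u))
    (hK0 : ∃ N, ∀ x, ‖K 0 x‖ ≤ N * w x)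
    (hKd : ∀ u v N, Continuous u → Continuous v → (∃ M, ∀ x, ‖u x‖ ≤ M * w x) →
      (∃ M, ∀ x, ‖v x‖ ≤ M * w x) → (∀ x, ‖u x - v x‖ ≤ N * w x) →
      ∀ x, ‖K u x - K v x‖ ≤ N / 2 * w x) :
    ∃ u, Continuous u ∧ (∃ N, ∀ x, ‖u x‖ ≤ N * w x) ∧ K u = u := by
  classical
  have hbd : ∀ u, Continuous u → (∃ N, ∀ x, ‖u x‖ ≤ N * w x) →
      ∃ N, ∀ x, ‖K u x‖ ≤ N * w x := by
    rintro u hu ⟨N, hN⟩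
    obtain ⟨N0, hN0⟩ := hK0
    refine ⟨N / 2 + N0, fun x => ?_⟩
    have h1 := hKd u 0 N hu continuous_const ⟨N, hN⟩
      ⟨0, fun x => by simp⟩ (fun x => by simpa using hN x) x
    calc ‖K u x‖ = ‖(K u x - K 0 x) + K 0 x‖ := by congr 1; ring
      _ ≤ ‖K u x - K 0 x‖ + ‖K 0 x‖ := norm_add_le _ _
      _ ≤ N / 2 * w x + N0 * w x := add_le_add h1 (hN0 x)
      _ = _ := by ring
  let up : BoundedContinuousFunction X ℂ → X → ℂ := fun g x => (w x : ℂ) * g x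
  have upc : ∀ g, Continuous (up g) := fun g =>
    (Complex.continuous_ofReal.comp hw).mul g.continuous
  have upn : ∀ g x, ‖up g x‖ = w x * ‖g x‖ := fun g x => by
    simp [up, abs_of_pos (hpos x)]
  have upb : ∀ g, ∃ N, ∀ x, ‖up g x‖ ≤ N * w x := fun g =>
    ⟨‖g‖, fun x => by
      rw [upn, mul_comm]; exact mul_le_mul_of_nonneg_right (g.norm_coe_le_norm x) (hpos x).le⟩
  have dnc : ∀ u, Continuous u → Continuous fun x => (w x : ℂ)⁻¹ * u x := fun u hu =>
    ((Complex.continuous_ofReal.comp hw).inv₀ (fun x => by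
      simpa using (hpos x).ne')).mul hu
  have dnb : ∀ (u : X → ℂ) (N : ℝ), (∀ x, ‖u x‖ ≤ N * w x) → ∀ x, ‖(w x : ℂ)⁻¹ * u x‖ ≤ N := by
    intro u N h x
    rw [norm_mul, norm_inv, Complex.norm_real, Real.norm_eq_abs, abs_of_pos (hpos x),
      inv_mul_le_iff₀ (hpos x), mul_comm]
    exact h x
  -- Conjugating `K` by multiplication by `w` turns the weighted norm into the ordinary supremum
  -- norm.
  let Φ : BoundedContinuousFunction X ℂ → BoundedContinuousFunction X ℂ := fun g =>
    BoundedContinuousFunction.ofNormedAddCommGroup (fun x => (w x : ℂ)⁻¹ * K (up g) x)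
      (dnc _ (hKc _ (upc g) (upb g))) (Classical.choose (hbd _ (upc g) (upb g)))
      (dnb _ _ (Classical.choose_spec (hbd _ (upc g) (upb g))))
  have hΦ : ContractingWith (1 / 2) Φ := by
    refine ⟨by rw [← NNReal.coe_lt_coe]; norm_num, LipschitzWith.of_dist_le_mul fun g h => ?_⟩
    rw [BoundedContinuousFunction.dist_le (by positivity)]
    intro x
    have h1 := hKd (up g) (up h) (dist g h) (upc g) (upc h) (upb g) (upb h) (fun y => by
      have : up g y - up h y = up (g - h) y := by simp [up, mul_sub]
      rw [this, upn, mul_comm, dist_eq_norm]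
      exact mul_le_mul_of_nonneg_right ((g - h).norm_coe_le_norm y) (hpos y).le)
    have h2 := dnb (fun y => K (up g) y - K (up h) y) _ h1 x
    rw [dist_eq_norm]
    change ‖(w x : ℂ)⁻¹ * K (up g) x - (w x : ℂ)⁻¹ * K (up h) x‖ ≤ _
    rw [← mul_sub]
    refine h2.trans (le_of_eq ?_)
    simp; ring
  have : Nonempty (BoundedContinuousFunction X ℂ) := ⟨0⟩
  obtain ⟨g, hg⟩ : ∃ g, Φ g = g := ⟨_, hΦ.fixedPoint_isFixedPt⟩
  refine ⟨up g, upc g, upb g, funext fun x => ?_⟩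
  have h1 : (w x : ℂ)⁻¹ * K (up g) x = g x := congrArg (fun h => h x) hg
  have h2 : (w x : ℂ) ≠ 0 := by simpa using (hpos x).ne'
  simp only [up]
  rw [← h1, mul_inv_cancel_left₀ h2]

/-- A function on the plane with continuous partial derivatives is differentiable. -/
theorem hasFDerivAt_of_continuous_partials {F f₁ f₂ : ℝ × ℝ → ℂ}
    (h₁ : ∀ x y, HasDerivAt (fun x => F (x, y)) (f₁ (x, y)) x)
    (h₂ : ∀ x y, HasDerivAt (fun y => F (x, y)) (f₂ (x, y)) y)
    (c₁ : Continuous f₁) (c₂ : Continuous f₂) (p : ℝ × ℝ) :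
    HasFDerivAt F ((ContinuousLinearMap.toSpanSingleton ℝ (f₁ p)).coprod
      (ContinuousLinearMap.toSpanSingleton ℝ (f₂ p))) p := by
  have key := hasStrictFDerivAt_uncurry_coprod (𝕜 := ℝ) (u := p) (f := fun x y => F (x, y))
    (f₁ := fun x y => ContinuousLinearMap.toSpanSingleton ℝ (f₁ (x, y)))
    (f₂ := fun x y => ContinuousLinearMap.toSpanSingleton ℝ (f₂ (x, y)))
    (Eventually.of_forall fun v => (h₁ v.1 v.2).hasFDerivAt)
    (Eventually.of_forall fun v => (h₂ v.1 v.2).hasFDerivAt)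
    (((ContinuousLinearMap.toSpanSingletonCLE (𝕜 := ℝ) (E := ℂ)).continuous.comp
      c₁).continuousAt)
    (((ContinuousLinearMap.toSpanSingletonCLE (𝕜 := ℝ) (E := ℂ)).continuous.comp
      c₂).continuousAt)
  exact key.hasFDerivAt

/-- If the partial derivatives are `Cⁿ` then the function is `Cⁿ⁺¹`. -/
theorem contDiff_succ_of_partials {F f₁ f₂ : ℝ × ℝ → ℂ} {n : ℕ}
    (h₁ : ∀ x y, HasDerivAt (fun x => F (x, y)) (f₁ (x, y)) x)
    (h₂ : ∀ x y, HasDerivAt (fun y => F (x, y)) (f₂ (x, y)) y)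
    (c₁ : ContDiff ℝ n f₁) (c₂ : ContDiff ℝ n f₂) : ContDiff ℝ (n + 1) F := by
  have hd := hasFDerivAt_of_continuous_partials h₁ h₂ c₁.continuous c₂.continuous
  rw [contDiff_succ_iff_hasFDerivAt]
  refine ⟨_, ?_, hd⟩
  have e : (fun p => (ContinuousLinearMap.toSpanSingleton ℝ (f₁ p)).coprod
      (ContinuousLinearMap.toSpanSingleton ℝ (f₂ p))) =
      fun p => (ContinuousLinearMap.toSpanSingletonCLE (𝕜 := ℝ) (E := ℂ) (f₁ p)).comp
        (ContinuousLinearMap.fst ℝ ℝ ℝ) +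
        (ContinuousLinearMap.toSpanSingletonCLE (𝕜 := ℝ) (E := ℂ) (f₂ p)).comp
        (ContinuousLinearMap.snd ℝ ℝ ℝ) := by
    funext p
    ext <;> simp
  rw [e]
  have hc := (ContinuousLinearMap.toSpanSingletonCLE (𝕜 := ℝ) (E := ℂ)).contDiff (n := n)
  exact ((hc.comp c₁).clm_comp contDiff_const).add ((hc.comp c₂).clm_comp contDiff_const)

variable {H : ℝ × ℝ → ℂ}

/-- The double integral `∫₀^y ∫₁^x H`. -/
noncomputable def doubleIntegral (H : ℝ × ℝ → ℂ) (p : ℝ × ℝ) : ℂ :=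
  ∫ y in (0 : ℝ)..p.2, ∫ x in (1 : ℝ)..p.1, H (x, y)

theorem continuous_integral_fst (hH : Continuous H) :
    Continuous fun p : ℝ × ℝ => ∫ x in (1 : ℝ)..p.1, H (x, p.2) :=
  intervalIntegral.continuous_parametric_intervalIntegral_of_continuous
    (f := fun (p : ℝ × ℝ) x => H (x, p.2)) (by fun_prop) continuous_fst

theorem continuous_integral_snd (hH : Continuous H) :
    Continuous fun p : ℝ × ℝ => ∫ y in (0 : ℝ)..p.2, H (p.1, y) :=
  intervalIntegral.continuous_parametric_intervalIntegral_of_continuous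
    (f := fun (p : ℝ × ℝ) y => H (p.1, y)) (by fun_prop) continuous_snd

theorem continuous_doubleIntegral (hH : Continuous H) : Continuous (doubleIntegral H) :=
  intervalIntegral.continuous_parametric_intervalIntegral_of_continuous
    (f := fun (p : ℝ × ℝ) y => ∫ x in (1 : ℝ)..p.1, H (x, y))
    ((continuous_integral_fst hH).comp (by fun_prop :
      Continuous fun q : (ℝ × ℝ) × ℝ => (q.1.1, q.2))) continuous_snd

theorem doubleIntegral_swap (hH : Continuous H) (p : ℝ × ℝ) :
    doubleIntegral H p = ∫ x in (1 : ℝ)..p.1, ∫ y in (0 : ℝ)..p.2, H (x, y) := by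
  unfold doubleIntegral
  rw [intervalIntegral_intervalIntegral_swap]
  have : Continuous (Function.uncurry fun y x => H (x, y)) := by
    change Continuous fun q : ℝ × ℝ => H (q.2, q.1)
    fun_prop
  refine (this.continuousOn.integrableOn_compact
    (isCompact_uIcc.prod isCompact_uIcc) (K := uIcc 0 p.2 ×ˢ uIcc 1 p.1)).mono_set ?_
  exact prod_mono uIoc_subset_uIcc uIoc_subset_uIcc

theorem hasDerivAt_doubleIntegral_fst (hH : Continuous H) (x y : ℝ) :
    HasDerivAt (fun x => doubleIntegral H (x, y)) (∫ t in (0 : ℝ)..y, H (x, t)) x := by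
  simp_rw [doubleIntegral_swap hH]
  have hc : Continuous fun x => ∫ t in (0 : ℝ)..y, H (x, t) :=
    (continuous_integral_snd hH).comp (by fun_prop : Continuous fun x : ℝ => (x, y))
  exact intervalIntegral.integral_hasDerivAt_right (hc.intervalIntegrable _ _)
    (hc.stronglyMeasurableAtFilter _ _) hc.continuousAt

theorem hasDerivAt_doubleIntegral_snd (hH : Continuous H) (x y : ℝ) :
    HasDerivAt (fun y => doubleIntegral H (x, y)) (∫ t in (1 : ℝ)..x, H (t, y)) y := by
  have hc : Continuous fun y => ∫ t in (1 : ℝ)..x, H (t, y) :=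
    (continuous_integral_fst hH).comp (by fun_prop : Continuous fun y : ℝ => (x, y))
  exact intervalIntegral.integral_hasDerivAt_right (hc.intervalIntegrable _ _)
    (hc.stronglyMeasurableAtFilter _ _) hc.continuousAt

theorem contDiff_one_doubleIntegral (hH : Continuous H) : ContDiff ℝ 1 (doubleIntegral H) := by
  have := contDiff_succ_of_partials (n := 0) (hasDerivAt_doubleIntegral_fst hH)
    (hasDerivAt_doubleIntegral_snd hH)
    (contDiff_zero.2 (continuous_integral_snd hH)) (contDiff_zero.2 (continuous_integral_fst hH))
  simpa using this

theorem contDiff_one_primitive {h : ℝ → ℂ} (hh : Continuous h) (a : ℝ) :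
    ContDiff ℝ 1 fun x => ∫ t in a..x, h t := by
  rw [contDiff_one_iff_deriv]
  have hd : ∀ x, HasDerivAt (fun x => ∫ t in a..x, h t) (h x) x := fun x =>
    intervalIntegral.integral_hasDerivAt_right (hh.intervalIntegrable _ _)
      (hh.stronglyMeasurableAtFilter _ _) hh.continuousAt
  exact ⟨fun x => (hd x).differentiableAt, by
    rw [show deriv (fun x => ∫ t in a..x, h t) = h from funext fun x => (hd x).deriv]; exact hh⟩

/-- Expanding H(x, y) = H(x, 0) + ∫₀^y ∂_yH reduces the claim to a primitive of one variable and a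
double integral of a continuous function, both already C¹. -/
theorem contDiff_one_integral_fst (hH : ContDiff ℝ 1 H) :
    ContDiff ℝ 1 fun p : ℝ × ℝ => ∫ x in (1 : ℝ)..p.1, H (x, p.2) := by
  have hfd := hH.continuous_fderiv one_ne_zero
  let D : ℝ × ℝ → ℂ := fun p => fderiv ℝ H p (0, 1)
  have hD : Continuous D := hfd.clm_apply continuous_const
  have hder : ∀ x y, HasDerivAt (fun y => H (x, y)) (D (x, y)) y := fun x y => by
    have h1 := (hH.differentiable one_ne_zero (x, y)).hasFDerivAt
    exact h1.comp_hasDerivAt y ((hasDerivAt_const y x).prodMk (hasDerivAt_id y))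
  have e : (fun p : ℝ × ℝ => ∫ x in (1 : ℝ)..p.1, H (x, p.2)) =
      fun p => (∫ x in (1 : ℝ)..p.1, H (x, 0)) + doubleIntegral D p := by
    funext p
    rw [doubleIntegral_swap hD, ← intervalIntegral.integral_add]
    · refine intervalIntegral.integral_congr fun x _ => ?_
      have := intervalIntegral.integral_eq_sub_of_hasDerivAt (a := 0) (b := p.2)
        (fun y _ => hder x y) ((by fun_prop : Continuous fun y => D (x, y)).intervalIntegrable _ _)
      simp only [this]; ring
    · exact (hH.continuous.comp (by fun_prop : Continuous fun x : ℝ => (x, (0 : ℝ)))).intervalIntegrable _ _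
    · exact ((continuous_integral_snd hD).comp
        (by fun_prop : Continuous fun x : ℝ => (x, p.2))).intervalIntegrable _ _
  rw [e]
  refine ContDiff.add ?_ (contDiff_one_doubleIntegral hD)
  exact (contDiff_one_primitive (hH.continuous.comp
    (by fun_prop : Continuous fun x : ℝ => (x, (0 : ℝ)))) 1).comp contDiff_fst

theorem contDiff_one_integral_snd (hH : ContDiff ℝ 1 H) :
    ContDiff ℝ 1 fun p : ℝ × ℝ => ∫ y in (0 : ℝ)..p.2, H (p.1, y) := by
  have hfd := hH.continuous_fderiv one_ne_zero
  let D : ℝ × ℝ → ℂ := fun p => fderiv ℝ H p (1, 0)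
  have hD : Continuous D := hfd.clm_apply continuous_const
  have hder : ∀ x y, HasDerivAt (fun x => H (x, y)) (D (x, y)) x := fun x y => by
    have h1 := (hH.differentiable one_ne_zero (x, y)).hasFDerivAt
    exact h1.comp_hasDerivAt x ((hasDerivAt_id x).prodMk (hasDerivAt_const x y))
  have e : (fun p : ℝ × ℝ => ∫ y in (0 : ℝ)..p.2, H (p.1, y)) =
      fun p => (∫ y in (0 : ℝ)..p.2, H (1, y)) + doubleIntegral D p := by
    funext p
    unfold doubleIntegral
    rw [← intervalIntegral.integral_add]
    · refine intervalIntegral.integral_congr fun y _ => ?_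
      have := intervalIntegral.integral_eq_sub_of_hasDerivAt (a := 1) (b := p.1)
        (fun x _ => hder x y) ((by fun_prop : Continuous fun x => D (x, y)).intervalIntegrable _ _)
      simp only [this]; ring
    · exact (hH.continuous.comp (by fun_prop : Continuous fun y : ℝ => ((1 : ℝ), y))).intervalIntegrable _ _
    · exact ((continuous_integral_fst hD).comp
        (by fun_prop : Continuous fun y : ℝ => (p.1, y))).intervalIntegrable _ _
  rw [e]
  refine ContDiff.add ?_ (contDiff_one_doubleIntegral hD)
  exact (contDiff_one_primitive (hH.continuous.comp
    (by fun_prop : Continuous fun y : ℝ => ((1 : ℝ), y))) 0).comp contDiff_snd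

/-- The partial derivatives are single integrals of `H`, which are only as smooth as `H`; so the
double integral gains exactly the one derivative used to bootstrap the Goursat solution. -/
theorem contDiff_two_doubleIntegral (hH : ContDiff ℝ 1 H) : ContDiff ℝ 2 (doubleIntegral H) := by
  have := contDiff_succ_of_partials (n := 1) (hasDerivAt_doubleIntegral_fst hH.continuous)
    (hasDerivAt_doubleIntegral_snd hH.continuous)
    (by exact_mod_cast contDiff_one_integral_snd hH) (by exact_mod_cast contDiff_one_integral_fst hH)
  exact_mod_cast this

end Analysis

/-! ### The Goursat problem E_xy = P(xy) E. -/

section Goursat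

theorem eq_of_hasDerivAt_eq_zero {f : ℝ → ℂ} {a b : ℝ} (hab : a ≤ b)
    (hc : ContinuousOn f (Icc a b)) (hd : ∀ x ∈ Ioo a b, HasDerivAt f 0 x) : f b = f a := by
  have := intervalIntegral.integral_eq_sub_of_hasDerivAt_of_le hab hc hd (by simp)
  simp at this
  exact (sub_eq_zero.1 this.symm)

/-- The primitive of cosh is sinh and |sinh| ≤ cosh, so every integration gains a factor 1/l. Being
even about the base point, cosh serves on both sides of it, which lets the contraction run on the
whole plane. -/
theorem norm_integral_le_cosh {f : ℝ → ℂ} {c N l : ℝ} (hl : 0 < l) (hN : 0 ≤ N)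
    (hf : ∀ y, ‖f y‖ ≤ N * Real.cosh (l * (y - c))) (x : ℝ) :
    ‖∫ y in c..x, f y‖ ≤ N / l * Real.cosh (l * (x - c)) := by
  have hc : Continuous fun y => N * Real.cosh (l * (y - c)) := by fun_prop
  have h1 := intervalIntegral.norm_integral_le_abs_of_norm_le (μ := volume) (a := c) (b := x)
    (f := f) (Eventually.of_forall hf) (hc.intervalIntegrable c x)
  have h2 : ∫ y in c..x, N * Real.cosh (l * (y - c)) = N / l * Real.sinh (l * (x - c)) := by
    have hd : ∀ y, HasDerivAt (fun y => N / l * Real.sinh (l * (y - c)))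
        (N * Real.cosh (l * (y - c))) y := fun y => by
      have := (((hasDerivAt_id y).sub_const c).const_mul l).sinh.const_mul (N / l)
      refine this.congr_deriv ?_
      simp; field_simp
    rw [intervalIntegral.integral_eq_sub_of_hasDerivAt (fun y _ => hd y)
      (hc.intervalIntegrable c x)]
    simp
  rw [h2] at h1
  refine h1.trans ?_
  rw [abs_mul, abs_of_nonneg (by positivity : 0 ≤ N / l)]
  refine mul_le_mul_of_nonneg_left ?_ (by positivity)
  rw [abs_le]
  constructor
  · linarith [Real.cosh_add_sinh (l * (x - c)), Real.exp_pos (l * (x - c))]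
  · linarith [Real.cosh_sub_sinh (l * (x - c)), Real.exp_pos (-(l * (x - c)))]

/-- Right-hand side of the integrated Goursat problem `E_{xy} = P(xy) E`, `E(1, y) = ∫₀^y P`,
`E(x, 0) = 0`. -/
noncomputable def goursatMap (P : ℝ → ℂ) (E : ℝ × ℝ → ℂ) (p : ℝ × ℝ) : ℂ :=
  (∫ y in (0 : ℝ)..p.2, P y) + doubleIntegral (fun q => P (q.1 * q.2) * E q) p

theorem continuous_goursatMap {P : ℝ → ℂ} {E : ℝ × ℝ → ℂ} (hP : Continuous P)
    (hE : Continuous E) : Continuous (goursatMap P E) := by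
  refine Continuous.add ?_ (continuous_doubleIntegral (by fun_prop))
  exact (contDiff_one_primitive hP 0).continuous.comp continuous_snd

/-- The Goursat problem has a `C²` solution. -/
theorem exists_goursat_solution {P : ℝ → ℂ} (hP : ContDiff ℝ 1 P) {M : ℝ}
    (hM : ∀ x, ‖P x‖ ≤ M) : ∃ E, ContDiff ℝ 2 E ∧ goursatMap P E = E := by
  have hM0 : 0 ≤ M := (norm_nonneg _).trans (hM 0)
  -- The two integrations give the contraction constant M/l², which is at most 1/2 because 2M ≤ (M +
  -- 2)².
  let l := M + 2
  have hl : 0 < l := by positivity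
  have hPc := hP.continuous
  obtain ⟨E, hEc, -, hE⟩ := exists_fixedPoint_of_weighted_contraction (X := ℝ × ℝ)
    (w := fun p => Real.cosh (l * (p.2 - 0)) * Real.cosh (l * (p.1 - 1)))
    (K := goursatMap P) (by fun_prop)
    (fun x => mul_pos (Real.cosh_pos _) (Real.cosh_pos _))
    (fun u hu _ => continuous_goursatMap hPc hu) (by
      refine ⟨M / l, fun p => ?_⟩
      have h0 : goursatMap P 0 p = ∫ y in (0 : ℝ)..p.2, P y := by
        simp [goursatMap, doubleIntegral]
      rw [h0]
      refine (norm_integral_le_cosh (c := 0) hl hM0 (fun y => ?_) p.2).trans ?_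
      · exact (hM y).trans (le_mul_of_one_le_right hM0 (Real.one_le_cosh _))
      · rw [← mul_assoc]
        exact le_mul_of_one_le_right (mul_nonneg (by positivity) (Real.cosh_pos _).le)
          (Real.one_le_cosh _)) (by
      intro u v N hu hv _ _ h p
      have hN : 0 ≤ N := by
        have := (norm_nonneg _).trans (h (1, 0))
        simpa using this
      have e : goursatMap P u p - goursatMap P v p =
          doubleIntegral (fun q => P (q.1 * q.2) * (u q - v q)) p := by
        unfold goursatMap doubleIntegral
        rw [add_sub_add_left_eq_sub, ← intervalIntegral.integral_sub]
        · refine intervalIntegral.integral_congr fun y _ => ?_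
          simp only
          rw [← intervalIntegral.integral_sub]
          · simp only [mul_sub]
          · exact Continuous.intervalIntegrable (by fun_prop) _ _
          · exact Continuous.intervalIntegrable (by fun_prop) _ _
        · exact ((continuous_integral_fst (H := fun q => P (q.1 * q.2) * u q)
            (by fun_prop)).comp (by fun_prop : Continuous fun y : ℝ => (p.1, y))).intervalIntegrable _ _
        · exact ((continuous_integral_fst (H := fun q => P (q.1 * q.2) * v q)
            (by fun_prop)).comp (by fun_prop : Continuous fun y : ℝ => (p.1, y))).intervalIntegrable _ _
      rw [e]
      have h1 : ∀ y, ‖∫ x in (1 : ℝ)..p.1, P (x * y) * (u (x, y) - v (x, y))‖ ≤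
          (M * N / l * Real.cosh (l * (p.1 - 1))) * Real.cosh (l * (y - 0)) := fun y => by
        refine (norm_integral_le_cosh (c := 1) (N := M * N * Real.cosh (l * (y - 0))) hl
          (by have := Real.cosh_pos (l * (y - 0)); positivity) (fun x => ?_) p.1).trans
          (le_of_eq (by ring))
        rw [norm_mul]
        refine (mul_le_mul (hM _) (h (x, y)) (norm_nonneg _) hM0).trans (le_of_eq (by ring))
      refine (norm_integral_le_cosh (c := 0) hl (by
        have := Real.cosh_pos (l * (p.1 - 1)); positivity) h1 p.2).trans ?_
      have h2 : M * N / l / l ≤ N / 2 := by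
        rw [div_div, div_le_div_iff₀ (by positivity) (by norm_num)]
        have : M * 2 ≤ l * l := by simp only [l]; nlinarith
        nlinarith
      calc _ = M * N / l / l * (Real.cosh (l * (p.2 - 0)) * Real.cosh (l * (p.1 - 1))) := by ring
        _ ≤ _ := mul_le_mul_of_nonneg_right h2
          (mul_pos (Real.cosh_pos _) (Real.cosh_pos _)).le)
  refine ⟨E, ?_, hE⟩
  have hp1 : ContDiff ℝ 1 fun p : ℝ × ℝ => P (p.1 * p.2) :=
    hP.comp (contDiff_fst.mul contDiff_snd)
  have hprim : ContDiff ℝ 2 fun x => ∫ t in (0 : ℝ)..x, P t := by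
    have hd : ∀ x, HasDerivAt (fun x => ∫ t in (0 : ℝ)..x, P t) (P x) x := fun x =>
      intervalIntegral.integral_hasDerivAt_right (hPc.intervalIntegrable _ _)
        (hPc.stronglyMeasurableAtFilter _ _) hPc.continuousAt
    have := (contDiff_succ_iff_deriv (n := 1) (f := fun x => ∫ t in (0 : ℝ)..x, P t)).2
      ⟨fun x => (hd x).differentiableAt, by simp, by
        rw [show deriv (fun x => ∫ t in (0 : ℝ)..x, P t) = P from funext fun x => (hd x).deriv]
        exact hP⟩
    exact_mod_cast this
  -- Bootstrap: a continuous fixed point is C¹, and feeding this back into the double integral makes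
  -- it C².
  have hE1 : ContDiff ℝ 1 E := by
    rw [← hE]
    exact ((contDiff_one_primitive hPc 0).comp contDiff_snd).add
      (contDiff_one_doubleIntegral (by fun_prop))
  rw [← hE]
  exact (hprim.comp contDiff_snd).add (contDiff_two_doubleIntegral (hp1.mul hE1))

/-- The homogeneous Goursat problem has only the zero solution. -/
theorem goursat_unique {P : ℝ → ℂ} {D : ℝ × ℝ → ℂ} {R M : ℝ} (hD : Continuous D)
    (hM : ∀ x, ‖P x‖ ≤ M)
    (h : ∀ x y, 1 ≤ x → 0 ≤ y → x * y ≤ R →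
      D (x, y) = doubleIntegral (fun q => P (q.1 * q.2) * D q) (x, y))
    {x₀ y₀ : ℝ} (hx₀ : 1 ≤ x₀) (hy₀ : 0 ≤ y₀) (hR : x₀ * y₀ ≤ R) : D (x₀, y₀) = 0 := by
  have hM0 : 0 ≤ M := (norm_nonneg _).trans (hM 0)
  obtain ⟨N, hN⟩ := (isCompact_Icc.prod isCompact_Icc :
    IsCompact (Icc 1 x₀ ×ˢ Icc 0 y₀)).exists_bound_of_continuousOn hD.continuousOn
  have hN0 : 0 ≤ N := (norm_nonneg _).trans (hN (1, 0) ⟨⟨le_rfl, hx₀⟩, ⟨le_rfl, hy₀⟩⟩)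
  -- With this rate M x₀/l ≤ 1/2, so each use of the integral equation halves the bound.
  let l := 2 * M * x₀ + 1
  have hl : 0 < l := by positivity
  have key : ∀ k : ℕ, ∀ x ∈ Icc 1 x₀, ∀ y ∈ Icc 0 y₀,
      ‖D (x, y)‖ ≤ N * (1 / 2) ^ k * Real.exp (l * y) := by
    intro k
    induction k with
    | zero =>
      intro x hx y hy
      refine (hN (x, y) ⟨hx, hy⟩).trans ?_
      simp only [pow_zero, mul_one]
      exact le_mul_of_one_le_right hN0 (Real.one_le_exp (mul_nonneg hl.le hy.1))
    | succ k ih =>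
      intro x hx y hy
      -- The rectangle with corners (1, 0) and (x₀, y₀) stays in the region xy ≤ R, so the equation
      -- may be iterated inside it.
      rw [h x y hx.1 hy.1 ((mul_le_mul hx.2 hy.2 hy.1 (by linarith)).trans hR)]
      have hi : ∀ t ∈ Icc 0 y, ‖∫ s in (1 : ℝ)..x, P (s * t) * D (s, t)‖ ≤
          (M * (N * (1 / 2) ^ k) * x₀) * Real.exp (l * t) := fun t ht => by
        have := intervalIntegral.norm_integral_le_of_norm_le_const (a := 1) (b := x)
          (f := fun s => P (s * t) * D (s, t))
          (C := M * (N * (1 / 2) ^ k * Real.exp (l * t))) (fun s hs => by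
            rw [uIoc_of_le hx.1] at hs
            rw [norm_mul]
            exact mul_le_mul (hM _) (ih s ⟨hs.1.le, hs.2.trans hx.2⟩ t
              ⟨ht.1, ht.2.trans hy.2⟩) (norm_nonneg _) hM0)
        refine this.trans ?_
        rw [abs_of_nonneg (by linarith [hx.1])]
        calc M * (N * (1 / 2) ^ k * Real.exp (l * t)) * (x - 1)
            ≤ M * (N * (1 / 2) ^ k * Real.exp (l * t)) * x₀ :=
              mul_le_mul_of_nonneg_left (by linarith [hx.2]) (by positivity)
          _ = _ := by ring
      have hcont : Continuous fun t => (M * (N * (1 / 2) ^ k) * x₀) * Real.exp (l * t) := by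
        fun_prop
      have h1 := intervalIntegral.norm_integral_le_of_norm_le (μ := volume) hy.1
        (f := fun t => ∫ s in (1 : ℝ)..x, P (s * t) * D (s, t))
        (Eventually.of_forall fun t ht => hi t ⟨ht.1.le, ht.2⟩)
        (hcont.intervalIntegrable 0 y)
      have h2 : ∫ t in (0 : ℝ)..y, (M * (N * (1 / 2) ^ k) * x₀) * Real.exp (l * t) =
          (M * (N * (1 / 2) ^ k) * x₀) / l * (Real.exp (l * y) - 1) := by
        rw [intervalIntegral.integral_const_mul, intervalIntegral.integral_comp_mul_left (fun t => Real.exp t) hl.ne', integral_exp]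
        simp
        ring
      refine h1.trans ?_
      rw [h2]
      have h3 : M * (N * (1 / 2) ^ k) * x₀ / l ≤ N * (1 / 2) ^ (k + 1) := by
        rw [div_le_iff₀ hl, pow_succ]
        have : 0 ≤ N * (1 / 2) ^ k := by positivity
        simp only [l]; nlinarith
      exact mul_le_mul h3 (by linarith) (by
        have := Real.one_le_exp (mul_nonneg hl.le hy.1); linarith) (by positivity)
  have hlim : Tendsto (fun k : ℕ => N * (1 / 2 : ℝ) ^ k * Real.exp (l * y₀)) atTop (𝓝 0) := by
    have := ((tendsto_pow_atTop_nhds_zero_of_lt_one (r := (1 / 2 : ℝ)) (by norm_num)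
      (by norm_num)).const_mul N).mul_const (Real.exp (l * y₀))
    simpa using this
  have := ge_of_tendsto' hlim (fun k => key k x₀ ⟨hx₀, le_rfl⟩ y₀ ⟨hy₀, le_rfl⟩)
  simpa using this

/-- The common boundary term cancels in the difference, which solves the homogeneous problem.
Restricting to xy ≤ R matters because an arbitrary kernel is known only for r = xy ≤ ρ. -/
theorem goursatMap_unique {P : ℝ → ℂ} {E F : ℝ × ℝ → ℂ} {R M : ℝ} (hP : Continuous P)
    (hE : Continuous E) (hF : Continuous F) (hM : ∀ x, ‖P x‖ ≤ M)
    (hEP : ∀ x y, 1 ≤ x → 0 ≤ y → x * y ≤ R → E (x, y) = goursatMap P E (x, y))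
    (hFP : ∀ x y, 1 ≤ x → 0 ≤ y → x * y ≤ R → F (x, y) = goursatMap P F (x, y))
    {x₀ y₀ : ℝ} (hx₀ : 1 ≤ x₀) (hy₀ : 0 ≤ y₀) (hR : x₀ * y₀ ≤ R) : E (x₀, y₀) = F (x₀, y₀) := by
  refine sub_eq_zero.1 (goursat_unique (D := fun p => E p - F p) (hE.sub hF) hM
    (fun x y hx hy h => ?_) hx₀ hy₀ hR)
  rw [hEP x y hx hy h, hFP x y hx hy h]
  unfold goursatMap doubleIntegral
  rw [add_sub_add_left_eq_sub, ← intervalIntegral.integral_sub]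
  · refine intervalIntegral.integral_congr fun y _ => ?_
    simp only
    rw [← intervalIntegral.integral_sub]
    · simp only [mul_sub]
    · exact Continuous.intervalIntegrable (by fun_prop) _ _
    · exact Continuous.intervalIntegrable (by fun_prop) _ _
  · exact ((continuous_integral_fst (H := fun q => P (q.1 * q.2) * E q)
      (by fun_prop)).comp (by fun_prop : Continuous fun y : ℝ => (x, y))).intervalIntegrable _ _
  · exact ((continuous_integral_fst (H := fun q => P (q.1 * q.2) * F q)
      (by fun_prop)).comp (by fun_prop : Continuous fun y : ℝ => (x, y))).intervalIntegrable _ _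

end Goursat

/-! ### The integral equation for G/r² in the variables (r, σ). -/

section RadialKernel

/-- Where `k` vanishes the argument `c / k` is meaningless, but the bound on `u` depends on the
first variable alone, so the factor `k` forces the limit 0, which is also the value under division
by zero. -/
theorem continuous_mul_comp_div {T : Type*} [TopologicalSpace T] {k c y : T → ℝ}
    (hk : Continuous k) (hc : Continuous c) (hy : Continuous y) {u : ℝ × ℝ → ℂ}
    (hu : Continuous u) {w : ℝ → ℝ} (hw : Continuous w) {N : ℝ}
    (hN : ∀ p, ‖u p‖ ≤ N * w p.1) :
    Continuous fun x => (k x : ℂ) * u (y x, c x / k x) := by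
  rw [continuous_iff_continuousAt]
  intro x
  by_cases h : k x = 0
  · have h0 : Tendsto (fun x => |k x| * (N * w (y x))) (𝓝 x) (𝓝 0) := by
      have : Continuous fun x => |k x| * (N * w (y x)) := by fun_prop
      simpa [h] using this.tendsto x
    rw [ContinuousAt, h, Complex.ofReal_zero, zero_mul]
    refine squeeze_zero_norm (fun z => ?_) h0
    rw [norm_mul, Complex.norm_real, Real.norm_eq_abs]
    exact mul_le_mul_of_nonneg_left (hN _) (abs_nonneg _)
  · have hd : ContinuousAt (fun x => c x / k x) x := hc.continuousAt.div hk.continuousAt h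
    have := hu.continuousAt.comp (f := fun x => (y x, c x / k x)) (hy.continuousAt.prodMk hd)
    exact (Complex.continuous_ofReal.comp hk).continuousAt.mul this

/-- The projection of the line to `[0, 1]`. -/
noncomputable def unitClamp (s : ℝ) : ℝ := max 0 (min s 1)

theorem continuous_unitClamp : Continuous unitClamp := by unfold unitClamp; fun_prop

theorem unitClamp_nonneg (s : ℝ) : 0 ≤ unitClamp s := le_max_left _ _

theorem unitClamp_le_one (s : ℝ) : unitClamp s ≤ 1 := max_le zero_le_one (min_le_right _ _)

theorem unitClamp_of_mem {s : ℝ} (hs : s ∈ Icc (0 : ℝ) 1) : unitClamp s = s := by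
  rw [unitClamp, min_eq_left hs.2, max_eq_right hs.1]

/-- The point dividing `[c, 1]` in the ratio `b`. -/
def towardOne (c b : ℝ) : ℝ := c + (1 - c) * b

theorem towardOne_mem {c b : ℝ} (hc : c ∈ Icc (0 : ℝ) 1) (hb : b ∈ Icc (0 : ℝ) 1) :
    towardOne c b ∈ Icc (0 : ℝ) 1 := by
  unfold towardOne
  have h1 := hc.1; have h2 := hc.2; have h3 := hb.1; have h4 := hb.2
  constructor <;> nlinarith

/-- The inner integral of the radial form of the Goursat equation. -/
noncomputable def radialInner (Q : ℝ → ℂ) (u : ℝ × ℝ → ℂ) (r c : ℝ) : ℂ :=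
  ∫ b in (0 : ℝ)..1, ((1 - c : ℝ) : ℂ) * (Q (r * towardOne c b) *
    ((towardOne c b : ℝ) * u (r * towardOne c b, c / towardOne c b)))

/-- The radial form of the Goursat equation, whose fixed point `g(r, σ)` gives the kernel
`G(r, t) = r² g(r, √(1 - t))`. -/
noncomputable def radialMap (Q : ℝ → ℂ) (u : ℝ × ℝ → ℂ) (p : ℝ × ℝ) : ℂ :=
  ∫ a in (0 : ℝ)..1, (a : ℂ) * (Q (p.1 * a * unitClamp p.2) +
    ((p.1 * a : ℝ) : ℂ) ^ 2 * radialInner Q u (p.1 * a) (unitClamp p.2))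

variable {Q : ℝ → ℂ} {u : ℝ × ℝ → ℂ} {l N : ℝ}

theorem continuous_radialInner_integrand (hQ : Continuous Q) (hu : Continuous u)
    (hN : ∀ p, ‖u p‖ ≤ N * Real.exp (l * p.1 ^ 2)) :
    Continuous fun x : (ℝ × ℝ) × ℝ => ((1 - x.1.2 : ℝ) : ℂ) * (Q (x.1.1 * towardOne x.1.2 x.2) *
      ((towardOne x.1.2 x.2 : ℝ) * u (x.1.1 * towardOne x.1.2 x.2,
        x.1.2 / towardOne x.1.2 x.2))) := by
  have hk : Continuous fun x : (ℝ × ℝ) × ℝ => towardOne x.1.2 x.2 := by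
    unfold towardOne; fun_prop
  have h1 := continuous_mul_comp_div hk (c := fun x => x.1.2)
    (y := fun x => x.1.1 * towardOne x.1.2 x.2) (by fun_prop) (by fun_prop) hu
    (w := fun r => Real.exp (l * r ^ 2)) (by fun_prop) hN
  fun_prop

theorem continuous_radialInner (hQ : Continuous Q) (hu : Continuous u)
    (hN : ∀ p, ‖u p‖ ≤ N * Real.exp (l * p.1 ^ 2)) :
    Continuous fun p : ℝ × ℝ => radialInner Q u p.1 p.2 :=
  intervalIntegral.continuous_parametric_intervalIntegral_of_continuous'
    (f := fun (p : ℝ × ℝ) b => ((1 - p.2 : ℝ) : ℂ) * (Q (p.1 * towardOne p.2 b) *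
      ((towardOne p.2 b : ℝ) * u (p.1 * towardOne p.2 b, p.2 / towardOne p.2 b))))
    (continuous_radialInner_integrand hQ hu hN) 0 1

theorem continuous_radialMap_integrand (hQ : Continuous Q) (hu : Continuous u)
    (hN : ∀ p, ‖u p‖ ≤ N * Real.exp (l * p.1 ^ 2)) :
    Continuous fun x : (ℝ × ℝ) × ℝ => (x.2 : ℂ) * (Q (x.1.1 * x.2 * unitClamp x.1.2) +
    ((x.1.1 * x.2 : ℝ) : ℂ) ^ 2 * radialInner Q u (x.1.1 * x.2) (unitClamp x.1.2)) := by
  have hc := continuous_unitClamp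
  have h1 := (continuous_radialInner hQ hu hN).comp (by fun_prop :
    Continuous fun x : (ℝ × ℝ) × ℝ => (x.1.1 * x.2, unitClamp x.1.2))
  simp only [Function.comp_def] at h1
  fun_prop

theorem continuous_radialMap (hQ : Continuous Q) (hu : Continuous u)
    (hN : ∀ p, ‖u p‖ ≤ N * Real.exp (l * p.1 ^ 2)) : Continuous (radialMap Q u) :=
  intervalIntegral.continuous_parametric_intervalIntegral_of_continuous'
    (f := fun (p : ℝ × ℝ) a => (a : ℂ) * (Q (p.1 * a * unitClamp p.2) +
    ((p.1 * a : ℝ) : ℂ) ^ 2 * radialInner Q u (p.1 * a) (unitClamp p.2)))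
    (continuous_radialMap_integrand hQ hu hN) 0 1

/-- The factors 1 - c and k are at most 1 in absolute value, and |rk| ≤ |r|, so the increasing
weight may be evaluated at r. -/
theorem norm_radialInner_le {M : ℝ} (hM : ∀ x, ‖Q x‖ ≤ M) (hl : 0 ≤ l)
    (hN : ∀ p, ‖u p‖ ≤ N * Real.exp (l * p.1 ^ 2)) {r c : ℝ} (hc : c ∈ Icc (0 : ℝ) 1) :
    ‖radialInner Q u r c‖ ≤ M * (N * Real.exp (l * r ^ 2)) := by
  have hM0 : 0 ≤ M := (norm_nonneg _).trans (hM 0)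
  have hN0 : 0 ≤ N := by simpa using (norm_nonneg _).trans (hN (0, 0))
  have := intervalIntegral.norm_integral_le_of_norm_le_const (a := 0) (b := 1)
    (f := fun b => ((1 - c : ℝ) : ℂ) * (Q (r * towardOne c b) *
    ((towardOne c b : ℝ) * u (r * towardOne c b, c / towardOne c b))))
    (C := M * (N * Real.exp (l * r ^ 2))) (fun b hb => by
      rw [uIoc_of_le zero_le_one] at hb
      have hk := towardOne_mem hc ⟨hb.1.le, hb.2⟩
      rw [norm_mul, norm_mul, norm_mul, Complex.norm_real, Complex.norm_real, Real.norm_eq_abs,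
        Real.norm_eq_abs, abs_of_nonneg (by linarith [hc.2] : 0 ≤ 1 - c), abs_of_nonneg hk.1]
      have h1 : ‖u (r * towardOne c b, c / towardOne c b)‖ ≤ N * Real.exp (l * r ^ 2) := by
        refine (hN _).trans (mul_le_mul_of_nonneg_left (Real.exp_le_exp.2 ?_) hN0)
        refine mul_le_mul_of_nonneg_left ?_ hl
        simp only [mul_pow]
        exact mul_le_of_le_one_right (sq_nonneg _) (pow_le_one₀ hk.1 hk.2)
      calc _ ≤ 1 * (M * (1 * (N * Real.exp (l * r ^ 2)))) := by
            refine mul_le_mul (by linarith [hc.1]) ?_ (by have := hk.1; positivity) zero_le_one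
            refine mul_le_mul (hM _) ?_ (by have := hk.1; positivity) hM0
            exact mul_le_mul hk.2 h1 (norm_nonneg _) zero_le_one
        _ = _ := by ring)
  simpa [radialInner] using this

theorem radialInner_sub {v : ℝ × ℝ → ℂ} {N' : ℝ} (hQ : Continuous Q) (hu : Continuous u)
    (hv : Continuous v) (hN : ∀ p, ‖u p‖ ≤ N * Real.exp (l * p.1 ^ 2))
    (hN' : ∀ p, ‖v p‖ ≤ N' * Real.exp (l * p.1 ^ 2)) (r c : ℝ) :
    radialInner Q (u - v) r c = radialInner Q u r c - radialInner Q v r c := by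
  unfold radialInner
  rw [← intervalIntegral.integral_sub]
  · refine intervalIntegral.integral_congr fun b _ => ?_
    simp only [Pi.sub_apply]; ring
  · exact ((continuous_radialInner_integrand hQ hu hN).comp
      (by fun_prop : Continuous fun b : ℝ => ((r, c), b))).intervalIntegrable _ _
  · exact ((continuous_radialInner_integrand hQ hv hN').comp
      (by fun_prop : Continuous fun b : ℝ => ((r, c), b))).intervalIntegrable _ _

/-- The radial equation has a continuous solution. -/
theorem exists_radialMap_fixedPoint {M : ℝ} (hQ : Continuous Q) (hM : ∀ x, ‖Q x‖ ≤ M) :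
    ∃ g, Continuous g ∧ (∃ l N : ℝ, ∀ p, ‖g p‖ ≤ N * Real.exp (l * p.1 ^ 2)) ∧
      radialMap Q g = g := by
  have hM0 : 0 ≤ M := (norm_nonneg _).trans (hM 0)
  -- The integral of r²a exp(l r²a²) over [0, 1] is at most exp(l r²)/(2l), so the contraction
  -- constant is M/(2l) ≤ 1/2.
  let l := M + 1
  have hl : 0 < l := by positivity
  obtain ⟨g, h1, ⟨N, h2⟩, h3⟩ := exists_fixedPoint_of_weighted_contraction (X := ℝ × ℝ)
    (w := fun p => Real.exp (l * p.1 ^ 2)) (K := radialMap Q) (by fun_prop)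
    (fun x => Real.exp_pos _) (fun u hu ⟨N, hN⟩ => continuous_radialMap hQ hu hN) (by
      refine ⟨M, fun p => ?_⟩
      have := intervalIntegral.norm_integral_le_of_norm_le_const (a := 0) (b := 1)
        (f := fun a : ℝ => (a : ℂ) * (Q (p.1 * a * unitClamp p.2) +
          ((p.1 * a : ℝ) : ℂ) ^ 2 * radialInner Q 0 (p.1 * a) (unitClamp p.2))) (C := M)
        (fun a ha => by
          rw [uIoc_of_le zero_le_one] at ha
          simp only [radialInner, Pi.zero_apply, mul_zero, intervalIntegral.integral_zero,
            add_zero, norm_mul, Complex.norm_real, Real.norm_eq_abs, abs_of_pos ha.1]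
          exact (mul_le_mul ha.2 (hM _) (norm_nonneg _) zero_le_one).trans (by simp))
      refine this.trans ?_
      simp only [sub_zero, abs_one, mul_one]
      exact le_mul_of_one_le_right hM0 (Real.one_le_exp (by positivity))) (by
      rintro u v N hu hv ⟨Nu, hNu⟩ ⟨Nv, hNv⟩ h p
      have hN0 : 0 ≤ N := by simpa using (norm_nonneg _).trans (h (0, 0))
      have e : radialMap Q u p - radialMap Q v p = ∫ a in (0 : ℝ)..1, (a : ℂ) *
          (((p.1 * a : ℝ) : ℂ) ^ 2 * radialInner Q (u - v) (p.1 * a) (unitClamp p.2)) := by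
        unfold radialMap
        rw [← intervalIntegral.integral_sub]
        · refine intervalIntegral.integral_congr fun a _ => ?_
          simp only [radialInner_sub hQ hu hv hNu hNv]; ring
        · exact ((continuous_radialMap_integrand hQ hu hNu).comp
            (by fun_prop : Continuous fun a : ℝ => (p, a))).intervalIntegrable _ _
        · exact ((continuous_radialMap_integrand hQ hv hNv).comp
            (by fun_prop : Continuous fun a : ℝ => (p, a))).intervalIntegrable _ _
      have hcont : Continuous fun a : ℝ =>
          (M * N) * (p.1 ^ 2 * a * Real.exp (l * (p.1 * a) ^ 2)) := by fun_prop
      have h1 := intervalIntegral.norm_integral_le_of_norm_le (μ := volume) (zero_le_one' ℝ)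
        (f := fun a : ℝ => (a : ℂ) *
          (((p.1 * a : ℝ) : ℂ) ^ 2 * radialInner Q (u - v) (p.1 * a) (unitClamp p.2)))
        (g := fun a : ℝ => (M * N) * (p.1 ^ 2 * a * Real.exp (l * (p.1 * a) ^ 2)))
        (Eventually.of_forall fun a ha => by
          have hb := norm_radialInner_le (u := u - v) hM hl.le h (r := p.1 * a)
            ⟨unitClamp_nonneg p.2, unitClamp_le_one p.2⟩
          rw [norm_mul, norm_mul, norm_pow, Complex.norm_real, Complex.norm_real,
            Real.norm_eq_abs, Real.norm_eq_abs, abs_of_pos ha.1, sq_abs, mul_pow]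
          have ha2 : a ^ 2 ≤ 1 := pow_le_one₀ ha.1.le ha.2
          calc a * (p.1 ^ 2 * a ^ 2 * ‖radialInner Q (u - v) (p.1 * a) (unitClamp p.2)‖)
              ≤ a * (p.1 ^ 2 * 1 * (M * (N * Real.exp (l * (p.1 * a) ^ 2)))) := by
                have := ha.1.le
                gcongr
            _ = _ := by ring_nf) (hcont.intervalIntegrable _ _)
      have h2 : ∫ a in (0 : ℝ)..1, (M * N) * (p.1 ^ 2 * a * Real.exp (l * (p.1 * a) ^ 2)) =
          M * N * ((Real.exp (l * p.1 ^ 2) - 1) / (2 * l)) := by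
        have hd : ∀ a, HasDerivAt (fun a : ℝ => M * N * (Real.exp (l * (p.1 * a) ^ 2) / (2 * l)))
            ((M * N) * (p.1 ^ 2 * a * Real.exp (l * (p.1 * a) ^ 2))) a := fun a => by
          have := (((((hasDerivAt_id a).const_mul p.1).pow 2).const_mul l).exp.div_const
            (2 * l)).const_mul (M * N)
          refine this.congr_deriv ?_
          simp only [Pi.pow_apply, id, Nat.cast_ofNat, Nat.add_one_sub_one, pow_one]
          field_simp
        rw [intervalIntegral.integral_eq_sub_of_hasDerivAt (fun a _ => hd a)
          (hcont.intervalIntegrable _ _)]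
        simp; ring_nf
      rw [e]
      refine h1.trans ?_
      rw [h2]
      have he : 0 < Real.exp (l * p.1 ^ 2) := Real.exp_pos _
      have h3 : M / (2 * l) ≤ 1 / 2 := by
        rw [div_le_div_iff₀ (by positivity) (by norm_num)]; simp only [l]; linarith
      calc _ = N * (M / (2 * l)) * (Real.exp (l * p.1 ^ 2) - 1) := by ring
        _ ≤ N * (M / (2 * l)) * Real.exp (l * p.1 ^ 2) := by
          refine mul_le_mul_of_nonneg_left (by linarith) (by positivity)
        _ ≤ N * (1 / 2) * Real.exp (l * p.1 ^ 2) := by gcongr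
        _ = _ := by ring)
  exact ⟨g, h1, ⟨l, N, h2⟩, h3⟩

/-- Replacing x by max(x, 1) extends functions of 1/x continuously from the half plane x ≥ 1, where
the Goursat problem lives, to the whole plane. -/
theorem continuous_max_inv : Continuous fun p : ℝ × ℝ => 1 / max p.1 1 := by
  refine continuous_const.div (by fun_prop) fun p => ?_
  have : (0 : ℝ) < max p.1 1 := lt_of_lt_of_le one_pos (le_max_right _ _)
  exact this.ne'

/-- In the variables `x = 1/σ`, `y = r σ` the radial equation becomes the Goursat equation. -/
theorem radialMap_fixedPoint_goursat {g : ℝ × ℝ → ℂ} (hQ : Continuous Q) (hgc : Continuous g)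
    (hg : radialMap Q g = g) {x y : ℝ} (hx : 1 ≤ x) :
    (y : ℂ) ^ 2 * g (y * x, 1 / x) = goursatMap (fun s => (s : ℂ) * Q s)
      (fun p => (p.2 : ℂ) ^ 2 * g (p.2 * max p.1 1, 1 / max p.1 1)) (x, y) := by
  have hx0 : 0 < x := by linarith
  have hxc : (x : ℂ) ≠ 0 := by exact_mod_cast hx0.ne'
  set J : ℝ → ℂ := fun z => ∫ t in (1 : ℝ)..x, (t : ℂ) * (Q (z * t) * g (z * t, 1 / t)) with hJ
  have hmem : (1 / x) ∈ Icc (0 : ℝ) 1 := ⟨by positivity, by rw [div_le_one hx0]; exact hx⟩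
  -- Substitute t = 1 + (x - 1)b: the dividing point of [1/x, 1] becomes t/x, and the integral runs
  -- over [1, x] as in the Goursat equation.
  have hin : ∀ z, radialInner Q g (z * x) (1 / x) = ((x : ℂ) ^ 2)⁻¹ * J z := by
    intro z
    have h2 := @intervalIntegral.smul_integral_comp_add_mul ℂ _ _ 0 1
      (fun t : ℝ => (t : ℂ) * (Q (z * t) * g (z * t, 1 / t))) (x - 1) 1
    simp only [mul_zero, add_zero, mul_one, add_sub_cancel] at h2
    rw [hJ]
    simp only
    rw [← h2, Complex.real_smul, ← mul_assoc, ← intervalIntegral.integral_const_mul, radialInner]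
    refine intervalIntegral.integral_congr fun b hb => ?_
    rw [uIcc_of_le zero_le_one] at hb
    have ht : 0 < 1 + (x - 1) * b := by nlinarith [hb.1]
    have hk : towardOne (1 / x) b = (1 + (x - 1) * b) / x := by
      unfold towardOne; field_simp
    simp only [hk]
    have e1 : z * x * ((1 + (x - 1) * b) / x) = z * (1 + (x - 1) * b) := by field_simp
    have e2 : 1 / x / ((1 + (x - 1) * b) / x) = 1 / (1 + (x - 1) * b) := by field_simp
    rw [e1, e2]
    push_cast
    field_simp
  set H : ℝ × ℝ → ℂ := fun q => ((q.1 * q.2 : ℝ) : ℂ) * Q (q.1 * q.2) *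
    ((q.2 : ℂ) ^ 2 * g (q.2 * max q.1 1, 1 / max q.1 1)) with hH
  have hHc : Continuous H := by
    have : Continuous fun q : ℝ × ℝ => g (q.2 * max q.1 1, 1 / max q.1 1) :=
      hgc.comp ((by fun_prop : Continuous fun q : ℝ × ℝ => q.2 * max q.1 1).prodMk continuous_max_inv)
    exact (by fun_prop : Continuous fun q : ℝ × ℝ => ((q.1 * q.2 : ℝ) : ℂ) * Q (q.1 * q.2)).mul
      ((by fun_prop : Continuous fun q : ℝ × ℝ => (q.2 : ℂ) ^ 2).mul this)
  have hJH : ∀ z : ℝ, (z : ℂ) ^ 3 * J z = ∫ t in (1 : ℝ)..x, H (t, z) := by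
    intro z
    rw [hJ]
    simp only
    rw [← intervalIntegral.integral_const_mul]
    refine intervalIntegral.integral_congr fun t ht => ?_
    rw [uIcc_of_le hx] at ht
    simp only [hH, max_eq_left ht.1, mul_comm t z]
    push_cast
    ring
  have hJc : Continuous fun z : ℝ => (z : ℂ) ^ 3 * J z := by
    simp_rw [hJH]
    exact (continuous_integral_fst hHc).comp (by fun_prop : Continuous fun z : ℝ => (x, z))
  have hF := @intervalIntegral.smul_integral_comp_mul_left ℂ _ _ 0 1
    (fun z : ℝ => (z : ℂ) * Q z + (z : ℂ) ^ 3 * J z) y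
  simp only [mul_zero, mul_one] at hF
  unfold goursatMap
  change _ = (∫ z in (0 : ℝ)..y, (z : ℂ) * Q z) + ∫ z in (0 : ℝ)..y, ∫ t in (1 : ℝ)..x, H (t, z)
  simp_rw [← hJH]
  rw [← intervalIntegral.integral_add
    (Continuous.intervalIntegrable (by fun_prop) _ _) (hJc.intervalIntegrable _ _), ← hF,
    Complex.real_smul, ← hg, radialMap, ← intervalIntegral.integral_const_mul,
    ← intervalIntegral.integral_const_mul]
  refine intervalIntegral.integral_congr fun a _ => ?_
  simp only [unitClamp_of_mem hmem]
  have e1 : y * x * a = y * a * x := by ring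
  have e2 : y * a * x * (1 / x) = y * a := by field_simp
  rw [e1, hin, e2]
  push_cast
  field_simp

end RadialKernel

/-! ### Existence of the transmutation kernel. -/

section KernelExistence

/-- A `C¹` function on `[0, ρ]` extends to a `C¹` function `Q` on the line such that
`Q` and `x Q(x)` are bounded. -/
theorem exists_contDiff_extension {ρ : ℝ} (hρ : 0 < ρ) {q : ℝ → ℂ}
    (hq : ContDiffOn ℝ 1 q (Icc 0 ρ)) :
    ∃ (Q : ℝ → ℂ) (M : ℝ), ContDiff ℝ 1 Q ∧ (∀ x ∈ Icc 0 ρ, Q x = q x) ∧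
      (∀ x, ‖Q x‖ ≤ M) ∧ ∀ x : ℝ, ‖(x : ℂ) * Q x‖ ≤ M := by
  have hU := uniqueDiffOn_Icc hρ
  -- The derivative is extended by its end values and integrated, which preserves C¹; a bump
  -- function equal to 1 on [0, ρ] then gives the two global bounds.
  let d : ℝ → ℂ := IccExtend hρ.le ((Icc 0 ρ).domRestrict (derivWithin q (Icc 0 ρ)))
  have hd : Continuous d :=
    (continuousOn_iff_continuous_domRestrict.1 (hq.continuousOn_derivWithin hU le_rfl)).Icc_extend'
  let Q₁ : ℝ → ℂ := fun x => q 0 + ∫ t in (0 : ℝ)..x, d t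
  have hQ₁ : ContDiff ℝ 1 Q₁ := contDiff_const.add (contDiff_one_primitive hd 0)
  have hQq : ∀ x ∈ Icc 0 ρ, Q₁ x = q x := by
    intro x hx
    have h := intervalIntegral.integral_eq_sub_of_hasDerivAt_of_le hx.1 (f := q) (f' := d)
      (hq.continuousOn.mono (Icc_subset_Icc_right hx.2)) (fun y hy => by
        have hy' : y ∈ Ioo 0 ρ := ⟨hy.1, hy.2.trans_le hx.2⟩
        have h1 := ((hq.differentiableOn one_ne_zero) y (Ioo_subset_Icc_self hy')).hasDerivWithinAt
        have : d y = derivWithin q (Icc 0 ρ) y := IccExtend_of_mem _ _ (Ioo_subset_Icc_self hy')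
        rw [this]
        exact h1.hasDerivAt (Icc_mem_nhds hy'.1 hy'.2)) (hd.intervalIntegrable _ _)
    simp only [Q₁, h]; ring
  let χ : ContDiffBump (0 : ℝ) := ⟨ρ, ρ + 1, hρ, by linarith⟩
  have hχ : ContDiff ℝ 1 fun x => ((χ x : ℝ) : ℂ) := Complex.ofRealCLM.contDiff.comp χ.contDiff
  have hQ : ContDiff ℝ 1 fun x => ((χ x : ℝ) : ℂ) * Q₁ x := hχ.mul hQ₁
  have hs : HasCompactSupport fun x => ((χ x : ℝ) : ℂ) * Q₁ x :=
    (χ.hasCompactSupport.comp_left (g := fun x : ℝ => (x : ℂ)) (by simp)).mul_right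
  have hs' : HasCompactSupport fun x : ℝ => (x : ℂ) * (((χ x : ℝ) : ℂ) * Q₁ x) := hs.mul_left
  obtain ⟨M₁, h₁⟩ := hQ.continuous.bounded_above_of_compact_support hs
  obtain ⟨M₂, h₂⟩ := ((Complex.continuous_ofReal.mul
    hQ.continuous)).bounded_above_of_compact_support hs'
  refine ⟨_, max M₁ M₂, hQ, fun x hx => ?_, fun x => (h₁ x).trans (le_max_left _ _),
    fun x => (h₂ x).trans (le_max_right _ _)⟩
  have : χ x = 1 := χ.one_of_mem_closedBall (by
    rw [mem_closedBall_zero_iff, Real.norm_eq_abs, abs_of_nonneg hx.1]; exact hx.2)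
  simp only [this, Complex.ofReal_one, one_mul, hQq x hx]

/-- The kernel `r² g(r, √(1 - t))`. -/
noncomputable def radialKernel (g : ℝ × ℝ → ℂ) (r t : ℝ) : ℂ :=
  (r : ℂ) ^ 2 * g (r, Real.sqrt (1 - t))

theorem continuous_radialKernel {g : ℝ × ℝ → ℂ} (hg : Continuous g) :
    Continuous (Function.uncurry (radialKernel g)) := by
  unfold radialKernel Function.uncurry
  fun_prop

/-- The kernel expressed by the solution `E` of the Goursat problem. -/
theorem radialKernel_eq_goursat {Q : ℝ → ℂ} {M : ℝ} (hQ : Continuous Q)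
    (hM : ∀ x : ℝ, ‖(x : ℂ) * Q x‖ ≤ M) {g E : ℝ × ℝ → ℂ} (hgc : Continuous g)
    (hg : radialMap Q g = g) (hEc : Continuous E)
    (hE : goursatMap (fun s => (s : ℂ) * Q s) E = E) {r t : ℝ} (hr : 0 ≤ r)
    (ht : t ∈ Ico (0 : ℝ) 1) :
    radialKernel g r t = ((Real.sqrt (1 - t) : ℂ)⁻¹) ^ 2 *
      E ((Real.sqrt (1 - t))⁻¹, r * Real.sqrt (1 - t)) := by
  set P : ℝ → ℂ := fun s => (s : ℂ) * Q s with hP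
  have hPc : Continuous P := by fun_prop
  set F : ℝ × ℝ → ℂ := fun p => (p.2 : ℂ) ^ 2 * g (p.2 * max p.1 1, 1 / max p.1 1) with hF
  have hFc : Continuous F := by
    have : Continuous fun q : ℝ × ℝ => g (q.2 * max q.1 1, 1 / max q.1 1) :=
      hgc.comp ((by fun_prop : Continuous fun q : ℝ × ℝ => q.2 * max q.1 1).prodMk
        continuous_max_inv)
    exact (by fun_prop : Continuous fun q : ℝ × ℝ => (q.2 : ℂ) ^ 2).mul this
  have hm0 : 0 < Real.sqrt (1 - t) := Real.sqrt_pos.2 (by linarith [ht.2])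
  have hm1 : Real.sqrt (1 - t) ≤ 1 := Real.sqrt_le_one.2 (by linarith [ht.1])
  set m := Real.sqrt (1 - t)
  have hx : 1 ≤ m⁻¹ := (one_le_inv₀ hm0).2 hm1
  have h0 := goursatMap_unique (P := P) (R := m⁻¹ * (r * m)) hPc hFc hEc hM
    (fun x y hx _ _ => by
      rw [← radialMap_fixedPoint_goursat hQ hgc hg hx]
      simp only [hF, max_eq_left hx])
    (fun x y _ _ _ => by rw [hE]) hx (by positivity) le_rfl
  rw [← h0]
  simp only [hF, max_eq_left hx, radialKernel]
  have e1 : r * m * m⁻¹ = r := by field_simp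
  have e2 : 1 / m⁻¹ = m := by field_simp
  have hmc : (m : ℂ) ≠ 0 := by exact_mod_cast hm0.ne'
  rw [e1, e2]
  push_cast
  field_simp
  rfl

/-- Two descriptions of one function share the work: continuity on the closed rectangle and the
boundary values are read off `g`, while C² and the equation inside come from the Goursat solution
`E`, where t < 1. -/
theorem isTransmutationKernel_radialKernel {q Q : ℝ → ℂ} {ρ M : ℝ} (hQ : ContDiff ℝ 1 Q)
    (hQq : ∀ x ∈ Icc 0 ρ, Q x = q x) (hM : ∀ x : ℝ, ‖(x : ℂ) * Q x‖ ≤ M) {g : ℝ × ℝ → ℂ}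
    (hgc : Continuous g) (hg : radialMap Q g = g) :
    IsTransmutationKernel q ρ (radialKernel g) := by
  have hP : ContDiff ℝ 1 fun s : ℝ => (s : ℂ) * Q s := Complex.ofRealCLM.contDiff.mul hQ
  obtain ⟨E, hE2, hE⟩ := exists_goursat_solution hP hM
  have hGE := fun r t (hr : 0 ≤ r) (ht : t ∈ Ico (0 : ℝ) 1) =>
    radialKernel_eq_goursat hQ.continuous hM hgc hg hE2.continuous hE hr ht
  set P : ℝ → ℂ := fun s => (s : ℂ) * Q s with hPdef
  have hE1 : ContDiff ℝ 1 E := hE2.of_le (by norm_num)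
  have hsq : ∀ t : ℝ, t < 1 → 0 < Real.sqrt (1 - t) := fun t ht => Real.sqrt_pos.2 (by linarith)
  have hsqd : ∀ t : ℝ, t < 1 → HasDerivAt (fun t => Real.sqrt (1 - t))
      (-1 / (2 * Real.sqrt (1 - t))) t := fun t ht => by
    have := ((hasDerivAt_id t).const_sub 1).sqrt (by simp; linarith)
    simpa using this
  -- This is ∂E/∂y, obtained by differentiating the integral equation; its x-derivative is P(xy)E,
  -- and `Ess` below is ∂²E/∂y².
  let Es : ℝ × ℝ → ℂ := fun p => P p.2 + ∫ x in (1 : ℝ)..p.1, P (x * p.2) * E (x, p.2)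
  have hH : ContDiff ℝ 1 fun p : ℝ × ℝ => P (p.1 * p.2) * E p :=
    (hP.comp (contDiff_fst.mul contDiff_snd)).mul hE1
  have hEs : ContDiff ℝ 1 Es := (hP.comp contDiff_snd).add (contDiff_one_integral_fst hH)
  have hEd : ∀ x y, HasDerivAt (fun y => E (x, y)) (Es (x, y)) y := fun x y => by
    have h1 : HasDerivAt (fun x => ∫ t in (0 : ℝ)..x, P t) (P y) y :=
      intervalIntegral.integral_hasDerivAt_right (hP.continuous.intervalIntegrable _ _)
        (hP.continuous.stronglyMeasurableAtFilter _ _) hP.continuous.continuousAt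
    have h2 := h1.add (hasDerivAt_doubleIntegral_snd hH.continuous x y)
    have e : (fun y => E (x, y)) = fun y => goursatMap P E (x, y) := by rw [hE]
    rw [e]
    exact h2
  have hEsd : ∀ x y, HasDerivAt (fun x => Es (x, y)) (P (x * y) * E (x, y)) x := fun x y => by
    have hc : Continuous fun x => P (x * y) * E (x, y) :=
      hH.continuous.comp (by fun_prop : Continuous fun x : ℝ => (x, y))
    have h1 : HasDerivAt (fun x => ∫ t in (1 : ℝ)..x, P (t * y) * E (t, y))
        (P (x * y) * E (x, y)) x :=
      intervalIntegral.integral_hasDerivAt_right (hc.intervalIntegrable _ _)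
        (hc.stronglyMeasurableAtFilter _ _) hc.continuousAt
    exact h1.const_add (P y)
  let Ess : ℝ × ℝ → ℂ := fun p => fderiv ℝ Es p (0, 1)
  have hEsf : ∀ p, HasFDerivAt Es (fderiv ℝ Es p) p := fun p =>
    (hEs.differentiable one_ne_zero p).hasFDerivAt
  have hEs1 : ∀ p, fderiv ℝ Es p (1, 0) = P (p.1 * p.2) * E p := fun p => by
    have h1 := (hEsf p).comp_hasDerivAt (f := fun x : ℝ => (x, p.2)) p.1
      ((hasDerivAt_id p.1).prodMk (hasDerivAt_const p.1 p.2))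
    exact h1.unique (hEsd p.1 p.2)
  have hEs2 : ∀ p (a b : ℝ), fderiv ℝ Es p (a, b) = a * (P (p.1 * p.2) * E p) + b * Ess p := by
    intro p a b
    have : ((a, b) : ℝ × ℝ) = a • (1, 0) + b • (0, 1) := by simp
    rw [this, map_add, map_smul, map_smul, hEs1, Complex.real_smul, Complex.real_smul]
  -- first derivative in `r`
  have hGr : ∀ r t, 0 < r → t ∈ Ico (0 : ℝ) 1 → HasDerivAt (fun s => radialKernel g s t)
      ((Real.sqrt (1 - t) : ℂ)⁻¹ * Es ((Real.sqrt (1 - t))⁻¹, r * Real.sqrt (1 - t))) r := by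
    intro r t hr ht
    have hev : (fun s => radialKernel g s t) =ᶠ[𝓝 r] fun s => ((Real.sqrt (1 - t) : ℂ)⁻¹) ^ 2 *
        E ((Real.sqrt (1 - t))⁻¹, s * Real.sqrt (1 - t)) := by
      filter_upwards [lt_mem_nhds hr] with s hs using hGE s t hs.le ht
    refine HasDerivAt.congr_of_eventuallyEq ?_ hev
    have h1 := (hEd (Real.sqrt (1 - t))⁻¹ (r * Real.sqrt (1 - t))).scomp r
      ((hasDerivAt_id r).mul_const (Real.sqrt (1 - t)))
    refine (h1.const_mul _).congr_deriv ?_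
    have hmc : (Real.sqrt (1 - t) : ℂ) ≠ 0 := by exact_mod_cast (hsq t ht.2).ne'
    simp only [one_mul, Complex.real_smul]
    field_simp
  refine ⟨(continuous_radialKernel hgc).continuousOn, ?_, ?_, ?_, ?_⟩
  · have hS : ContDiffOn ℝ 2 (fun p : ℝ × ℝ => Real.sqrt (1 - p.2)) (Ioo 0 ρ ×ˢ Ioo 0 1) :=
      ContDiffOn.sqrt (contDiffOn_const.sub contDiff_snd.contDiffOn)
        (fun p hp => by have := hp.2.2; simp; linarith)
    have hS0 : ∀ p ∈ Ioo (0 : ℝ) ρ ×ˢ Ioo (0 : ℝ) 1, Real.sqrt (1 - p.2) ≠ 0 := fun p hp =>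
      (hsq p.2 hp.2.2).ne'
    have hI := hS.inv hS0
    have hC : ContDiffOn ℝ 2 (fun p : ℝ × ℝ => (((Real.sqrt (1 - p.2))⁻¹ : ℝ) : ℂ) ^ 2 *
        E ((Real.sqrt (1 - p.2))⁻¹, p.1 * Real.sqrt (1 - p.2))) (Ioo 0 ρ ×ˢ Ioo 0 1) :=
      ((Complex.ofRealCLM.contDiff.comp_contDiffOn hI).pow 2).mul
        (hE2.comp_contDiffOn (hI.prodMk (contDiff_fst.contDiffOn.mul hS)))
    refine hC.congr fun p hp => ?_
    change radialKernel g p.1 p.2 = _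
    rw [hGE p.1 p.2 hp.1.1.le ⟨hp.2.1.le, hp.2.2⟩]
    push_cast
    rfl
  · intro r hr t ht
    have ht' : t ∈ Ico (0 : ℝ) 1 := ⟨ht.1.le, ht.2⟩
    set m := Real.sqrt (1 - t) with hm
    have hm0 : 0 < m := hsq t ht.2
    have hmc : (m : ℂ) ≠ 0 := by exact_mod_cast hm0.ne'
    have hm2 : m ^ 2 = 1 - t := Real.sq_sqrt (by linarith [ht.2])
    have d1 : deriv (fun s => radialKernel g s t) r = (m : ℂ)⁻¹ * Es (m⁻¹, r * m) :=
      (hGr r t hr.1 ht').deriv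
    have d2 : deriv (deriv fun s => radialKernel g s t) r = Ess (m⁻¹, r * m) := by
      have hev : (deriv fun s => radialKernel g s t) =ᶠ[𝓝 r] fun s =>
          (m : ℂ)⁻¹ * Es (m⁻¹, s * m) := by
        filter_upwards [lt_mem_nhds hr.1] with s hs using (hGr s t hs ht').deriv
      rw [hev.deriv_eq]
      have h1 := (hEsf (m⁻¹, r * m)).comp_hasDerivAt (f := fun s : ℝ => (m⁻¹, s * m)) r
        ((hasDerivAt_const r m⁻¹).prodMk ((hasDerivAt_id r).mul_const m))
      refine (h1.const_mul (m : ℂ)⁻¹).deriv.trans ?_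
      rw [hEs2]
      simp only [Complex.ofReal_zero, zero_mul, zero_add, one_mul]
      field_simp
    -- With m = √(1 - t) one has m' = -1/(2m) and (1/m)' = 1/(2m³). Multiplication by 2(1 - t) = 2m²
    -- then cancels the remaining terms of the equation.
    have d3 : deriv (fun τ => deriv (fun s => radialKernel g s τ) r) t =
        ((1 / (2 * m) / m ^ 2 : ℝ) : ℂ) * Es (m⁻¹, r * m) + (m : ℂ)⁻¹ *
          (((1 / (2 * m) / m ^ 2 : ℝ) : ℂ) * (P r * E (m⁻¹, r * m)) +
            ((r * (-1 / (2 * m)) : ℝ) : ℂ) * Ess (m⁻¹, r * m)) := by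
      have hev : (fun τ => deriv (fun s => radialKernel g s τ) r) =ᶠ[𝓝 t] fun τ =>
          (((Real.sqrt (1 - τ))⁻¹ : ℝ) : ℂ) *
            Es ((Real.sqrt (1 - τ))⁻¹, r * Real.sqrt (1 - τ)) := by
        filter_upwards [Ioo_mem_nhds ht.1 ht.2] with τ hτ
        rw [(hGr r τ hr.1 ⟨hτ.1.le, hτ.2⟩).deriv]
        push_cast
        rfl
      rw [hev.deriv_eq]
      have hi : HasDerivAt (fun τ => (Real.sqrt (1 - τ))⁻¹) (1 / (2 * m) / m ^ 2) t := by
        refine ((hsqd t ht.2).inv hm0.ne').congr_deriv ?_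
        rw [← hm]; ring
      have h1 := (hEsf (m⁻¹, r * m)).comp_hasDerivAt
        (f := fun τ : ℝ => ((Real.sqrt (1 - τ))⁻¹, r * Real.sqrt (1 - τ))) t
        (hi.prodMk ((hsqd t ht.2).const_mul r))
      have h2 := hi.ofReal_comp.mul h1
      have h3 := h2.deriv
      rw [hEs2] at h3
      simp only [← hm] at h3
      have e1 : m⁻¹ * (r * m) = r := by field_simp
      rw [e1] at h3
      rw [← Complex.ofReal_inv]
      exact h3
    rw [d1, d2, d3, hGE r t hr.1.le ht', ← hm]
    have e : P r = r * q r := by simp only [hPdef, hQq r (Ioo_subset_Icc_self hr)]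
    have ht1 : (1 - (t : ℂ)) = (m : ℂ) ^ 2 := by rw [← Complex.ofReal_pow, hm2]; push_cast; rfl
    rw [e, ht1]
    push_cast
    field_simp
    ring
  · intro r hr
    -- At t = 0, that is σ = 1, the interval [σ, 1] of the inner integral degenerates and only the
    -- source term remains.
    have h1 : radialKernel g r 0 = (r : ℂ) ^ 2 * ∫ a in (0 : ℝ)..1, (a : ℂ) * Q (r * a) := by
      unfold radialKernel
      rw [← hg, sub_zero, Real.sqrt_one, radialMap]
      congr 1
      refine intervalIntegral.integral_congr fun a _ => ?_
      simp [unitClamp_of_mem (show (1 : ℝ) ∈ Icc (0 : ℝ) 1 by simp), radialInner]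
    have hF := @intervalIntegral.smul_integral_comp_mul_left ℂ _ _ 0 1
      (fun z : ℝ => (z : ℂ) * Q z) r
    simp only [mul_zero, mul_one] at hF
    have h2 : ∫ τ in (0 : ℝ)..r, (τ : ℂ) * q τ = ∫ τ in (0 : ℝ)..r, (τ : ℂ) * Q τ := by
      refine intervalIntegral.integral_congr fun x hx => ?_
      rw [uIcc_of_le hr.1] at hx
      simp only [hQq x ⟨hx.1, hx.2.trans hr.2⟩]
    rw [h2, h1, ← hF, Complex.real_smul, ← intervalIntegral.integral_const_mul,
      ← intervalIntegral.integral_const_mul]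
    refine intervalIntegral.integral_congr fun a _ => ?_
    push_cast
    ring
  · intro t _
    simp [radialKernel]

end KernelExistence

/-! ### Uniqueness of the transmutation kernel. -/

section KernelUniqueness

/-- Every transmutation kernel is the radial kernel. -/
theorem IsTransmutationKernel.eq_radialKernel {q Q : ℝ → ℂ} {ρ M : ℝ} (hρ : 0 < ρ)
    (hQ : Continuous Q)
    (hQq : ∀ x ∈ Icc 0 ρ, Q x = q x) (hM : ∀ x : ℝ, ‖(x : ℂ) * Q x‖ ≤ M) {g : ℝ × ℝ → ℂ}
    (hgc : Continuous g) (hg : radialMap Q g = g) {G : ℝ → ℝ → ℂ}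
    (hG : IsTransmutationKernel q ρ G) {r t : ℝ} (hr : r ∈ Icc 0 ρ) (ht : t ∈ Icc (0 : ℝ) 1) :
    G r t = radialKernel g r t := by
  set P : ℝ → ℂ := fun s => (s : ℂ) * Q s with hPdef
  have hPc : Continuous P := by fun_prop
  -- Clamping both variables gives a function continuous on the plane, so the integrals below need
  -- no side conditions.
  set Gc : ℝ × ℝ → ℂ := fun p => G (projIcc 0 ρ hρ.le p.1) (projIcc 0 1 zero_le_one p.2) with hGc
  have hGcc : Continuous Gc := by
    refine hG.continuousOn.comp_continuous (f := fun p : ℝ × ℝ =>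
      (((projIcc 0 ρ hρ.le p.1 : Icc 0 ρ) : ℝ), ((projIcc 0 1 zero_le_one p.2 : Icc (0 : ℝ) 1) : ℝ)))
      ?_ (fun p => ⟨Subtype.mem _, Subtype.mem _⟩)
    have h1 : Continuous fun p : ℝ × ℝ => ((projIcc 0 ρ hρ.le p.1 : Icc 0 ρ) : ℝ) :=
      continuous_subtype_val.comp (continuous_projIcc.comp continuous_fst)
    have h2 : Continuous fun p : ℝ × ℝ => ((projIcc 0 1 zero_le_one p.2 : Icc (0 : ℝ) 1) : ℝ) :=
      continuous_subtype_val.comp (continuous_projIcc.comp continuous_snd)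
    exact h1.prodMk h2
  have hGce : ∀ r t, r ∈ Icc 0 ρ → t ∈ Icc (0 : ℝ) 1 → Gc (r, t) = G r t := by
    intro r t hr ht
    simp only [hGc, projIcc_of_mem hρ.le hr, projIcc_of_mem zero_le_one ht]
  set Ec : ℝ × ℝ → ℂ := fun p => ((1 / max p.1 1 : ℝ) : ℂ) ^ 2 *
    Gc (p.2 * max p.1 1, 1 - (1 / max p.1 1) ^ 2) with hEc
  have hEcc : Continuous Ec := by
    have h0 := continuous_max_inv
    have h1 : Continuous fun p : ℝ × ℝ => Gc (p.2 * max p.1 1, 1 - (1 / max p.1 1) ^ 2) :=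
      hGcc.comp ((by fun_prop : Continuous fun p : ℝ × ℝ => p.2 * max p.1 1).prodMk
        (continuous_const.sub (h0.pow 2)))
    exact ((Complex.continuous_ofReal.comp h0).pow 2).mul h1
  have hmem : ∀ x : ℝ, 1 ≤ x → 1 - (1 / x) ^ 2 ∈ Icc (0 : ℝ) 1 := fun x hx => by
    have h0 : 0 < 1 / x := by positivity
    have h1 : 1 / x ≤ 1 := by rw [div_le_one (by linarith)]; exact hx
    exact ⟨by nlinarith, by nlinarith⟩
  have hEce : ∀ x y, 1 ≤ x → 0 ≤ y → x * y ≤ ρ →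
      Ec (x, y) = ((1 / x : ℝ) : ℂ) ^ 2 * G (y * x) (1 - (1 / x) ^ 2) := by
    intro x y hx hy hxy
    simp only [hEc, max_eq_left hx]
    rw [hGce _ _ ⟨by positivity, by linarith⟩ (hmem x hx)]
  set H : ℝ × ℝ → ℂ := fun q => P (q.1 * q.2) * Ec q with hH
  have hHc : Continuous H := by fun_prop
  -- derivatives of the kernel in the open rectangle
  set F : ℝ × ℝ → ℂ := Function.uncurry G with hF
  set S : Set (ℝ × ℝ) := Ioo 0 ρ ×ˢ Ioo (0 : ℝ) 1 with hS
  have hSo : IsOpen S := isOpen_Ioo.prod isOpen_Ioo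
  set Dr : ℝ × ℝ → ℂ := fun p => fderiv ℝ F p (1, 0) with hDr
  have hFc : ∀ p ∈ S, ContDiffAt ℝ 2 F p := fun p hp => hG.contDiffOn.contDiffAt (hSo.mem_nhds hp)
  have hFr : ∀ p ∈ S, HasDerivAt (fun s => G s p.2) (Dr p) p.1 := fun p hp =>
    ((hFc p hp).differentiableAt two_ne_zero).hasFDerivAt.comp_hasDerivAt
      (f := fun s : ℝ => (s, p.2)) p.1 ((hasDerivAt_id p.1).prodMk (hasDerivAt_const p.1 p.2))
  have hDrd : ∀ p ∈ S, HasFDerivAt Dr (fderiv ℝ Dr p) p := fun p hp => by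
    have h1 : ContDiffAt ℝ 1 (fderiv ℝ F) p := (hFc p hp).fderiv_right (by norm_num)
    have h2 : ContDiffAt ℝ 1 Dr p := h1.clm_apply contDiffAt_const
    exact (h2.differentiableAt one_ne_zero).hasFDerivAt
  have hpde : ∀ r t, (r, t) ∈ S → (r : ℂ) * (fderiv ℝ Dr (r, t) (1, 0) - q r * G r t) - Dr (r, t)
      + 2 * (1 - (t : ℂ)) * fderiv ℝ Dr (r, t) (0, 1) = 0 := by
    intro r t hp
    have h0 := hG.pde r hp.1 t hp.2
    have e1 : deriv (fun s => G s t) r = Dr (r, t) := (hFr _ hp).deriv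
    have e2 : deriv (deriv fun s => G s t) r = fderiv ℝ Dr (r, t) (1, 0) := by
      have hev : (deriv fun s => G s t) =ᶠ[𝓝 r] fun s => Dr (s, t) := by
        filter_upwards [isOpen_Ioo.mem_nhds hp.1] with s hs using (hFr (s, t) ⟨hs, hp.2⟩).deriv
      rw [hev.deriv_eq]
      exact ((hDrd _ hp).comp_hasDerivAt (f := fun s : ℝ => (s, t)) r
        ((hasDerivAt_id r).prodMk (hasDerivAt_const r t))).deriv
    have e3 : deriv (fun τ => deriv (fun s => G s τ) r) t = fderiv ℝ Dr (r, t) (0, 1) := by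
      have hev : (fun τ => deriv (fun s => G s τ) r) =ᶠ[𝓝 t] fun τ => Dr (r, τ) := by
        filter_upwards [isOpen_Ioo.mem_nhds hp.2] with τ hτ using (hFr (r, τ) ⟨hp.1, hτ⟩).deriv
      rw [hev.deriv_eq]
      exact ((hDrd _ hp).comp_hasDerivAt (f := fun τ : ℝ => (r, τ)) t
        ((hasDerivAt_const t r).prodMk (hasDerivAt_id t))).deriv
    rwa [e1, e2, e3] at h0
  have hreg : ∀ x y : ℝ, 1 < x → 0 < y → x * y < ρ → (y * x, 1 - (1 / x) ^ 2) ∈ S := by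
    intro x y hx hy hxy
    have h0 : 0 < 1 / x := by positivity
    have h1 : 1 / x < 1 := by rw [div_lt_one (by linarith)]; exact hx
    exact ⟨⟨by positivity, by linarith⟩, ⟨by nlinarith, by nlinarith⟩⟩
  let Es : ℝ × ℝ → ℂ := fun p => ((1 / p.1 : ℝ) : ℂ) * Dr (p.2 * p.1, 1 - (1 / p.1) ^ 2)
  have hEs : ∀ x y, 1 < x → 0 < y → x * y < ρ →
      HasDerivAt (fun y => Ec (x, y)) (Es (x, y)) y := by
    intro x y hx hy hxy
    have hx0 : 0 < x := by linarith
    have hev : (fun y => Ec (x, y)) =ᶠ[𝓝 y] fun y =>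
        ((1 / x : ℝ) : ℂ) ^ 2 * G (y * x) (1 - (1 / x) ^ 2) := by
      have : Ioo 0 (ρ / x) ∈ 𝓝 y := Ioo_mem_nhds hy (by rw [lt_div_iff₀ hx0]; linarith)
      filter_upwards [this] with z hz
      refine hEce x z hx.le hz.1.le ?_
      have := (lt_div_iff₀ hx0).1 hz.2
      linarith
    refine HasDerivAt.congr_of_eventuallyEq ?_ hev
    have h1 := (hFr _ (hreg x y hx hy hxy)).scomp y ((hasDerivAt_id y).mul_const x)
    refine (h1.const_mul _).congr_deriv ?_
    have hxc : (x : ℂ) ≠ 0 := by exact_mod_cast hx0.ne'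
    simp only [Es, one_mul, Complex.real_smul]
    push_cast
    field_simp
  have hEsd : ∀ x y, 1 < x → 0 < y → x * y < ρ →
      HasDerivAt (fun x => Es (x, y)) (H (x, y)) x := by
    intro x y hx hy hxy
    have hx0 : 0 < x := by linarith
    have hxc : (x : ℂ) ≠ 0 := by exact_mod_cast hx0.ne'
    have hp := hreg x y hx hy hxy
    have hi : HasDerivAt (fun x : ℝ => 1 / x) (-(1 / x) ^ 2) x := by
      have := hasDerivAt_inv hx0.ne'
      simp only [one_div]
      refine this.congr_deriv ?_
      rw [inv_pow]
    have h1 := (hDrd _ hp).comp_hasDerivAt (f := fun x : ℝ => (y * x, 1 - (1 / x) ^ 2)) x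
      (((hasDerivAt_id x).const_mul y).prodMk ((hi.pow 2).const_sub 1))
    have h2 := hi.ofReal_comp.mul h1
    refine h2.congr_deriv ?_
    have hl : ∀ a b : ℝ, fderiv ℝ Dr (y * x, 1 - (1 / x) ^ 2) (a, b) =
        a * fderiv ℝ Dr (y * x, 1 - (1 / x) ^ 2) (1, 0) +
        b * fderiv ℝ Dr (y * x, 1 - (1 / x) ^ 2) (0, 1) := by
      intro a b
      have : ((a, b) : ℝ × ℝ) = a • (1, 0) + b • (0, 1) := by simp
      rw [this, map_add, map_smul, map_smul, Complex.real_smul, Complex.real_smul]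
    rw [hl]
    have h3 := hpde _ _ hp
    simp only [hH, hPdef]
    rw [hEce x y hx.le hy.le hxy.le, mul_comm x y, hQq (y * x) (Ioo_subset_Icc_self hp.1)]
    simp only [Function.comp]
    generalize fderiv ℝ Dr (y * x, 1 - (1 / x) ^ 2) (1, 0) = A at *
    generalize fderiv ℝ Dr (y * x, 1 - (1 / x) ^ 2) (0, 1) = B at *
    generalize Dr (y * x, 1 - (1 / x) ^ 2) = C at *
    generalize G (y * x) (1 - (1 / x) ^ 2) = G₀ at *
    generalize q (y * x) = q₀ at *
    push_cast at h3 ⊢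
    field_simp at h3 ⊢
    linear_combination h3
  -- If `Ec` solves the Goursat equation, this depends on y alone. An arbitrary kernel need not have
  -- derivatives on the edges, so independence of x is first proved for x > 1: the y-derivatives at
  -- two abscissae agree and both functions vanish at y = 0. Continuity then reaches x = 1, where
  -- the initial condition gives the value.
  let Δ : ℝ × ℝ → ℂ := fun p => Ec p - doubleIntegral H p
  have hΔ : Continuous Δ := hEcc.sub (continuous_doubleIntegral hHc)
  have hΔ0 : ∀ x, 1 ≤ x → Δ (x, 0) = 0 := by
    intro x hx
    simp only [Δ, hEce x 0 hx le_rfl (by simpa using hρ.le), zero_mul, hG.init_r _ (hmem x hx),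
      mul_zero, doubleIntegral, intervalIntegral.integral_same, sub_zero]
  have hstep : ∀ x₁ x₂ y, 1 < x₁ → x₁ ≤ x₂ → 0 ≤ y → x₂ * y < ρ → Δ (x₂, y) = Δ (x₁, y) := by
    intro x₁ x₂ y h1 h2 hy hxy
    have h := eq_of_hasDerivAt_eq_zero (f := fun z => Δ (x₂, z) - Δ (x₁, z)) hy
      (by fun_prop) (fun z hz => by
        have hz2 : x₂ * z < ρ := lt_of_le_of_lt (by gcongr; exacts [by linarith, hz.2.le]) hxy
        have hzx : ∀ x, x ≤ x₂ → x * z < ρ := fun x hx =>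
          lt_of_le_of_lt (mul_le_mul_of_nonneg_right hx hz.1.le) hz2
        have a1 := (hEs x₂ z (h1.trans_le h2) hz.1 hz2).sub
          (hasDerivAt_doubleIntegral_snd hHc x₂ z)
        have a2 := (hEs x₁ z h1 hz.1 (hzx x₁ h2)).sub (hasDerivAt_doubleIntegral_snd hHc x₁ z)
        refine (a1.sub a2).congr_deriv ?_
        have hHz : Continuous fun x => H (x, z) := by fun_prop
        have a3 := intervalIntegral.integral_eq_sub_of_hasDerivAt (a := x₁) (b := x₂)
          (f := fun x => Es (x, z)) (f' := fun x => H (x, z)) (fun x hx => by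
            rw [uIcc_of_le h2] at hx
            exact hEsd x z (h1.trans_le hx.1) hz.1 (hzx x hx.2)) (hHz.intervalIntegrable _ _)
        have a4 := intervalIntegral.integral_add_adjacent_intervals
          (hHz.intervalIntegrable (μ := volume) 1 x₁) (hHz.intervalIntegrable x₁ x₂)
        rw [← a4, a3]
        ring)
    simp only [hΔ0 x₁ h1.le, hΔ0 x₂ (h1.le.trans h2), sub_zero] at h
    exact sub_eq_zero.1 h
  have hone : ∀ y ∈ Icc 0 ρ, Δ (1, y) = ∫ z in (0 : ℝ)..y, P z := by
    intro y hy
    have e : ∫ z in (0 : ℝ)..y, P z = ∫ z in (0 : ℝ)..y, (z : ℂ) * q z := by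
      refine intervalIntegral.integral_congr fun z hz => ?_
      rw [uIcc_of_le hy.1] at hz
      simp only [hPdef, hQq z ⟨hz.1, hz.2.trans hy.2⟩]
    rw [e, ← hG.init_t y hy]
    simp only [Δ, hEce 1 y le_rfl hy.1 (by simpa using hy.2), doubleIntegral,
      intervalIntegral.integral_same, intervalIntegral.integral_zero]
    norm_num
  have hgour : ∀ x y, 1 ≤ x → 0 ≤ y → x * y ≤ ρ → Ec (x, y) = goursatMap P Ec (x, y) := by
    suffices h : ∀ x y, 1 ≤ x → 0 ≤ y → x * y ≤ ρ → Δ (x, y) = ∫ z in (0 : ℝ)..y, P z by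
      intro x y hx hy hxy
      have := h x y hx hy hxy
      simp only [Δ] at this
      rw [goursatMap, ← this]
      simp only [hH]
      ring
    intro x y hx hy hxy
    rcases hx.eq_or_lt with rfl | hx
    · exact hone y ⟨hy, by linarith⟩
    have hx0 : 0 < x := by linarith
    have hstrict : ∀ z ∈ Ico 0 (ρ / x), Δ (x, z) = ∫ z in (0 : ℝ)..z, P z := by
      intro z hz
      have hxz : x * z < ρ := by have := (lt_div_iff₀ hx0).1 hz.2; linarith
      rw [← hone z ⟨hz.1, by nlinarith [hz.1]⟩]
      have hcl : EqOn (fun s => Δ (x, z)) (fun s => Δ (s, z)) (closure (Ioc 1 x)) :=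
        EqOn.closure (fun s hs => hstep s x z hs.1 hs.2 hz.1 hxz) continuous_const (by fun_prop)
      rw [closure_Ioc hx.ne] at hcl
      exact hcl ⟨le_rfl, hx.le⟩
    have hcl : EqOn (fun z => Δ (x, z)) (fun z => ∫ z in (0 : ℝ)..z, P z)
        (closure (Ico 0 (ρ / x))) :=
      EqOn.closure hstrict (by fun_prop) (contDiff_one_primitive hPc 0).continuous
    rw [closure_Ico (by positivity : (0 : ℝ) < ρ / x).ne] at hcl
    exact hcl ⟨hy, by rw [le_div_iff₀ hx0]; linarith⟩
  -- comparison with the radial kernel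
  set K : ℝ × ℝ → ℂ := fun p => (p.2 : ℂ) ^ 2 * g (p.2 * max p.1 1, 1 / max p.1 1) with hK
  have hKc : Continuous K := by
    have : Continuous fun q : ℝ × ℝ => g (q.2 * max q.1 1, 1 / max q.1 1) :=
      hgc.comp ((by fun_prop : Continuous fun q : ℝ × ℝ => q.2 * max q.1 1).prodMk
        continuous_max_inv)
    exact (by fun_prop : Continuous fun q : ℝ × ℝ => (q.2 : ℂ) ^ 2).mul this
  have hlt : ∀ t ∈ Ico (0 : ℝ) 1, G r t = radialKernel g r t := by
    intro t ht
    have hm0 : 0 < Real.sqrt (1 - t) := Real.sqrt_pos.2 (by linarith [ht.2])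
    have hm1 : Real.sqrt (1 - t) ≤ 1 := Real.sqrt_le_one.2 (by linarith [ht.1])
    have hm2 : Real.sqrt (1 - t) ^ 2 = 1 - t := Real.sq_sqrt (by linarith [ht.2])
    unfold radialKernel
    set m := Real.sqrt (1 - t)
    have hx : 1 ≤ m⁻¹ := (one_le_inv₀ hm0).2 hm1
    have hmc : (m : ℂ) ≠ 0 := by exact_mod_cast hm0.ne'
    have hxy : m⁻¹ * (r * m) = r := by field_simp
    have h0 := goursatMap_unique (P := P) (R := ρ) hPc hEcc hKc hM hgour
      (fun x y hx _ _ => by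
        rw [← radialMap_fixedPoint_goursat hQ hgc hg hx]
        simp only [hK, max_eq_left hx])
      hx (mul_nonneg hr.1 hm0.le) (by rw [hxy]; exact hr.2)
    rw [hEce _ _ hx (mul_nonneg hr.1 hm0.le) (by rw [hxy]; exact hr.2)] at h0
    simp only [hK, max_eq_left hx] at h0
    have e1 : r * m * m⁻¹ = r := by field_simp
    have e2 : 1 / m⁻¹ = m := by field_simp
    have e3 : 1 - m ^ 2 = t := by rw [hm2]; ring
    rw [e1, e2, e3] at h0
    have hm2c : (m : ℂ) ^ 2 ≠ 0 := pow_ne_zero 2 hmc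
    apply mul_left_cancel₀ hm2c
    rw [h0]
    push_cast
    ring
  have hcl : EqOn (fun t => G r t) (fun t => radialKernel g r t) (Icc 0 1) := by
    refine EqOn.of_subset_closure (s := Ico 0 1) hlt ?_ ?_ Ico_subset_Icc_self
      (by rw [closure_Ico zero_ne_one])
    · exact hG.continuousOn.comp (f := fun t : ℝ => (r, t)) (by fun_prop) (fun t ht => ⟨hr, ht⟩)
    · exact ((continuous_radialKernel hgc).comp
        (by fun_prop : Continuous fun t : ℝ => (r, t))).continuousOn
  exact hcl ht

end KernelUniqueness

/-! ### Regular solutions of the perturbed Bessel equation. -/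

section Bessel

theorem eq_of_hasDerivAt_eq_zero_Ioo {f : ℝ → ℂ} {l u : ℝ}
    (hd : ∀ x ∈ Ioo l u, HasDerivAt f 0 x) {a b : ℝ} (ha : a ∈ Ioo l u) (hb : b ∈ Ioo l u) :
    f a = f b := by
  wlog hab : a ≤ b generalizing a b
  · exact (this hb ha (le_of_not_ge hab)).symm
  have hs : Icc a b ⊆ Ioo l u := fun x hx => ⟨ha.1.trans_le hx.1, hx.2.trans_lt hb.2⟩
  exact (eq_of_hasDerivAt_eq_zero hab
    (fun x hx => (hd x (hs hx)).continuousAt.continuousWithinAt)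
    (fun x hx => hd x (hs (Ioo_subset_Icc_self hx)))).symm

/-- A solution of a linear system `a' = α b`, `b' = β a` that vanishes at one point vanishes. -/
theorem linear_system_eq_zero {a b α β : ℝ → ℂ} {l u : ℝ} (hα : ContinuousOn α (Ioo l u))
    (hβ : ContinuousOn β (Ioo l u)) (ha : ∀ r ∈ Ioo l u, HasDerivAt a (α r * b r) r)
    (hb : ∀ r ∈ Ioo l u, HasDerivAt b (β r * a r) r) {r₀ : ℝ} (hr₀ : r₀ ∈ Ioo l u)
    (ha₀ : a r₀ = 0) (hb₀ : b r₀ = 0) {r : ℝ} (hr : r ∈ Ioo l u) : a r = 0 ∧ b r = 0 := by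
  -- The coefficients may blow up at the ends, so the Lipschitz bound is taken on a compact
  -- subinterval containing both points.
  obtain ⟨l', hl', hl''⟩ := exists_between (lt_min hr.1 hr₀.1)
  obtain ⟨u', hu', hu''⟩ := exists_between (max_lt hr.2 hr₀.2)
  rw [lt_min_iff] at hl''
  rw [max_lt_iff] at hu'
  have hs : Icc l' u' ⊆ Ioo l u := fun x hx => ⟨hl'.trans_le hx.1, hx.2.trans_lt hu''⟩
  obtain ⟨A, hA⟩ := isCompact_Icc.exists_bound_of_continuousOn (hα.mono hs)
  obtain ⟨B, hB⟩ := isCompact_Icc.exists_bound_of_continuousOn (hβ.mono hs)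
  let v : ℝ → ℂ × ℂ → ℂ × ℂ := fun t x => (α t * x.2, β t * x.1)
  have hK : ∀ t ∈ Ioo l' u', LipschitzOnWith (Real.toNNReal (max A B)) (v t) univ := by
    intro t ht
    refine LipschitzOnWith.of_dist_le_mul fun x _ y _ => ?_
    have h0 : 0 ≤ max A B :=
      ((norm_nonneg _).trans (hA t (Ioo_subset_Icc_self ht))).trans (le_max_left _ _)
    rw [Real.coe_toNNReal _ h0, Prod.dist_eq]
    refine max_le ?_ ?_
    · simp only [v]
      rw [dist_eq_norm, ← mul_sub, norm_mul, ← dist_eq_norm]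
      exact mul_le_mul ((hA t (Ioo_subset_Icc_self ht)).trans (le_max_left _ _))
        (le_max_right _ _) dist_nonneg h0
    · simp only [v]
      rw [dist_eq_norm, ← mul_sub, norm_mul, ← dist_eq_norm]
      exact mul_le_mul ((hB t (Ioo_subset_Icc_self ht)).trans (le_max_right _ _))
        (le_max_left _ _) dist_nonneg h0
  have := ODE_solution_unique_of_mem_Ioo (v := v) (s := fun _ => univ) (f := fun t => (a t, b t))
    (g := fun _ => 0) hK ⟨hl''.2, hu'.2⟩
    (fun t ht => ⟨(ha t (hs (Ioo_subset_Icc_self ht))).prodMk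
      (hb t (hs (Ioo_subset_Icc_self ht))), mem_univ _⟩)
    (fun t ht => ⟨(hasDerivAt_const t (0 : ℂ × ℂ)).congr_deriv (by simp [v, Prod.zero_eq_mk]),
      mem_univ _⟩)
    (by simp [ha₀, hb₀]) ⟨hl''.1, hu'.1⟩
  simpa using this

theorem IsRegularBesselSolution.hasDerivAt {q y : ℝ → ℂ} {ρ : ℝ} {n : ℕ}
    (h : IsRegularBesselSolution q ρ n y) {r : ℝ} (hr : r ∈ Ioo 0 ρ) :
    HasDerivAt y (deriv y r) r ∧ HasDerivAt (deriv y)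
      ((((n : ℂ) - 1 / 2) * ((n : ℂ) + 1 / 2) / (r : ℂ) ^ 2 + q r) * y r) r := by
  have h1 := h.contDiffOn.contDiffAt (isOpen_Ioo.mem_nhds hr)
  refine ⟨(h1.differentiableAt two_ne_zero).hasDerivAt, ?_⟩
  have h2 := ((contDiffOn_succ_iff_deriv_of_isOpen (n := 1) (f := y) isOpen_Ioo).1
    (by exact_mod_cast h.contDiffOn)).2.2
  have h3 := ((h2.contDiffAt (isOpen_Ioo.mem_nhds hr)).differentiableAt one_ne_zero).hasDerivAt
  refine h3.congr_deriv ?_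
  linear_combination -(h.ode r hr)

theorem natCast_add_half_ne_zero (n : ℕ) : ((n : ℂ) + 1 / 2) ≠ 0 := by
  have h : (((n : ℝ) + 1 / 2 : ℝ) : ℂ) ≠ 0 := by
    rw [Complex.ofReal_ne_zero]; positivity
  push_cast at h
  exact h

theorem tendsto_pow_nhdsGT_zero (k : ℕ) :
    Tendsto (fun r : ℝ => (r : ℂ) ^ k) (𝓝[>] 0) (𝓝 ((0 : ℂ) ^ k)) := by
  have : Continuous fun r : ℝ => (r : ℂ) ^ k := by fun_prop
  have h := (this.tendsto 0).mono_left (nhdsWithin_le_nhds (s := Ioi (0 : ℝ)))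
  simpa using h

/-- Regular solutions of the perturbed Bessel equation are unique. -/
theorem IsRegularBesselSolution.unique {q y z : ℝ → ℂ} {ρ : ℝ} {n : ℕ} (hρ : 0 < ρ)
    (hq : ContinuousOn q (Icc 0 ρ)) (hy : IsRegularBesselSolution q ρ n y)
    (hz : IsRegularBesselSolution q ρ n z) {r : ℝ} (hr : r ∈ Icc 0 ρ) : y r = z r := by
  let V : ℝ → ℂ := fun r => ((n : ℂ) - 1 / 2) * ((n : ℂ) + 1 / 2) / (r : ℂ) ^ 2 + q r
  have hV : ContinuousOn V (Ioo 0 ρ) := by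
    refine ContinuousOn.add (ContinuousOn.div continuousOn_const (by fun_prop) fun x hx => ?_)
      (hq.mono Ioo_subset_Icc_self)
    exact pow_ne_zero 2 (by exact_mod_cast hx.1.ne')
  let w : ℝ → ℂ := fun r => y r * deriv z r - deriv y r * z r
  have hw : ∀ r ∈ Ioo 0 ρ, HasDerivAt w 0 r := fun r hr => by
    obtain ⟨a1, a2⟩ := hy.hasDerivAt hr
    obtain ⟨b1, b2⟩ := hz.hasDerivAt hr
    refine ((a1.mul b2).sub (a2.mul b1)).congr_deriv ?_
    ring
  have hc := natCast_add_half_ne_zero n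
  -- The Wronskian is (n + 1/2) r²ⁿ times a difference of two products that both tend to 1. For n =
  -- 0 the power does not decay and it is this cancellation that gives the limit.
  have hlim : Tendsto w (𝓝[>] 0) (𝓝 0) := by
    have h1 := (hy.asymp.mul hz.asymp_deriv).sub (hy.asymp_deriv.mul hz.asymp)
    have h2 := (((tendsto_pow_nhdsGT_zero (2 * n)).const_mul ((n : ℂ) + 1 / 2))).mul h1
    simp only [mul_one, sub_self, mul_zero] at h2
    refine h2.congr' ?_
    filter_upwards [self_mem_nhdsWithin] with r (hr : 0 < r)
    have hrc : (r : ℂ) ≠ 0 := by exact_mod_cast hr.ne'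
    have e1 : r ^ ((n : ℝ) + 1 / 2) = r ^ n * r ^ (1 / 2 : ℝ) := by
      rw [Real.rpow_add hr, Real.rpow_natCast]
    have e2 : r ^ ((n : ℝ) - 1 / 2) = r ^ n / r ^ (1 / 2 : ℝ) := by
      rw [Real.rpow_sub hr, Real.rpow_natCast]
    have hs : ((r ^ (1 / 2 : ℝ) : ℝ) : ℂ) ≠ 0 := by
      exact_mod_cast (Real.rpow_pos_of_pos hr _).ne'
    rw [e1, e2]
    simp only [w]
    push_cast
    generalize ((r ^ (1 / 2 : ℝ) : ℝ) : ℂ) = s at hs ⊢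
    generalize (n : ℂ) + 1 / 2 = c at hc ⊢
    field_simp
    ring
  have hw0 : ∀ r ∈ Ioo 0 ρ, w r = 0 := fun r hr => by
    have : Tendsto w (𝓝[>] 0) (𝓝 (w r)) := by
      refine tendsto_const_nhds.congr' ?_
      filter_upwards [Ioo_mem_nhdsGT hρ] with s hs
      exact eq_of_hasDerivAt_eq_zero_Ioo hw hr hs
    exact tendsto_nhds_unique this hlim
  -- `z` does not vanish near `0`
  have hne : ∀ᶠ r in 𝓝[>] (0 : ℝ), z r ≠ 0 := by
    have := hz.asymp.eventually_ne one_ne_zero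
    filter_upwards [this] with r hr h
    exact hr (by simp [h])
  obtain ⟨δ, hδ, hδz⟩ := mem_nhdsGT_iff_exists_Ioo_subset.1 hne
  have hδ0 : 0 < min δ ρ := lt_min hδ hρ
  have hquot : ∀ r ∈ Ioo 0 (min δ ρ), HasDerivAt (fun r => y r / z r) 0 r := fun r hr => by
    have hr' : r ∈ Ioo 0 ρ := ⟨hr.1, hr.2.trans_le (min_le_right _ _)⟩
    have hzr : z r ≠ 0 := hδz ⟨hr.1, hr.2.trans_le (min_le_left _ _)⟩
    refine ((hy.hasDerivAt hr').1.div (hz.hasDerivAt hr').1 hzr).congr_deriv ?_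
    rw [div_eq_zero_iff]
    left
    have := hw0 r hr'
    simp only [w] at this
    linear_combination -this
  have hql : Tendsto (fun r => y r / z r) (𝓝[>] 0) (𝓝 1) := by
    have h1 := hy.asymp.div hz.asymp one_ne_zero
    rw [div_one] at h1
    refine h1.congr' ?_
    filter_upwards [self_mem_nhdsWithin] with r (hr : 0 < r)
    have hs : ((r ^ ((n : ℝ) + 1 / 2) : ℝ) : ℂ) ≠ 0 := by
      exact_mod_cast (Real.rpow_pos_of_pos hr _).ne'
    exact div_div_div_cancel_right₀ hs _ _
  obtain ⟨r₀, hr₀⟩ : (Ioo 0 (min δ ρ)).Nonempty := nonempty_Ioo.2 hδ0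
  have heq : ∀ r ∈ Ioo 0 (min δ ρ), y r = z r := fun r hr => by
    have : Tendsto (fun r => y r / z r) (𝓝[>] 0) (𝓝 (y r / z r)) := by
      refine tendsto_const_nhds.congr' ?_
      filter_upwards [Ioo_mem_nhdsGT hδ0] with s hs
      exact eq_of_hasDerivAt_eq_zero_Ioo hquot hr hs
    have h1 := tendsto_nhds_unique this hql
    have hzr : z r ≠ 0 := hδz ⟨hr.1, hr.2.trans_le (min_le_left _ _)⟩
    rwa [div_eq_one_iff_eq hzr] at h1
  have hr₀' : r₀ ∈ Ioo 0 ρ := ⟨hr₀.1, hr₀.2.trans_le (min_le_right _ _)⟩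
  have hder : deriv y r₀ = deriv z r₀ := by
    refine Filter.EventuallyEq.deriv_eq ?_
    filter_upwards [isOpen_Ioo.mem_nhds hr₀] with s hs using heq s hs
  have hIoo : EqOn y z (Ioo 0 ρ) := fun r hr => by
    -- The quotient argument works only near 0, since `z` may vanish farther out; from `r₀` on,
    -- uniqueness for the linear equation takes over.
    have := (linear_system_eq_zero (a := fun r => y r - z r) (b := fun r => deriv y r - deriv z r)
      (α := fun _ => 1) (β := V) continuousOn_const hV
      (fun r hr => ((hy.hasDerivAt hr).1.sub (hz.hasDerivAt hr).1).congr_deriv (by ring))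
      (fun r hr => ((hy.hasDerivAt hr).2.sub (hz.hasDerivAt hr).2).congr_deriv (by
        simp only [V]; ring))
      hr₀' (by simp [heq r₀ hr₀]) (by simp [hder]) hr).1
    exact sub_eq_zero.1 this
  exact hIoo.of_subset_closure hy.continuousOn hz.continuousOn Ioo_subset_Icc_self
    (by rw [closure_Ioo hρ.ne]) hr

/-- `φ` with `φ(0) = 1` and `φ'' + (2n+1) φ'/r = q φ` gives the regular Bessel solution
`r^{n+1/2} φ(r)`. -/
theorem isRegularBesselSolution_of_radial {q φ dφ : ℝ → ℂ} {ρ : ℝ} {n : ℕ} (hρ : 0 < ρ)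
    (hq : ContinuousOn q (Ioo 0 ρ)) (hc : ContinuousOn φ (Icc 0 ρ)) (h0 : φ 0 = 1)
    (hd : ∀ r ∈ Ioo 0 ρ, HasDerivAt φ (dφ r) r)
    (hdd : ∀ r ∈ Ioo 0 ρ, HasDerivAt dφ (q r * φ r - (2 * n + 1) / r * dφ r) r)
    (hlim : Tendsto (fun r : ℝ => (r : ℂ) * dφ r) (𝓝[>] 0) (𝓝 0)) :
    IsRegularBesselSolution q ρ n fun r => ((r ^ ((n : ℝ) + 1 / 2) : ℝ) : ℂ) * φ r := by
  set R : ℝ → ℂ := fun r => ((r ^ ((n : ℝ) + 1 / 2) : ℝ) : ℂ) with hR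
  have hR0 : ∀ r : ℝ, 0 < r → R r ≠ 0 := fun r hr =>
    Complex.ofReal_ne_zero.2 (Real.rpow_pos_of_pos hr _).ne'
  have hRd : ∀ r : ℝ, 0 < r → HasDerivAt R (((n : ℂ) + 1 / 2) / r * R r) r := fun r hr => by
    have h1 := (Real.hasDerivAt_rpow_const (p := (n : ℝ) + 1 / 2) (Or.inl hr.ne')).ofReal_comp
    refine h1.congr_deriv ?_
    rw [Real.rpow_sub hr, Real.rpow_one]
    simp only [hR]
    push_cast
    ring
  have hφc : ContinuousOn φ (Ioo 0 ρ) := hc.mono Ioo_subset_Icc_self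
  have hy : ∀ r ∈ Ioo 0 ρ, HasDerivAt (fun r => R r * φ r)
      (R r * (((n : ℂ) + 1 / 2) / r * φ r + dφ r)) r := fun r hr =>
    ((hRd r hr.1).mul (hd r hr)).congr_deriv (by ring)
  have hy' : ∀ r ∈ Ioo 0 ρ, HasDerivAt (fun r => R r * (((n : ℂ) + 1 / 2) / r * φ r + dφ r))
      ((((n : ℂ) - 1 / 2) * ((n : ℂ) + 1 / 2) / (r : ℂ) ^ 2 + q r) * (R r * φ r)) r := by
    intro r hr
    have hrc : (r : ℂ) ≠ 0 := by exact_mod_cast hr.1.ne'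
    have hi : HasDerivAt (fun r : ℝ => ((n : ℂ) + 1 / 2) / (r : ℂ))
        (-((n : ℂ) + 1 / 2) / (r : ℂ) ^ 2) r := by
      have := ((hasDerivAt_id r).ofReal_comp.inv hrc).const_mul ((n : ℂ) + 1 / 2)
      simp only [div_eq_mul_inv]
      refine this.congr_deriv ?_
      simp; ring
    refine ((hRd r hr.1).mul ((hi.mul (hd r hr)).add (hdd r hr))).congr_deriv ?_
    simp only [Pi.add_apply, Pi.mul_apply]
    field_simp
    ring
  have hdy : ∀ r ∈ Ioo 0 ρ, deriv (fun r => R r * φ r) r =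
      R r * (((n : ℂ) + 1 / 2) / r * φ r + dφ r) := fun r hr => (hy r hr).deriv
  have hdyd : ∀ r ∈ Ioo 0 ρ, HasDerivAt (deriv fun r => R r * φ r)
      ((((n : ℂ) - 1 / 2) * ((n : ℂ) + 1 / 2) / (r : ℂ) ^ 2 + q r) * (R r * φ r)) r := by
    intro r hr
    refine (hy' r hr).congr_of_eventuallyEq ?_
    filter_upwards [isOpen_Ioo.mem_nhds hr] with s hs using hdy s hs
  have hRc : Continuous R := by
    have : Continuous fun r : ℝ => r ^ ((n : ℝ) + 1 / 2) :=
      Real.continuous_rpow_const (by positivity)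
    exact Complex.continuous_ofReal.comp this
  have hφ0 : Tendsto φ (𝓝[>] 0) (𝓝 1) := by
    have := (hc 0 ⟨le_rfl, hρ.le⟩).tendsto.mono_left (nhdsWithin_mono 0 Ioo_subset_Icc_self)
    rwa [h0, nhdsWithin_Ioo_eq_nhdsGT hρ] at this
  refine ⟨hRc.continuousOn.mul hc, ?_, ?_, ?_, ?_⟩
  · have h2 : ContDiffOn ℝ 1 (deriv fun r => R r * φ r) (Ioo 0 ρ) := by
      have := (contDiffOn_succ_iff_deriv_of_isOpen (n := 0)
        (f := deriv fun r => R r * φ r) (isOpen_Ioo (a := (0 : ℝ)) (b := ρ)) (𝕜 := ℝ)).2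
        ⟨fun r hr => (hdyd r hr).differentiableAt.differentiableWithinAt, by simp, ?_⟩
      · exact_mod_cast this
      rw [contDiffOn_zero]
      refine ContinuousOn.congr ?_ (fun r hr => (hdyd r hr).deriv)
      refine ContinuousOn.mul (ContinuousOn.add (ContinuousOn.div continuousOn_const
        (by fun_prop) fun x hx => pow_ne_zero 2 (by exact_mod_cast hx.1.ne')) hq)
        (hRc.continuousOn.mul hφc)
    have := (contDiffOn_succ_iff_deriv_of_isOpen (n := 1)
        (f := fun r => R r * φ r) (isOpen_Ioo (a := (0 : ℝ)) (b := ρ)) (𝕜 := ℝ)).2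
        ⟨fun r hr => (hy r hr).differentiableAt.differentiableWithinAt, by simp, h2⟩
    exact_mod_cast this
  · intro r hr
    rw [(hdyd r hr).deriv]
    ring
  · refine hφ0.congr' ?_
    filter_upwards [self_mem_nhdsWithin] with r (hr : 0 < r)
    rw [mul_div_cancel_left₀ _ (hR0 r hr)]
  · have hc' := natCast_add_half_ne_zero n
    have h1 := hφ0.add (hlim.div_const ((n : ℂ) + 1 / 2))
    rw [zero_div, add_zero] at h1
    refine h1.congr' ?_
    filter_upwards [Ioo_mem_nhdsGT hρ] with r hr
    rw [hdy r hr]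
    have hrc : (r : ℂ) ≠ 0 := by exact_mod_cast hr.1.ne'
    have e : ((((n : ℝ) + 1 / 2) * r ^ ((n : ℝ) - 1 / 2) : ℝ) : ℂ) =
        ((n : ℂ) + 1 / 2) * (R r / r) := by
      have : r ^ ((n : ℝ) - 1 / 2) = r ^ ((n : ℝ) + 1 / 2) / r := by
        rw [← Real.rpow_sub_one hr.1.ne']; congr 1; ring
      rw [this]
      simp only [hR]
      push_cast
      ring
    rw [e]
    have := hR0 r hr.1
    generalize (n : ℂ) + 1 / 2 = c at hc' ⊢
    field_simp

end Bessel

/-! ### Moments of the kernel and their differential equation. -/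

section Moments

theorem intervalIntegral_congr_Ioo {f g : ℝ → ℂ} {a b : ℝ} (hab : a ≤ b)
    (h : ∀ x ∈ Ioo a b, f x = g x) : ∫ x in a..b, f x = ∫ x in a..b, g x := by
  rw [intervalIntegral.integral_of_le hab, intervalIntegral.integral_of_le hab,
    integral_Ioc_eq_integral_Ioo, integral_Ioc_eq_integral_Ioo]
  exact setIntegral_congr_fun measurableSet_Ioo h

/-- Fubini on the unit square for `h` cut off to the triangle x < y. -/
theorem integral_triangle_swap {h : ℝ × ℝ → ℂ} (hh : Continuous h) :
    ∫ x in (0 : ℝ)..1, ∫ y in x..1, h (x, y) = ∫ y in (0 : ℝ)..1, ∫ x in (0 : ℝ)..y, h (x, y) := by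
  let F : ℝ → ℝ → ℂ := fun x y => {p : ℝ × ℝ | p.1 < p.2}.indicator h (x, y)
  have hm : MeasurableSet {p : ℝ × ℝ | p.1 < p.2} := measurableSet_lt measurable_fst measurable_snd
  have hI : IntegrableOn F.uncurry (uIoc (0 : ℝ) 1 ×ˢ uIoc (0 : ℝ) 1) := by
    have h1 : IntegrableOn h (uIoc (0 : ℝ) 1 ×ˢ uIoc (0 : ℝ) 1) :=
      (hh.continuousOn.integrableOn_compact (isCompact_uIcc.prod isCompact_uIcc)
        (K := uIcc (0 : ℝ) 1 ×ˢ uIcc (0 : ℝ) 1)).mono_set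
        (prod_mono uIoc_subset_uIcc uIoc_subset_uIcc)
    exact Integrable.indicator h1 hm
  have h1 : ∀ x ∈ Icc (0 : ℝ) 1, ∫ y in (0 : ℝ)..1, F x y = ∫ y in x..1, h (x, y) := by
    intro x hx
    have a1 : ∫ y in (0 : ℝ)..x, F x y = 0 := by
      rw [intervalIntegral.integral_congr (g := fun _ => 0), intervalIntegral.integral_zero]
      intro y hy
      rw [uIcc_of_le hx.1] at hy
      exact indicator_of_notMem (by simpa using hy.2) _
    have a2 : ∫ y in x..1, F x y = ∫ y in x..1, h (x, y) := by
      refine intervalIntegral.integral_congr_ae (Eventually.of_forall fun y hy => ?_)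
      rw [uIoc_of_le hx.2] at hy
      exact indicator_of_mem (by simpa using hy.1) _
    have i1 : IntervalIntegrable (F x) volume 0 x := by
      refine (intervalIntegrable_const (c := (0 : ℂ))).congr ?_
      intro y hy
      rw [uIoc_of_le hx.1] at hy
      exact (indicator_of_notMem (by simpa using hy.2) _).symm
    have i2 : IntervalIntegrable (F x) volume x 1 := by
      refine ((by fun_prop : Continuous fun y => h (x, y)).intervalIntegrable x 1).congr ?_
      intro y hy
      rw [uIoc_of_le hx.2] at hy
      exact (indicator_of_mem (by simpa using hy.1) _).symm
    rw [← intervalIntegral.integral_add_adjacent_intervals i1 i2, a1, a2, zero_add]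
  have h2 : ∀ y ∈ Icc (0 : ℝ) 1, ∫ x in (0 : ℝ)..1, F x y = ∫ x in (0 : ℝ)..y, h (x, y) := by
    intro y hy
    have a1 : ∫ x in y..1, F x y = 0 := by
      rw [intervalIntegral.integral_congr (g := fun _ => 0), intervalIntegral.integral_zero]
      intro x hx
      rw [uIcc_of_le hy.2] at hx
      exact indicator_of_notMem (by simpa using hx.1) _
    have a2 : ∫ x in (0 : ℝ)..y, F x y = ∫ x in (0 : ℝ)..y, h (x, y) := by
      refine intervalIntegral_congr_Ioo hy.1 fun x hx => ?_
      exact indicator_of_mem (by simpa using hx.2) _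
    have i1 : IntervalIntegrable (fun x => F x y) volume y 1 := by
      refine (intervalIntegrable_const (c := (0 : ℂ))).congr ?_
      intro x hx
      rw [uIoc_of_le hy.2] at hx
      exact (indicator_of_notMem (by simpa using hx.1.le) _).symm
    have i2 : IntervalIntegrable (fun x => F x y) volume 0 y := by
      have hc := (by fun_prop : Continuous fun x => h (x, y)).intervalIntegrable (μ := volume) 0 y
      rw [intervalIntegrable_iff_integrableOn_Ioo_of_le hy.1] at hc ⊢
      refine hc.congr_fun (fun x hx => ?_) measurableSet_Ioo
      exact (indicator_of_mem (by simpa using hx.2) _).symm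
    rw [← intervalIntegral.integral_add_adjacent_intervals i2 i1, a1, a2, add_zero]
  have h3 := intervalIntegral_intervalIntegral_swap hI
  rw [intervalIntegral.integral_congr (g := fun x => ∫ y in x..1, h (x, y)),
    intervalIntegral.integral_congr (g := fun y => ∫ x in (0 : ℝ)..y, h (x, y))
      (f := fun y => ∫ x in (0 : ℝ)..1, F x y)] at h3
  · exact h3
  · intro y hy
    rw [uIcc_of_le zero_le_one] at hy
    exact h2 y hy
  · intro x hx
    rw [uIcc_of_le zero_le_one] at hx
    exact h1 x hx

/-- The moments of the radial kernel. -/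
noncomputable def radialMoment (g : ℝ × ℝ → ℂ) (n : ℕ) (r : ℝ) : ℂ :=
  ∫ s in (0 : ℝ)..1, (s : ℂ) ^ (2 * n + 1) * g (r, s)

/-- The radial factor of the image of `zⁿ`. -/
noncomputable def radialPhi (g : ℝ × ℝ → ℂ) (n : ℕ) (r : ℝ) : ℂ :=
  1 + (r : ℂ) ^ 2 * radialMoment g n r

/-- `φ'(r) / r`. -/
noncomputable def radialSlope (Q : ℝ → ℂ) (g : ℝ × ℝ → ℂ) (n : ℕ) (x : ℝ) : ℂ :=
  ∫ k in (0 : ℝ)..1, (k : ℂ) ^ (2 * n + 1) * (Q (x * k) * radialPhi g n (x * k))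

variable {Q : ℝ → ℂ} {g : ℝ × ℝ → ℂ} {l N : ℝ}

theorem continuous_radialMoment (hg : Continuous g) (n : ℕ) : Continuous (radialMoment g n) :=
  intervalIntegral.continuous_parametric_intervalIntegral_of_continuous'
    (f := fun r s => (s : ℂ) ^ (2 * n + 1) * g (r, s)) (by fun_prop) 0 1

theorem continuous_radialPhi (hg : Continuous g) (n : ℕ) : Continuous (radialPhi g n) := by
  have := continuous_radialMoment hg n
  unfold radialPhi
  fun_prop

theorem continuous_radialSlope (hQ : Continuous Q) (hg : Continuous g) (n : ℕ) :
    Continuous (radialSlope Q g n) := by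
  have := continuous_radialPhi hg n
  exact intervalIntegral.continuous_parametric_intervalIntegral_of_continuous'
    (f := fun x k => (k : ℂ) ^ (2 * n + 1) * (Q (x * k) * radialPhi g n (x * k)))
    (by fun_prop) 0 1

/-- With k in [s, 1] as the inner variable, exchange the order over the triangle s < k and put s = k
s'. The argument s/k becomes s', so the moment of g splits off; the powers of k are 2n+1 from the
monomial, one from the kernel and one from ds. -/
theorem integral_pow_mul_radialInner (hQ : Continuous Q) (hg : Continuous g)
    (hN : ∀ p, ‖g p‖ ≤ N * Real.exp (l * p.1 ^ 2)) (n : ℕ) (x : ℝ) :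
    ∫ s in (0 : ℝ)..1, (s : ℂ) ^ (2 * n + 1) * radialInner Q g x s =
      ∫ k in (0 : ℝ)..1, (k : ℂ) ^ (2 * n + 3) * (Q (x * k) * radialMoment g n (x * k)) := by
  let h : ℝ × ℝ → ℂ := fun p => (p.1 : ℂ) ^ (2 * n + 1) *
    (Q (x * p.2) * ((p.2 : ℂ) * g (x * p.2, p.1 / p.2)))
  have hh : Continuous h := by
    have h1 := continuous_mul_comp_div (T := ℝ × ℝ) (k := fun p => p.2) (c := fun p => p.1)
      (y := fun p => x * p.2) (by fun_prop) (by fun_prop) (by fun_prop) hg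
      (w := fun r => Real.exp (l * r ^ 2)) (by fun_prop) hN
    exact (by fun_prop : Continuous fun p : ℝ × ℝ => (p.1 : ℂ) ^ (2 * n + 1)).mul
      ((by fun_prop : Continuous fun p : ℝ × ℝ => Q (x * p.2)).mul h1)
  have e1 : ∀ s : ℝ, (s : ℂ) ^ (2 * n + 1) * radialInner Q g x s = ∫ y in s..1, h (s, y) := by
    intro s
    have h2 := @intervalIntegral.smul_integral_comp_add_mul ℂ _ _ 0 1
      (fun y : ℝ => h (s, y)) (1 - s) s
    simp only [mul_zero, add_zero, mul_one, add_sub_cancel] at h2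
    rw [← h2, Complex.real_smul, radialInner, ← intervalIntegral.integral_const_mul,
      ← intervalIntegral.integral_const_mul]
    refine intervalIntegral.integral_congr fun b _ => ?_
    simp only [h, towardOne]
    ring
  simp_rw [e1]
  rw [integral_triangle_swap hh]
  refine intervalIntegral_congr_Ioo zero_le_one fun k hk => ?_
  have hkc : (k : ℂ) ≠ 0 := by exact_mod_cast hk.1.ne'
  have h2 := @intervalIntegral.smul_integral_comp_mul_left ℂ _ _ 0 1 (fun s : ℝ => h (s, k)) k
  simp only [mul_zero, mul_one] at h2
  rw [← h2, Complex.real_smul, radialMoment, ← intervalIntegral.integral_const_mul,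
    ← intervalIntegral.integral_const_mul, ← intervalIntegral.integral_const_mul]
  refine intervalIntegral.integral_congr fun s _ => ?_
  have e : k * s / k = s := by field_simp [hk.1.ne']
  simp only [h, e]
  push_cast
  ring

/-- Taking the moment of the fixed point equation makes it closed in φ = 1 + r²μ: the source
contributes Q and the inner integral contributes Q r²μ under one integral. This is the radial
equation in integrated form, reached without differentiating the kernel. -/
theorem radialPhi_eq (hQ : Continuous Q) (hg : Continuous g)
    (hN : ∀ p, ‖g p‖ ≤ N * Real.exp (l * p.1 ^ 2)) (hfix : radialMap Q g = g) (n : ℕ) (r : ℝ) :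
    radialPhi g n r = 1 + ∫ x in (0 : ℝ)..r, (x : ℂ) * radialSlope Q g n x := by
  have hμ := continuous_radialMoment hg n
  have hφ := continuous_radialPhi hg n
  have hI := continuous_radialInner hQ hg hN
  have hslope : ∀ x : ℝ, radialSlope Q g n x = ∫ s in (0 : ℝ)..1, (s : ℂ) ^ (2 * n + 1) *
      (Q (x * s) + (x : ℂ) ^ 2 * radialInner Q g x s) := by
    intro x
    have hIx : Continuous fun s => radialInner Q g x s :=
      hI.comp (by fun_prop : Continuous fun s : ℝ => (x, s))
    have e1 : ∫ s in (0 : ℝ)..1, (s : ℂ) ^ (2 * n + 1) *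
        (Q (x * s) + (x : ℂ) ^ 2 * radialInner Q g x s) =
        (∫ s in (0 : ℝ)..1, (s : ℂ) ^ (2 * n + 1) * Q (x * s)) + (x : ℂ) ^ 2 *
          ∫ s in (0 : ℝ)..1, (s : ℂ) ^ (2 * n + 1) * radialInner Q g x s := by
      rw [← intervalIntegral.integral_const_mul, ← intervalIntegral.integral_add]
      · refine intervalIntegral.integral_congr fun s _ => ?_
        ring
      · exact Continuous.intervalIntegrable (by fun_prop) _ _
      · exact Continuous.intervalIntegrable (by fun_prop) _ _
    rw [e1, integral_pow_mul_radialInner hQ hg hN, ← intervalIntegral.integral_const_mul,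
      ← intervalIntegral.integral_add]
    · refine intervalIntegral.integral_congr fun s _ => ?_
      simp only [radialPhi]
      push_cast
      ring
    · exact Continuous.intervalIntegrable (by fun_prop) _ _
    · exact Continuous.intervalIntegrable (by fun_prop) _ _
  have hmom : radialMoment g n r = ∫ a in (0 : ℝ)..1, (a : ℂ) * radialSlope Q g n (r * a) := by
    have hcont := continuous_radialMap_integrand hQ hg hN
    have e1 : radialMoment g n r = ∫ s in (0 : ℝ)..1, ∫ a in (0 : ℝ)..1, (s : ℂ) ^ (2 * n + 1) *
        ((a : ℂ) * (Q (r * a * unitClamp s) +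
          ((r * a : ℝ) : ℂ) ^ 2 * radialInner Q g (r * a) (unitClamp s))) := by
      unfold radialMoment
      refine intervalIntegral.integral_congr fun s _ => ?_
      rw [intervalIntegral.integral_const_mul]
      congr 1
      exact (congrFun hfix (r, s)).symm
    rw [e1, intervalIntegral_intervalIntegral_swap]
    · refine intervalIntegral.integral_congr fun a _ => ?_
      rw [hslope, ← intervalIntegral.integral_const_mul]
      refine intervalIntegral.integral_congr fun s hs => ?_
      rw [uIcc_of_le zero_le_one] at hs
      simp only [unitClamp_of_mem hs]
      ring
    · have hc : Continuous (Function.uncurry fun s a : ℝ => (s : ℂ) ^ (2 * n + 1) *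
          ((a : ℂ) * (Q (r * a * unitClamp s) +
          ((r * a : ℝ) : ℂ) ^ 2 * radialInner Q g (r * a) (unitClamp s)))) := by
        have h1 := hcont.comp (by fun_prop : Continuous fun p : ℝ × ℝ => ((r, p.1), p.2))
        exact (by fun_prop : Continuous fun p : ℝ × ℝ => (p.1 : ℂ) ^ (2 * n + 1)).mul h1
      refine (hc.continuousOn.integrableOn_compact
        (isCompact_uIcc.prod isCompact_uIcc) (K := uIcc 0 1 ×ˢ uIcc 0 1)).mono_set ?_
      exact prod_mono uIoc_subset_uIcc uIoc_subset_uIcc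
  have hF := @intervalIntegral.smul_integral_comp_mul_left ℂ _ _ 0 1
    (fun x : ℝ => (x : ℂ) * radialSlope Q g n x) r
  simp only [mul_zero, mul_one] at hF
  rw [radialPhi, hmom, ← hF, Complex.real_smul, ← intervalIntegral.integral_const_mul,
    ← intervalIntegral.integral_const_mul]
  congr 1
  refine intervalIntegral.integral_congr fun a _ => ?_
  push_cast
  ring

theorem hasDerivAt_radialPhi (hQ : Continuous Q) (hg : Continuous g)
    (hN : ∀ p, ‖g p‖ ≤ N * Real.exp (l * p.1 ^ 2)) (hfix : radialMap Q g = g) (n : ℕ) (r : ℝ) :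
    HasDerivAt (radialPhi g n) ((r : ℂ) * radialSlope Q g n r) r := by
  have hc : Continuous fun x : ℝ => (x : ℂ) * radialSlope Q g n x :=
    Complex.continuous_ofReal.mul (continuous_radialSlope hQ hg n)
  rw [funext (radialPhi_eq hQ hg hN hfix n)]
  exact (intervalIntegral.integral_hasDerivAt_right (hc.intervalIntegrable _ _)
    (hc.stronglyMeasurableAtFilter _ _) hc.continuousAt).const_add 1

/-- After scaling, r²ⁿ⁺² times the slope is ∫₀^r y²ⁿ⁺¹ Q φ dy; differentiating this gives (r²ⁿ⁺¹φ')'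
= r²ⁿ⁺¹Qφ in expanded form. -/
theorem hasDerivAt_mul_radialSlope (hQ : Continuous Q) (hg : Continuous g) (n : ℕ) {r : ℝ}
    (hr : 0 < r) : HasDerivAt (fun r : ℝ => (r : ℂ) * radialSlope Q g n r)
      (Q r * radialPhi g n r - (2 * n + 1) / r * ((r : ℂ) * radialSlope Q g n r)) r := by
  have hφ := continuous_radialPhi hg n
  have hc : Continuous fun y : ℝ => (y : ℂ) ^ (2 * n + 1) * (Q y * radialPhi g n y) := by fun_prop
  let B : ℝ → ℂ := fun x => ∫ y in (0 : ℝ)..x, (y : ℂ) ^ (2 * n + 1) * (Q y * radialPhi g n y)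
  have hB : HasDerivAt B ((r : ℂ) ^ (2 * n + 1) * (Q r * radialPhi g n r)) r :=
    intervalIntegral.integral_hasDerivAt_right (hc.intervalIntegrable _ _)
      (hc.stronglyMeasurableAtFilter _ _) hc.continuousAt
  have hBs : ∀ x : ℝ, B x = (x : ℂ) ^ (2 * n + 2) * radialSlope Q g n x := by
    intro x
    have h2 := @intervalIntegral.smul_integral_comp_mul_left ℂ _ _ 0 1
      (fun y : ℝ => (y : ℂ) ^ (2 * n + 1) * (Q y * radialPhi g n y)) x
    simp only [mul_zero, mul_one] at h2
    simp only [B]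
    rw [← h2, Complex.real_smul, radialSlope, ← intervalIntegral.integral_const_mul,
      ← intervalIntegral.integral_const_mul]
    refine intervalIntegral.integral_congr fun s _ => ?_
    push_cast
    ring
  have hrc : (r : ℂ) ≠ 0 := by exact_mod_cast hr.ne'
  have hev : (fun r : ℝ => (r : ℂ) * radialSlope Q g n r) =ᶠ[𝓝 r]
      fun x => B x / (x : ℂ) ^ (2 * n + 1) := by
    filter_upwards [lt_mem_nhds hr] with x hx
    have hxc : (x : ℂ) ≠ 0 := by exact_mod_cast hx.ne'
    rw [hBs]
    field_simp
    ring
  have hp : HasDerivAt (fun x : ℝ => (x : ℂ) ^ (2 * n + 1))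
      ((2 * n + 1 : ℂ) * (r : ℂ) ^ (2 * n)) r := by
    have := (hasDerivAt_id r).ofReal_comp.pow (2 * n + 1)
    refine this.congr_deriv ?_
    simp
  refine HasDerivAt.congr_of_eventuallyEq ?_ hev
  refine (hB.div hp (pow_ne_zero _ hrc)).congr_deriv ?_
  rw [hBs]
  field_simp
  ring

end Moments

/-! ### The functions φ^{(n)} with bounds uniform in n. -/

section RadialFamily

/-- The functions `φ^{(n)}` of the potential `q` and their derivatives, with the properties used
below and bounds that are uniform in `n`. -/
structure IsRadialFamily (q : ℝ → ℂ) (ρ C : ℝ) (Φ dΦ : ℕ → ℝ → ℂ) : Prop where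
  continuous : ∀ n, Continuous (Φ n)
  apply_zero : ∀ n, Φ n 0 = 1
  hasDerivAt : ∀ n r, HasDerivAt (Φ n) (dΦ n r) r
  continuous_deriv : ∀ n, Continuous (dΦ n)
  deriv_zero : ∀ n, dΦ n 0 = 0
  hasDerivAt_deriv : ∀ n, ∀ r ∈ Ioo 0 ρ,
    HasDerivAt (dΦ n) (q r * Φ n r - (2 * n + 1) / r * dΦ n r) r
  norm_le : ∀ n, ∀ r ∈ Icc 0 ρ, ‖Φ n r‖ ≤ C
  norm_deriv_le : ∀ n, ∀ r ∈ Icc 0 ρ, ‖dΦ n r‖ ≤ C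
  norm_sub_one_le : ∀ n, ∀ r ∈ Icc 0 ρ, ‖Φ n r - 1‖ ≤ C / (n + 1)
  transmute_eq : ∀ n, ∀ r ∈ Icc 0 ρ, 1 + ∫ s in (0 : ℝ)..1,
    (s : ℂ) * transmutationKernel q ρ r (1 - s ^ 2) * ((s : ℂ) ^ 2) ^ n = Φ n r
  phi_eq : ∀ n, ∀ r ∈ Ioc 0 ρ, phi q ρ n r = Φ n r

/-- The monomial has integral 1/(2n+2). This decay makes φ^{(n)} tend to 1 uniformly, which later
bounds the norms of the formal powers from below. -/
theorem norm_integral_pow_mul_le {h : ℝ → ℂ} {B : ℝ} (hB : ∀ s ∈ Icc (0 : ℝ) 1, ‖h s‖ ≤ B) (n : ℕ) :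
    ‖∫ s in (0 : ℝ)..1, (s : ℂ) ^ (2 * n + 1) * h s‖ ≤ B / (n + 1) := by
  have hB0 : 0 ≤ B := (norm_nonneg _).trans (hB 0 (by simp))
  have h1 := intervalIntegral.norm_integral_le_of_norm_le (μ := volume) (zero_le_one' ℝ)
    (f := fun s : ℝ => (s : ℂ) ^ (2 * n + 1) * h s) (g := fun s => B * s ^ (2 * n + 1))
    (Eventually.of_forall fun s hs => by
      rw [norm_mul, norm_pow, Complex.norm_real, Real.norm_eq_abs, abs_of_pos hs.1, mul_comm]
      exact mul_le_mul_of_nonneg_right (hB s ⟨hs.1.le, hs.2⟩) (pow_nonneg hs.1.le _))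
    (Continuous.intervalIntegrable (by fun_prop) _ _)
  refine h1.trans ?_
  rw [intervalIntegral.integral_const_mul, integral_pow]
  simp only [one_pow, ne_eq, Nat.add_eq_zero_iff, one_ne_zero,
    and_false, not_false_eq_true, zero_pow, sub_zero]
  rw [div_eq_mul_inv B]
  refine mul_le_mul_of_nonneg_left ?_ hB0
  rw [one_div]
  refine inv_anti₀ (by positivity) ?_
  push_cast
  have : (0 : ℝ) ≤ n := n.cast_nonneg
  linarith

/-- A `C¹` potential has a unique transmutation kernel and unique regular Bessel solutions, and the
functions `φ^{(n)}` are the moments of the kernel. -/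
theorem wellDefined_and_exists_radialFamily {ρ : ℝ} (hρ : 0 < ρ) {q : ℝ → ℂ}
    (hq : ContDiffOn ℝ 1 q (Icc 0 ρ)) :
    WellDefined q ρ ∧ ∃ C Φ dΦ, IsRadialFamily q ρ C Φ dΦ := by
  obtain ⟨Q, M, hQ, hQq, hM, hM'⟩ := exists_contDiff_extension hρ hq
  have hQc := hQ.continuous
  obtain ⟨g, hg, ⟨l, N, hN⟩, hfix⟩ := exists_radialMap_fixedPoint hQc hM
  have hker : IsTransmutationKernel q ρ (transmutationKernel q ρ) :=
    Classical.epsilon_spec ⟨_, isTransmutationKernel_radialKernel hQ hQq hM' hg hfix⟩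
  have huniq := fun (G : ℝ → ℝ → ℂ) (hG : IsTransmutationKernel q ρ G) r hr t ht =>
    hG.eq_radialKernel hρ hQc hQq hM' hg hfix (r := r) (t := t) hr ht
  let Φ : ℕ → ℝ → ℂ := radialPhi g
  let dΦ : ℕ → ℝ → ℂ := fun n r => (r : ℂ) * radialSlope Q g n r
  have hΦc : ∀ n, Continuous (Φ n) := continuous_radialPhi hg
  have hΦ0 : ∀ n, Φ n 0 = 1 := fun n => by simp [Φ, radialPhi]
  have hdc : ∀ n, Continuous (dΦ n) := fun n =>
    Complex.continuous_ofReal.mul (continuous_radialSlope hQc hg n)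
  have hΦd : ∀ n r, HasDerivAt (Φ n) (dΦ n r) r := hasDerivAt_radialPhi hQc hg hN hfix
  have hΦdd : ∀ n, ∀ r ∈ Ioo 0 ρ,
      HasDerivAt (dΦ n) (q r * Φ n r - (2 * n + 1) / r * dΦ n r) r := fun n r hr => by
    rw [← hQq r (Ioo_subset_Icc_self hr)]
    exact hasDerivAt_mul_radialSlope hQc hg n hr.1
  have hbes : ∀ n, IsRegularBesselSolution q ρ n
      fun r => ((r ^ ((n : ℝ) + 1 / 2) : ℝ) : ℂ) * Φ n r := fun n => by
    refine isRegularBesselSolution_of_radial hρ (hq.continuousOn.mono Ioo_subset_Icc_self)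
      (hΦc n).continuousOn (hΦ0 n) (fun r _ => hΦd n r) (hΦdd n) ?_
    have h1 : Continuous fun r : ℝ => (r : ℂ) * dΦ n r := Complex.continuous_ofReal.mul (hdc n)
    have h2 := (h1.tendsto 0).mono_left (nhdsWithin_le_nhds (s := Ioi (0 : ℝ)))
    simpa using h2
  have hbes' : ∀ n, IsRegularBesselSolution q ρ n (besselSolution q ρ n) := fun n =>
    Classical.epsilon_spec ⟨_, hbes n⟩
  refine ⟨⟨⟨hker, fun G hG r hr t ht => ?_⟩, fun n => ⟨hbes' n, fun y hy r hr =>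
    hy.unique hρ hq.continuousOn (hbes' n) hr⟩⟩, ?_⟩
  · rw [huniq G hG r hr t ht, huniq _ hker r hr t ht]
  have hM0 : 0 ≤ M := (norm_nonneg _).trans (hM 0)
  obtain ⟨B, hB⟩ := (isCompact_Icc.prod isCompact_Icc :
    IsCompact (Icc 0 ρ ×ˢ Icc (0 : ℝ) 1)).exists_bound_of_continuousOn hg.continuousOn
  have hB0 : 0 ≤ B := (norm_nonneg _).trans (hB (0, 0) ⟨⟨le_rfl, hρ.le⟩, by simp⟩)
  have hsub : ∀ n, ∀ r ∈ Icc 0 ρ, ‖Φ n r - 1‖ ≤ ρ ^ 2 * B / (n + 1) := by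
    intro n r hr
    simp only [Φ, radialPhi, add_sub_cancel_left]
    rw [norm_mul, norm_pow, Complex.norm_real, Real.norm_eq_abs, abs_of_nonneg hr.1, mul_div_assoc]
    refine mul_le_mul (pow_le_pow_left₀ hr.1 hr.2 2) ?_ (norm_nonneg _) (by positivity)
    exact norm_integral_pow_mul_le (fun s hs => hB (r, s) ⟨hr, hs⟩) n
  have hone : ∀ n : ℕ, (1 : ℝ) ≤ n + 1 := fun n => by
    have : (0 : ℝ) ≤ n := n.cast_nonneg
    linarith
  have hle : ∀ n, ∀ r ∈ Icc 0 ρ, ‖Φ n r‖ ≤ 1 + ρ ^ 2 * B := by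
    intro n r hr
    calc ‖Φ n r‖ = ‖1 + (Φ n r - 1)‖ := by congr 1; ring
      _ ≤ ‖(1 : ℂ)‖ + ‖Φ n r - 1‖ := norm_add_le _ _
      _ ≤ 1 + ρ ^ 2 * B := by
        rw [norm_one]
        exact add_le_add_right ((hsub n r hr).trans (div_le_self (by positivity) (hone n))) _
  have hdle : ∀ n, ∀ r ∈ Icc 0 ρ, ‖dΦ n r‖ ≤ ρ * (M * (1 + ρ ^ 2 * B)) := by
    intro n r hr
    simp only [dΦ]
    rw [norm_mul, Complex.norm_real, Real.norm_eq_abs, abs_of_nonneg hr.1]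
    refine mul_le_mul hr.2 ?_ (norm_nonneg _) hρ.le
    refine (norm_integral_pow_mul_le (B := M * (1 + ρ ^ 2 * B)) (fun s hs => ?_) n).trans
      (div_le_self (by positivity) (hone n))
    rw [norm_mul]
    exact mul_le_mul (hM _) (hle n (r * s) ⟨mul_nonneg hr.1 hs.1,
      (mul_le_of_le_one_right hr.1 hs.2).trans hr.2⟩) (norm_nonneg _) hM0
  refine ⟨max (1 + ρ ^ 2 * B) (ρ * (M * (1 + ρ ^ 2 * B))), Φ, dΦ, hΦc, hΦ0, hΦd, hdc,
    fun n => by simp [dΦ], hΦdd, fun n r hr => (hle n r hr).trans (le_max_left _ _),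
    fun n r hr => (hdle n r hr).trans (le_max_right _ _), fun n r hr => (hsub n r hr).trans ?_,
    fun n r hr => ?_, fun n r hr => ?_⟩
  · refine div_le_div_of_nonneg_right (le_trans ?_ (le_max_left _ _)) (by linarith [hone n])
    linarith
  · simp only [Φ, radialPhi, radialMoment]
    rw [← intervalIntegral.integral_const_mul]
    congr 1
    refine intervalIntegral.integral_congr fun s hs => ?_
    rw [uIcc_of_le zero_le_one] at hs
    have hs2 : 1 - s ^ 2 ∈ Icc (0 : ℝ) 1 := ⟨by nlinarith [hs.1, hs.2], by nlinarith [hs.1]⟩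
    rw [huniq _ hker r hr _ hs2, radialKernel, sub_sub_cancel, Real.sqrt_sq hs.1]
    ring
  · have hr' : r ∈ Icc 0 ρ := Ioc_subset_Icc_self hr
    rw [phi, ← (hbes n).unique hρ hq.continuousOn (hbes' n) hr', mul_div_cancel_left₀]
    exact Complex.ofReal_ne_zero.2 (Real.rpow_pos_of_pos hr.1 _).ne'

end RadialFamily

/-! ### Bicomplex algebra and the real form of the Vekua equation. -/

namespace Bicomplex

theorem sc_ofParts (u v : ℂ) : (ofParts u v).sc = u := rfl
theorem vec_ofParts (u v : ℂ) : (ofParts u v).vec = v := rfl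

/-- The scalar part as a continuous linear map. -/
noncomputable def scL : Bicomplex →L[ℝ] ℂ := WithLp.fstL 2 ℝ ℂ ℂ

/-- The vectorial part as a continuous linear map. -/
noncomputable def vecL : Bicomplex →L[ℝ] ℂ := WithLp.sndL 2 ℝ ℂ ℂ

/-- `(u, v) ↦ u + 𝐣 v` as a continuous linear map. -/
noncomputable def ofPartsL : ℂ × ℂ →L[ℝ] Bicomplex :=
  (WithLp.prodContinuousLinearEquiv 2 ℝ ℂ ℂ).symm.toContinuousLinearMap

theorem norm_sq_eq (W : Bicomplex) : ‖W‖ ^ 2 = ‖W.sc‖ ^ 2 + ‖W.vec‖ ^ 2 :=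
  WithLp.prod_norm_sq_eq_of_L2 W

theorem norm_le_add (W : Bicomplex) : ‖W‖ ≤ ‖W.sc‖ + ‖W.vec‖ := by
  refine (sq_le_sq₀ (norm_nonneg _) (by positivity)).1 ?_
  rw [norm_sq_eq]; nlinarith [norm_nonneg W.sc, norm_nonneg W.vec]

theorem pairing_eq (W V : Bicomplex) : pairing W V =
    W.sc * starRingEnd ℂ V.sc + W.vec * starRingEnd ℂ V.vec := by
  rw [pairing, sc_mul]
  simp only [dagger, sc_ofParts, vec_ofParts]
  ring

/-- Because 𝐣² = -1, z ↦ ẑ copies complex multiplication. This lets Λẑⁿ be handled as the ordinary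
polynomial c zⁿ. -/
theorem hat_mul (a b : ℂ) : hat (a * b) = hat a * hat b := by
  apply ext'
  · simp [hat, sc_mul, sc_ofParts, vec_ofParts]
  · simp [hat, vec_mul, sc_ofParts, vec_ofParts]

theorem hat_one : hat 1 = 1 := by
  apply ext' <;> simp [hat, sc_ofParts, vec_ofParts, sc_one, vec_one]

theorem hat_I : hat Complex.I = j := by
  apply ext' <;> simp [hat, j, sc_ofParts, vec_ofParts]

theorem hat_pow (a : ℂ) (n : ℕ) : hat (a ^ n) = hat a ^ n := by
  induction n with
  | zero => rw [pow_zero, pow_zero, hat_one]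
  | succ n ih => rw [pow_succ, pow_succ, hat_mul, ih]

theorem one_ne_j : (1 : Bicomplex) ≠ j := by
  intro h
  have := congrArg sc h
  simp [sc_one, j, sc_ofParts] at this

section dbar

variable {W : ℂ → Bicomplex} {z : ℂ}

theorem fderiv_sc (hW : DifferentiableAt ℝ W z) (v : ℂ) :
    fderiv ℝ (fun w => (W w).sc) z v = (fderiv ℝ W z v).sc := by
  have := (scL.hasFDerivAt.comp z hW.hasFDerivAt).fderiv
  change fderiv ℝ (scL ∘ W) z v = _
  rw [this]
  rfl

theorem fderiv_vec (hW : DifferentiableAt ℝ W z) (v : ℂ) :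
    fderiv ℝ (fun w => (W w).vec) z v = (fderiv ℝ W z v).vec := by
  have := (vecL.hasFDerivAt.comp z hW.hasFDerivAt).fderiv
  change fderiv ℝ (vecL ∘ W) z v = _
  rw [this]
  rfl

theorem sc_dbar : (dbar W z).sc =
    1 / 2 * ((fderiv ℝ W z 1).sc - (fderiv ℝ W z Complex.I).vec) := by
  unfold dbar
  rw [sc_smul, sc_add, sc_mul]
  simp only [j, sc_ofParts, vec_ofParts]
  ring

theorem vec_dbar : (dbar W z).vec =
    1 / 2 * ((fderiv ℝ W z 1).vec + (fderiv ℝ W z Complex.I).sc) := by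
  unfold dbar
  rw [vec_smul, vec_add, vec_mul]
  simp only [j, sc_ofParts, vec_ofParts]
  ring

/-- The Vekua equation in real form. -/
theorem vekua_iff {F : ℂ → ℂ} {c : ℂ} (hF : DifferentiableAt ℝ F z)
    (hW : DifferentiableAt ℝ W z) :
    dbar W z = c • (dbar (fun w => ofParts (F w) 0) z * bar (W z)) ↔
      (fderiv ℝ (fun w => (W w).sc) z 1 - fderiv ℝ (fun w => (W w).vec) z Complex.I =
        c * (fderiv ℝ F z 1 * (W z).sc + fderiv ℝ F z Complex.I * (W z).vec)) ∧
      (fderiv ℝ (fun w => (W w).vec) z 1 + fderiv ℝ (fun w => (W w).sc) z Complex.I =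
        c * (fderiv ℝ F z Complex.I * (W z).sc - fderiv ℝ F z 1 * (W z).vec)) := by
  have hFd : HasFDerivAt (fun w => ofParts (F w) 0)
      (ofPartsL.comp ((fderiv ℝ F z).prod 0)) z :=
    ofPartsL.hasFDerivAt.comp z (hF.hasFDerivAt.prodMk (hasFDerivAt_const (0 : ℂ) z))
  have hs : ∀ v, (fderiv ℝ (fun w => ofParts (F w) 0) z v).sc = fderiv ℝ F z v := fun v => by
    rw [hFd.fderiv]; rfl
  have hv : ∀ v, (fderiv ℝ (fun w => ofParts (F w) 0) z v).vec = 0 := fun v => by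
    rw [hFd.fderiv]; rfl
  have e1 : (dbar (fun w => ofParts (F w) 0) z).sc = 1 / 2 * fderiv ℝ F z 1 := by
    rw [sc_dbar, hs, hv, sub_zero]
  have e2 : (dbar (fun w => ofParts (F w) 0) z).vec = 1 / 2 * fderiv ℝ F z Complex.I := by
    rw [vec_dbar, hs, hv, zero_add]
  rw [fderiv_sc hW, fderiv_sc hW, fderiv_vec hW, fderiv_vec hW]
  constructor
  · intro h
    have h1 := congrArg sc h
    have h2 := congrArg vec h
    rw [sc_dbar, sc_smul, sc_mul, e1, e2] at h1
    rw [vec_dbar, vec_smul, vec_mul, e1, e2] at h2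
    simp only [bar, sc_ofParts, vec_ofParts] at h1 h2
    constructor
    · linear_combination 2 * h1
    · linear_combination 2 * h2
  · rintro ⟨h1, h2⟩
    apply ext'
    · rw [sc_dbar, sc_smul, sc_mul, e1, e2]
      simp only [bar, sc_ofParts, vec_ofParts]
      linear_combination h1 / 2
    · rw [vec_dbar, vec_smul, vec_mul, e1, e2]
      simp only [bar, sc_ofParts, vec_ofParts]
      linear_combination h2 / 2

end dbar

end Bicomplex

/-! ### Differentiating radial functions. -/

section RadialCalculus

/-- The derivative of `z ↦ φ(|z|)` when `d` is the derivative of `φ`. -/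
noncomputable def radialFDeriv (d : ℝ → ℂ) (z : ℂ) : ℂ →L[ℝ] ℂ :=
  (innerSL ℝ z).smulRight (d ‖z‖ / (‖z‖ : ℂ))

theorem radialFDeriv_apply (d : ℝ → ℂ) (z v : ℂ) :
    radialFDeriv d z v = ((z.re * v.re + z.im * v.im : ℝ) : ℂ) * (d ‖z‖ / ‖z‖) := by
  rw [radialFDeriv, ContinuousLinearMap.smulRight_apply, innerSL_apply_apply, Complex.real_smul]
  congr 2
  rw [Complex.inner]
  simp
  ring

theorem norm_radialFDeriv_le (d : ℝ → ℂ) (z : ℂ) : ‖radialFDeriv d z‖ ≤ ‖d ‖z‖‖ := by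
  rw [radialFDeriv, ContinuousLinearMap.norm_smulRight_apply, innerSL_apply_norm, norm_div,
    Complex.norm_real, norm_norm]
  by_cases h : ‖z‖ = 0
  · simp [h]
  · rw [mul_div_cancel₀ _ h]

theorem hasFDerivAt_norm_complex {z : ℂ} (hz : z ≠ 0) :
    HasFDerivAt (fun w : ℂ => ‖w‖) ((‖z‖⁻¹ : ℝ) • innerSL ℝ z) z := by
  have h1 := (hasStrictFDerivAt_norm_sq z).hasFDerivAt.sqrt (by simpa using hz)
  have e : (fun w : ℂ => ‖w‖) = fun w => Real.sqrt (‖w‖ ^ 2) := by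
    funext w; rw [Real.sqrt_sq (norm_nonneg _)]
  rw [e]
  refine h1.congr_fderiv ?_
  rw [Real.sqrt_sq (norm_nonneg _)]
  ext v
  simp
  ring

/-- Away from 0 this is the chain rule; at 0 the norm is not differentiable, but d(0) = 0 makes
φ(|w|) - φ(0) of order o(|w|). One-sided derivatives at 0 are assumed because f is given only on [0,
ρ]. -/
theorem hasFDerivAt_radial {φ d : ℝ → ℂ} {ρ : ℝ}
    (hd : ∀ r ∈ Ico 0 ρ, HasDerivWithinAt φ (d r) (Ici 0) r) (h0 : d 0 = 0) {z : ℂ}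
    (hz : z ∈ Metric.ball (0 : ℂ) ρ) :
    HasFDerivAt (fun w : ℂ => φ ‖w‖) (radialFDeriv d z) z := by
  rw [mem_ball_zero_iff] at hz
  by_cases hz0 : z = 0
  · subst hz0
    have h1 := hd 0 ⟨le_rfl, by simpa using hz⟩
    rw [h0] at h1
    have e : radialFDeriv d 0 = 0 := by
      have := norm_radialFDeriv_le d 0
      rw [norm_zero, h0, norm_zero] at this
      exact norm_le_zero_iff.1 this
    rw [e]
    rw [hasDerivWithinAt_iff_isLittleO] at h1
    rw [hasFDerivAt_iff_isLittleO]
    have ht : Tendsto (fun w : ℂ => ‖w‖) (𝓝 0) (𝓝[Ici 0] 0) := by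
      refine tendsto_nhdsWithin_iff.2 ⟨?_, Eventually.of_forall fun w => norm_nonneg w⟩
      simpa using (continuous_norm (E := ℂ)).tendsto 0
    have h2 := h1.comp_tendsto ht
    simp only [Function.comp_def, smul_zero, sub_zero] at h2
    simpa using h2.of_norm_right
  · have hpos : 0 < ‖z‖ := norm_pos_iff.2 hz0
    have h1 := (hd ‖z‖ ⟨hpos.le, hz⟩).hasDerivAt (Ici_mem_nhds hpos)
    refine (h1.hasFDerivAt.comp z (hasFDerivAt_norm_complex hz0)).congr_fderiv ?_
    ext v
    simp [radialFDeriv]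
    ring

theorem continuousOn_radialFDeriv {d : ℝ → ℂ} {ρ : ℝ} (hd : ContinuousOn d (Ico 0 ρ))
    (h0 : d 0 = 0) : ContinuousOn (radialFDeriv d) (Metric.ball (0 : ℂ) ρ) := by
  have hn : ContinuousOn (fun z : ℂ => d ‖z‖) (Metric.ball (0 : ℂ) ρ) :=
    hd.comp continuous_norm.continuousOn fun z hz => ⟨norm_nonneg z, mem_ball_zero_iff.1 hz⟩
  intro z hz
  by_cases hz0 : z = 0
  · subst hz0
    have e : radialFDeriv d 0 = 0 := by
      have := norm_radialFDeriv_le d 0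
      rw [norm_zero, h0, norm_zero] at this
      exact norm_le_zero_iff.1 this
    rw [ContinuousWithinAt, e]
    have := (hn 0 hz).norm
    rw [ContinuousWithinAt, norm_zero, h0, norm_zero] at this
    exact squeeze_zero_norm (fun w => norm_radialFDeriv_le d w) this
  · have h1 : ContinuousWithinAt (fun z : ℂ => d ‖z‖ / (‖z‖ : ℂ)) (Metric.ball 0 ρ) z :=
      (hn z hz).div (by fun_prop) (by simpa using hz0)
    have h2 : Continuous fun p : ℂ × ℂ => (innerSL ℝ p.1).smulRight p.2 := by
      fun_prop
    exact h2.continuousAt.comp_continuousWithinAt (f := fun z : ℂ => (z, d ‖z‖ / (‖z‖ : ℂ)))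
      (continuousWithinAt_id.prodMk h1)

theorem contDiffOn_one_of_hasFDerivAt {E F : Type*} [NormedAddCommGroup E] [NormedSpace ℝ E]
    [NormedAddCommGroup F] [NormedSpace ℝ F] {f : E → F} {f' : E → E →L[ℝ] F} {s : Set E}
    (hs : IsOpen s) (hf : ∀ x ∈ s, HasFDerivAt f (f' x) x) (hc : ContinuousOn f' s) :
    ContDiffOn ℝ 1 f s := by
  have := (contDiffOn_succ_iff_fderiv_of_isOpen (n := 0) (𝕜 := ℝ) (f := f) hs).2
    ⟨fun x hx => (hf x hx).differentiableAt.differentiableWithinAt, by simp,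
      contDiffOn_zero.2 (hc.congr fun x hx => (hf x hx).fderiv)⟩
  simpa using this

end RadialCalculus

/-! ### The Darboux transformation between the potentials of f and 1/f. -/

section Darboux

/-- Multiplying by rⁿ⁺¹ᐟ² turns both functions into regular Bessel solutions, which are unique. This
is how explicit expressions are recognised as members of the family. -/
theorem IsRadialFamily.eq_of_radial {q : ℝ → ℂ} {ρ C : ℝ} {Φ dΦ : ℕ → ℝ → ℂ}
    (hΦ : IsRadialFamily q ρ C Φ dΦ) (hρ : 0 < ρ) (hq : ContinuousOn q (Icc 0 ρ))
    {n : ℕ} {φ dφ : ℝ → ℂ} (hc : ContinuousOn φ (Icc 0 ρ)) (h0 : φ 0 = 1)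
    (hd : ∀ r ∈ Ioo 0 ρ, HasDerivAt φ (dφ r) r)
    (hdd : ∀ r ∈ Ioo 0 ρ, HasDerivAt dφ (q r * φ r - (2 * n + 1) / r * dφ r) r)
    (hdc : ContinuousOn dφ (Icc 0 ρ)) {r : ℝ} (hr : r ∈ Icc 0 ρ) : φ r = Φ n r := by
  have hlim : ∀ d : ℝ → ℂ, ContinuousOn d (Icc 0 ρ) →
      Tendsto (fun r : ℝ => (r : ℂ) * d r) (𝓝[>] 0) (𝓝 0) := by
    intro d hd
    have h1 : ContinuousOn (fun r : ℝ => (r : ℂ) * d r) (Icc 0 ρ) :=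
      Complex.continuous_ofReal.continuousOn.mul hd
    have h2 := (h1 0 ⟨le_rfl, hρ.le⟩).tendsto.mono_left (nhdsWithin_mono 0 Ioo_subset_Icc_self)
    rw [nhdsWithin_Ioo_eq_nhdsGT hρ] at h2
    simpa using h2
  have hqo := hq.mono Ioo_subset_Icc_self
  have b1 := isRegularBesselSolution_of_radial hρ hqo hc h0 hd hdd (hlim _ hdc)
  have b2 := isRegularBesselSolution_of_radial hρ hqo (hΦ.continuous n).continuousOn
    (hΦ.apply_zero n) (fun r _ => hΦ.hasDerivAt n r) (hΦ.hasDerivAt_deriv n)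
    (hlim _ (hΦ.continuous_deriv n).continuousOn)
  rcases hr.1.eq_or_lt with h | h
  · rw [← h, h0, hΦ.apply_zero]
  · have := b1.unique hρ hq b2 hr
    exact mul_left_cancel₀ (Complex.ofReal_ne_zero.2 (Real.rpow_pos_of_pos h _).ne') this

/-- The standing assumptions on the radial coefficient `f` and its potential `q`. -/
structure IsRadialCoefficient (ρ : ℝ) (q f : ℝ → ℂ) : Prop where
  pos : 0 < ρ
  contDiffOn_potential : ContDiffOn ℝ 1 q (Icc 0 ρ)
  contDiffOn : ContDiffOn ℝ 2 f (Icc 0 ρ)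
  eqn : ∀ r ∈ Ioo 0 ρ, deriv (deriv f) r + 1 / (r : ℂ) * deriv f r - q r * f r = 0
  ne_zero : ∀ r ∈ Icc 0 ρ, f r ≠ 0
  apply_zero : f 0 = 1

namespace IsRadialCoefficient

variable {ρ : ℝ} {q f : ℝ → ℂ} (h : IsRadialCoefficient ρ q f)

include h

theorem contDiffOn_derivWithin : ContDiffOn ℝ 1 (derivWithin f (Icc 0 ρ)) (Icc 0 ρ) :=
  h.contDiffOn.derivWithin (uniqueDiffOn_Icc h.pos) (by norm_num)

theorem continuousOn_deriv : ContinuousOn (derivWithin f (Icc 0 ρ)) (Icc 0 ρ) :=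
  h.contDiffOn_derivWithin.continuousOn

theorem hasDerivWithinAt {r : ℝ} (hr : r ∈ Icc 0 ρ) :
    HasDerivWithinAt f (derivWithin f (Icc 0 ρ) r) (Icc 0 ρ) r :=
  (h.contDiffOn.differentiableOn two_ne_zero r hr).hasDerivWithinAt

theorem hasDerivAt {r : ℝ} (hr : r ∈ Ioo 0 ρ) :
    HasDerivAt f (derivWithin f (Icc 0 ρ) r) r :=
  (h.hasDerivWithinAt (Ioo_subset_Icc_self hr)).hasDerivAt (Icc_mem_nhds hr.1 hr.2)

theorem hasDerivAt_deriv {r : ℝ} (hr : r ∈ Ioo 0 ρ) :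
    HasDerivAt (derivWithin f (Icc 0 ρ))
      (q r * f r - 1 / r * derivWithin f (Icc 0 ρ) r) r := by
  have h1 : DifferentiableAt ℝ (derivWithin f (Icc 0 ρ)) r :=
    (h.contDiffOn_derivWithin.contDiffAt (Icc_mem_nhds hr.1 hr.2)).differentiableAt one_ne_zero
  have hev : deriv f =ᶠ[𝓝 r] derivWithin f (Icc 0 ρ) := by
    filter_upwards [isOpen_Ioo.mem_nhds hr] with s hs using (h.hasDerivAt hs).deriv
  have h2 := h.eqn r hr
  rw [hev.deriv_eq, hev.eq_of_nhds] at h2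
  exact h1.hasDerivAt.congr_deriv (by linear_combination h2)

/-- The equation reads f' = r(q f - f''), and the bracket is continuous up to r = 0, so f' tends to
0. This is what makes z ↦ f(|z|) differentiable at the origin. -/
theorem deriv_zero : derivWithin f (Icc 0 ρ) 0 = 0 := by
  set d := derivWithin f (Icc 0 ρ) with hd
  have hmono := nhdsWithin_mono (0 : ℝ) (Ioo_subset_Icc_self (a := (0 : ℝ)) (b := ρ))
  have hz : (0 : ℝ) ∈ Icc 0 ρ := ⟨le_rfl, h.pos.le⟩
  have c1 := (h.continuousOn_deriv 0 hz).tendsto.mono_left hmono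
  have hcont : ContinuousOn (fun r : ℝ => (r : ℂ) * (q r * f r - derivWithin d (Icc 0 ρ) r))
      (Icc 0 ρ) :=
    Complex.continuous_ofReal.continuousOn.mul ((h.contDiffOn_potential.continuousOn.mul
      h.contDiffOn.continuousOn).sub (h.contDiffOn_derivWithin.continuousOn_derivWithin
        (uniqueDiffOn_Icc h.pos) le_rfl))
  have c2 := (hcont 0 hz).tendsto.mono_left hmono
  have : (𝓝[Ioo 0 ρ] (0 : ℝ)).NeBot := by
    rw [nhdsWithin_Ioo_eq_nhdsGT h.pos]; infer_instance
  have c3 : Tendsto d (𝓝[Ioo 0 ρ] 0) (𝓝 _) := c2.congr' (by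
    filter_upwards [self_mem_nhdsWithin] with r hr
    have h1 := (h.hasDerivAt_deriv hr).hasDerivWithinAt.derivWithin
      ((uniqueDiffOn_Icc h.pos) r (Ioo_subset_Icc_self hr))
    rw [h1]
    have hrc : (r : ℂ) ≠ 0 := by exact_mod_cast hr.1.ne'
    field_simp
    ring)
  exact (tendsto_nhds_unique c1 c3).trans (by simp)

theorem contDiffOn_darbouxPotential : ContDiffOn ℝ 1 (darbouxPotential f q ρ) (Icc 0 ρ) := by
  have hinv : ContDiffOn ℝ 1 (fun r => (f r)⁻¹) (Icc 0 ρ) :=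
    (h.contDiffOn.of_le (by norm_num)).inv h.ne_zero
  unfold darbouxPotential
  simp only [div_eq_mul_inv]
  exact (contDiffOn_const.mul ((h.contDiffOn_derivWithin.mul hinv).pow 2)).sub
    h.contDiffOn_potential

theorem hasDerivWithinAt_Ici {r : ℝ} (hr : r ∈ Ico 0 ρ) :
    HasDerivWithinAt f (derivWithin f (Icc 0 ρ) r) (Ici 0) r := by
  refine (h.hasDerivWithinAt (Ico_subset_Icc_self hr)).mono_of_mem_nhdsWithin ?_
  rw [← Ici_inter_Iic]
  exact inter_mem self_mem_nhdsWithin (mem_nhdsWithin_of_mem_nhds (Iic_mem_nhds hr.2))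

variable {C C' : ℝ} {Φ dΦ Ψ dΨ : ℕ → ℝ → ℂ} (hΦ : IsRadialFamily q ρ C Φ dΦ)
  (hΨ : IsRadialFamily (darbouxPotential f q ρ) ρ C' Ψ dΨ)

include hΦ in
theorem family_zero {r : ℝ} (hr : r ∈ Icc 0 ρ) : Φ 0 r = f r :=
  (hΦ.eq_of_radial h.pos h.contDiffOn_potential.continuousOn (n := 0) (φ := f)
    h.contDiffOn.continuousOn h.apply_zero (fun _ hr => h.hasDerivAt hr)
    (fun r hr => (h.hasDerivAt_deriv hr).congr_deriv (by simp))
    h.continuousOn_deriv hr).symm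

include hΨ in
-- The Darboux potential is exactly the one for which 1/f solves the radial equation of degree zero.
theorem darboux_family_zero {r : ℝ} (hr : r ∈ Icc 0 ρ) : Ψ 0 r = (f r)⁻¹ := by
  refine (hΨ.eq_of_radial h.pos h.contDiffOn_darbouxPotential.continuousOn (n := 0)
    (φ := fun r => (f r)⁻¹) (dφ := fun r => -derivWithin f (Icc 0 ρ) r / f r ^ 2)
    (h.contDiffOn.continuousOn.inv₀ h.ne_zero) (by simp [h.apply_zero])
    (fun r hr => (h.hasDerivAt hr).inv (h.ne_zero r (Ioo_subset_Icc_self hr)))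
    (fun r hr => ?_) ?_ hr).symm
  · have hfr := h.ne_zero r (Ioo_subset_Icc_self hr)
    have hrc : (r : ℂ) ≠ 0 := by exact_mod_cast hr.1.ne'
    refine ((h.hasDerivAt_deriv hr).neg.div ((h.hasDerivAt hr).pow 2)
      (pow_ne_zero 2 hfr)).congr_deriv ?_
    simp only [darbouxPotential, Pi.neg_apply, Pi.pow_apply]
    push_cast
    field_simp
    ring
  · exact h.continuousOn_deriv.neg.div (h.contDiffOn.continuousOn.pow 2)
      fun r hr => pow_ne_zero 2 (h.ne_zero r hr)

include hΦ hΨ in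
/-- The first order system relating the families of `f` and `1/f`. -/
theorem system {n : ℕ} {r : ℝ} (hr : r ∈ Ioo 0 ρ) :
    (r : ℂ) * (dΦ n r - derivWithin f (Icc 0 ρ) r / f r * Φ n r) = n * (Ψ n r - Φ n r) ∧
    (r : ℂ) * (dΨ n r + derivWithin f (Icc 0 ρ) r / f r * Ψ n r) = n * (Φ n r - Ψ n r) := by
  set d := derivWithin f (Icc 0 ρ) with hd
  have hfr := h.ne_zero r (Ioo_subset_Icc_self hr)
  rcases Nat.eq_zero_or_pos n with rfl | hn
  · have e1 : dΦ 0 r = d r := by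
      refine (hΦ.hasDerivAt 0 r).unique ((h.hasDerivAt hr).congr_of_eventuallyEq ?_)
      filter_upwards [isOpen_Ioo.mem_nhds hr] with s hs using
        h.family_zero hΦ (Ioo_subset_Icc_self hs)
    have e2 : dΨ 0 r = -d r / f r ^ 2 := by
      refine (hΨ.hasDerivAt 0 r).unique
        (((h.hasDerivAt hr).inv hfr).congr_of_eventuallyEq ?_)
      filter_upwards [isOpen_Ioo.mem_nhds hr] with s hs using
        h.darboux_family_zero hΨ (Ioo_subset_Icc_self hs)
    rw [e1, e2, h.family_zero hΦ (Ioo_subset_Icc_self hr),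
      h.darboux_family_zero hΨ (Ioo_subset_Icc_self hr)]
    constructor
    · field_simp; simp
    · field_simp; simp
  have hnc : (n : ℂ) ≠ 0 := by exact_mod_cast hn.ne'
  let H : ℝ → ℂ := fun r => d r / f r
  have hHc : ContinuousOn H (Icc 0 ρ) := h.continuousOn_deriv.div h.contDiffOn.continuousOn h.ne_zero
  -- The Riccati equation of the logarithmic derivative H = f'/f.
  have hHd : ∀ r ∈ Ioo 0 ρ, HasDerivAt H (q r - H r / r - H r ^ 2) r := by
    intro r hr
    have hfr := h.ne_zero r (Ioo_subset_Icc_self hr)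
    have hrc : (r : ℂ) ≠ 0 := by exact_mod_cast hr.1.ne'
    refine ((h.hasDerivAt_deriv hr).div (h.hasDerivAt hr) hfr).congr_deriv ?_
    simp only [H, ← hd]
    field_simp
  -- For n ≥ 1 the first equation of the system is solved for its unknown. The Riccati equation
  -- yields ψ' (this is the second equation), then the radial equation with the Darboux potential;
  -- since ψ(0) = 1, uniqueness gives ψ = Ψ n.
  let ψ : ℝ → ℂ := fun r => Φ n r + (r : ℂ) / n * (dΦ n r - H r * Φ n r)
  let dψ : ℝ → ℂ := fun r => -dΦ n r + H r * (Φ n r - ψ r)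
  have hψc : ContinuousOn ψ (Icc 0 ρ) := by
    have c1 := (hΦ.continuous n).continuousOn (s := Icc 0 ρ)
    have c2 := (hΦ.continuous_deriv n).continuousOn (s := Icc 0 ρ)
    exact c1.add ((by fun_prop : Continuous fun r : ℝ => (r : ℂ) / n).continuousOn.mul
      (c2.sub (hHc.mul c1)))
  have hψd : ∀ r ∈ Ioo 0 ρ, HasDerivAt ψ (dψ r) r := by
    intro r hr
    have hrc : (r : ℂ) ≠ 0 := by exact_mod_cast hr.1.ne'
    have a1 := hΦ.hasDerivAt n r
    have a2 := hΦ.hasDerivAt_deriv n r hr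
    have a3 : HasDerivAt (fun r : ℝ => (r : ℂ) / n) (1 / n) r := by
      simpa using (hasDerivAt_id r).ofReal_comp.div_const (n : ℂ)
    refine (a1.add (a3.mul (a2.sub ((hHd r hr).mul a1)))).congr_deriv ?_
    simp only [dψ, ψ, Pi.sub_apply, Pi.mul_apply]
    field_simp
    ring
  have hψdd : ∀ r ∈ Ioo 0 ρ, HasDerivAt dψ
      (darbouxPotential f q ρ r * ψ r - (2 * n + 1) / r * dψ r) r := by
    intro r hr
    have hrc : (r : ℂ) ≠ 0 := by exact_mod_cast hr.1.ne'
    have a1 := hΦ.hasDerivAt n r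
    have a2 := hΦ.hasDerivAt_deriv n r hr
    refine (a2.neg.add ((hHd r hr).mul (a1.sub (hψd r hr)))).congr_deriv ?_
    have e : darbouxPotential f q ρ r = 2 * H r ^ 2 - q r := rfl
    rw [e]
    simp only [dψ, ψ, Pi.sub_apply]
    field_simp
    ring
  have hdψc : ContinuousOn dψ (Icc 0 ρ) :=
    (hΦ.continuous_deriv n).continuousOn.neg.add
      (hHc.mul ((hΦ.continuous n).continuousOn.sub hψc))
  have hψ : ∀ r ∈ Icc 0 ρ, ψ r = Ψ n r := fun r hr =>
    hΨ.eq_of_radial h.pos h.contDiffOn_darbouxPotential.continuousOn hψc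
      (by simp [ψ, hΦ.apply_zero]) hψd hψdd hdψc hr
  have hdψ : dΨ n r = dψ r := by
    refine (hΨ.hasDerivAt n r).unique ((hψd r hr).congr_of_eventuallyEq ?_)
    filter_upwards [isOpen_Ioo.mem_nhds hr] with s hs using (hψ s (Ioo_subset_Icc_self hs)).symm
  rw [hdψ, ← hψ r (Ioo_subset_Icc_self hr)]
  change (r : ℂ) * (dΦ n r - H r * Φ n r) = _ ∧ (r : ℂ) * (dψ r + H r * ψ r) = _
  simp only [dψ, ψ]
  constructor
  · field_simp; ring
  · field_simp; ring

end IsRadialCoefficient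

end Darboux

/-! ### The functions φ(|z|) Re(c zⁿ) + 𝐣 ψ(|z|) Im(c zⁿ) as Vekua solutions. -/

section RadialPowers

open Bicomplex

/-- The real part, as a real linear map into `ℂ`. -/
noncomputable def reL : ℂ →L[ℝ] ℂ := Complex.ofRealCLM.comp Complex.reCLM

/-- The imaginary part, as a real linear map into `ℂ`. -/
noncomputable def imL : ℂ →L[ℝ] ℂ := Complex.ofRealCLM.comp Complex.imCLM

theorem reL_apply (z : ℂ) : reL z = (z.re : ℂ) := rfl
theorem imL_apply (z : ℂ) : imL z = (z.im : ℂ) := rfl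

theorem norm_reL_apply_le (z : ℂ) : ‖reL z‖ ≤ ‖z‖ := by
  rw [reL_apply, Complex.norm_real]; exact Complex.abs_re_le_norm z

theorem norm_imL_apply_le (z : ℂ) : ‖imL z‖ ≤ ‖z‖ := by
  rw [imL_apply, Complex.norm_real]; exact Complex.abs_im_le_norm z

variable {φ d : ℝ → ℂ} {ρ : ℝ} (T : ℂ →L[ℝ] ℂ)

/-- The derivative of `z ↦ φ(|z|) T(c zⁿ)`. -/
noncomputable def radialTermFDeriv (φ d : ℝ → ℂ) (n : ℕ) (c z : ℂ) : ℂ →L[ℝ] ℂ :=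
  φ ‖z‖ • T.comp (ContinuousLinearMap.mul ℝ ℂ (c * (n * z ^ (n - 1)))) +
    T (c * z ^ n) • radialFDeriv d z

theorem hasFDerivAt_const_mul_pow (n : ℕ) (c z : ℂ) :
    HasFDerivAt (fun w : ℂ => c * w ^ n) (ContinuousLinearMap.mul ℝ ℂ (c * (n * z ^ (n - 1)))) z := by
  have h1 := ((hasDerivAt_pow n z).const_mul c).hasFDerivAt.restrictScalars ℝ
  refine h1.congr_fderiv ?_
  ext; simp [mul_comm]

theorem hasFDerivAt_radialTerm (hd : ∀ r ∈ Ico 0 ρ, HasDerivWithinAt φ (d r) (Ici 0) r)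
    (h0 : d 0 = 0) (n : ℕ) (c : ℂ) {z : ℂ} (hz : z ∈ Metric.ball (0 : ℂ) ρ) :
    HasFDerivAt (fun w : ℂ => φ ‖w‖ * T (c * w ^ n)) (radialTermFDeriv T φ d n c z) z :=
  (hasFDerivAt_radial hd h0 hz).mul (T.hasFDerivAt.comp z (hasFDerivAt_const_mul_pow n c z))

theorem continuousOn_radialTermFDeriv (hφ : ContinuousOn φ (Ico 0 ρ))
    (hdc : ContinuousOn d (Ico 0 ρ)) (h0 : d 0 = 0) (n : ℕ) (c : ℂ) :
    ContinuousOn (radialTermFDeriv T φ d n c) (Metric.ball (0 : ℂ) ρ) := by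
  have hn : ContinuousOn (fun z : ℂ => φ ‖z‖) (Metric.ball (0 : ℂ) ρ) :=
    hφ.comp continuous_norm.continuousOn fun z hz => ⟨norm_nonneg z, mem_ball_zero_iff.1 hz⟩
  have h1 : Continuous fun z : ℂ =>
      T.comp (ContinuousLinearMap.mul ℝ ℂ (c * (n * z ^ (n - 1)))) := by fun_prop
  have h2 : Continuous fun z : ℂ => T (c * z ^ n) := by fun_prop
  exact (hn.smul h1.continuousOn).add (h2.continuousOn.smul (continuousOn_radialFDeriv hdc h0))

theorem radialTermFDeriv_apply (n : ℕ) (c z v : ℂ) : radialTermFDeriv T φ d n c z v =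
    φ ‖z‖ * T (c * (n * z ^ (n - 1)) * v) +
      T (c * z ^ n) * (((z.re * v.re + z.im * v.im : ℝ) : ℂ) * (d ‖z‖ / ‖z‖)) := by
  rw [radialTermFDeriv, add_apply, smul_apply, smul_apply, radialFDeriv_apply]
  rfl

/-- `φ(|z|) Re(c zⁿ) + 𝐣 ψ(|z|) Im(c zⁿ)`. -/
noncomputable def radialPower (φ ψ : ℝ → ℂ) (n : ℕ) (c z : ℂ) : Bicomplex :=
  ofParts (φ ‖z‖ * reL (c * z ^ n)) (ψ ‖z‖ * imL (c * z ^ n))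

/-- Euler's identity for homogeneous functions; for n = 0 the exponent n - 1 truncates to 0 but the
factor n is zero. -/
theorem mul_pow_pred_identity (n : ℕ) (c z : ℂ) : z * (c * (n * z ^ (n - 1))) = n * (c * z ^ n) := by
  rcases n with _ | k
  · simp
  · simp only [Nat.add_sub_cancel]; ring

theorem IsRadialFamily.hasDerivWithinAt {q : ℝ → ℂ} {C : ℝ} {Φ dΦ : ℕ → ℝ → ℂ}
    (hΦ : IsRadialFamily q ρ C Φ dΦ) (n : ℕ) :
    ∀ r ∈ Ico 0 ρ, HasDerivWithinAt (Φ n) (dΦ n r) (Ici 0) r :=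
  fun r _ => (hΦ.hasDerivAt n r).hasDerivWithinAt

variable {q f : ℝ → ℂ} {C C' : ℝ} {Φ dΦ Ψ dΨ : ℕ → ℝ → ℂ}

/-- The derivative of a radial power. -/
noncomputable def radialPowerFDeriv (φ dφ ψ dψ : ℝ → ℂ) (n : ℕ) (c z : ℂ) : ℂ →L[ℝ] Bicomplex :=
  ofPartsL.comp ((radialTermFDeriv reL φ dφ n c z).prod (radialTermFDeriv imL ψ dψ n c z))

theorem hasFDerivAt_radialPower {q' : ℝ → ℂ} (hΦ : IsRadialFamily q ρ C Φ dΦ)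
    (hΨ : IsRadialFamily q' ρ C' Ψ dΨ) (n : ℕ) (c : ℂ) {z : ℂ} (hz : z ∈ Metric.ball (0 : ℂ) ρ) :
    HasFDerivAt (radialPower (Φ n) (Ψ n) n c)
      (radialPowerFDeriv (Φ n) (dΦ n) (Ψ n) (dΨ n) n c z) z :=
  ofPartsL.hasFDerivAt.comp z
    ((hasFDerivAt_radialTerm reL (hΦ.hasDerivWithinAt n) (hΦ.deriv_zero n) n c hz).prodMk
      (hasFDerivAt_radialTerm imL (hΨ.hasDerivWithinAt n) (hΨ.deriv_zero n) n c hz))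

theorem continuousOn_radialPowerFDeriv {q' : ℝ → ℂ} (hΦ : IsRadialFamily q ρ C Φ dΦ)
    (hΨ : IsRadialFamily q' ρ C' Ψ dΨ) (n : ℕ) (c : ℂ) :
    ContinuousOn (radialPowerFDeriv (Φ n) (dΦ n) (Ψ n) (dΨ n) n c) (Metric.ball (0 : ℂ) ρ) := by
  have h1 := continuousOn_radialTermFDeriv reL (ρ := ρ) (hΦ.continuous n).continuousOn
    (hΦ.continuous_deriv n).continuousOn (hΦ.deriv_zero n) n c
  have h2 := continuousOn_radialTermFDeriv imL (ρ := ρ) (hΨ.continuous n).continuousOn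
    (hΨ.continuous_deriv n).continuousOn (hΨ.deriv_zero n) n c
  have e : ∀ A B : ℂ →L[ℝ] ℂ, ofPartsL.comp (A.prod B) =
      (ofPartsL.comp (ContinuousLinearMap.inl ℝ ℂ ℂ)).comp A +
        (ofPartsL.comp (ContinuousLinearMap.inr ℝ ℂ ℂ)).comp B := fun A B => by
    refine ContinuousLinearMap.ext fun v => ?_
    apply ext'
    · exact (add_zero (A v)).symm
    · exact (zero_add (B v)).symm
  refine ContinuousOn.congr ((continuousOn_const.clm_comp h1).add (continuousOn_const.clm_comp h2))
    fun z _ => e _ _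

theorem IsVekuaSolution.congr {W V : ℂ → Bicomplex} (hV : IsVekuaSolution f ρ V)
    (h : EqOn W V (Metric.ball 0 ρ)) : IsVekuaSolution f ρ W := by
  refine ⟨hV.1.congr h, fun z hz => ?_⟩
  have hev : W =ᶠ[𝓝 z] V := h.eventuallyEq_of_mem (Metric.isOpen_ball.mem_nhds hz)
  have e : dbar W z = dbar V z := by unfold dbar; rw [hev.fderiv_eq]
  rw [e, h hz, hV.2 z hz]

theorem IsRadialCoefficient.hasFDerivAt_norm (h : IsRadialCoefficient ρ q f) {z : ℂ}
    (hz : z ∈ Metric.ball (0 : ℂ) ρ) :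
    HasFDerivAt (fun w : ℂ => f ‖w‖) (radialFDeriv (derivWithin f (Icc 0 ρ)) z) z :=
  hasFDerivAt_radial (fun _ hr => h.hasDerivWithinAt_Ici hr) h.deriv_zero hz

/-- The radial powers solve the Vekua equation. -/
theorem isVekuaSolution_radialPower (h : IsRadialCoefficient ρ q f)
    (hΦ : IsRadialFamily q ρ C Φ dΦ) (hΨ : IsRadialFamily (darbouxPotential f q ρ) ρ C' Ψ dΨ)
    (n : ℕ) (c : ℂ) : IsVekuaSolution f ρ (radialPower (Φ n) (Ψ n) n c) := by
  refine ⟨contDiffOn_one_of_hasFDerivAt Metric.isOpen_ball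
    (fun z hz => hasFDerivAt_radialPower hΦ hΨ n c hz)
    (continuousOn_radialPowerFDeriv hΦ hΨ n c), fun z hz => ?_⟩
  have hF := h.hasFDerivAt_norm hz
  rw [vekua_iff hF.differentiableAt (hasFDerivAt_radialPower hΦ hΨ n c hz).differentiableAt,
    hF.fderiv]
  have e1 : fderiv ℝ (fun w => (radialPower (Φ n) (Ψ n) n c w).sc) z =
      radialTermFDeriv reL (Φ n) (dΦ n) n c z :=
    (hasFDerivAt_radialTerm reL (hΦ.hasDerivWithinAt n) (hΦ.deriv_zero n) n c hz).fderiv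
  have e2 : fderiv ℝ (fun w => (radialPower (Φ n) (Ψ n) n c w).vec) z =
      radialTermFDeriv imL (Ψ n) (dΨ n) n c z :=
    (hasFDerivAt_radialTerm imL (hΨ.hasDerivWithinAt n) (hΨ.deriv_zero n) n c hz).fderiv
  rw [e1, e2]
  simp only [radialTermFDeriv_apply, radialFDeriv_apply, radialPower, sc_ofParts, vec_ofParts,
    reL_apply, imL_apply]
  have hid := mul_pow_pred_identity n c z
  set a := c * (n * z ^ (n - 1)) with ha
  set b := c * z ^ n with hb
  by_cases hz0 : z = 0
  -- At the origin every radial derivative vanishes and both factors are 1, so only the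
  -- Cauchy–Riemann equations of c zⁿ remain.
  · have hd0 : dΦ n ‖z‖ = 0 ∧ dΨ n ‖z‖ = 0 ∧ derivWithin f (Icc 0 ρ) ‖z‖ = 0 ∧ Φ n ‖z‖ = 1 ∧
        Ψ n ‖z‖ = 1 := by
      rw [hz0, norm_zero]
      exact ⟨hΦ.deriv_zero n, hΨ.deriv_zero n, h.deriv_zero, hΦ.apply_zero n, hΨ.apply_zero n⟩
    obtain ⟨h1, h2, h3, h4, h5⟩ := hd0
    rw [h1, h2, h3, h4, h5]
    simp
  have hr0 : 0 < ‖z‖ := norm_pos_iff.2 hz0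
  have hr : ‖z‖ ∈ Ioo 0 ρ := ⟨hr0, mem_ball_zero_iff.1 hz⟩
  obtain ⟨s1, s2⟩ := h.system hΦ hΨ (n := n) hr
  have hfr := h.ne_zero ‖z‖ (Ioo_subset_Icc_self hr)
  have hrc : (‖z‖ : ℂ) ≠ 0 := by exact_mod_cast hr0.ne'
  have hn2 : (‖z‖ : ℂ) ^ 2 = (z.re : ℂ) ^ 2 + (z.im : ℂ) ^ 2 := by
    have := Complex.sq_norm z
    rw [Complex.normSq_apply] at this
    have h2 : ‖z‖ ^ 2 = z.re ^ 2 + z.im ^ 2 := by rw [this]; ring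
    exact_mod_cast h2
  have k1 : (z.re : ℂ) * a.re - z.im * a.im = n * b.re := by
    have := congrArg Complex.re hid
    simp only [Complex.mul_re, Complex.natCast_re, Complex.natCast_im, zero_mul, sub_zero] at this
    exact_mod_cast this
  have k2 : (z.re : ℂ) * a.im + z.im * a.re = n * b.im := by
    have := congrArg Complex.im hid
    simp only [Complex.mul_im, Complex.natCast_re, Complex.natCast_im, zero_mul, add_zero] at this
    exact_mod_cast this
  -- Euler's identity z a = n b is solved for a by multiplying with the conjugate of z and dividing
  -- by |z|².
  have m1 : (n * b.re * z.re + n * b.im * z.im) / (‖z‖ : ℂ) ^ 2 = a.re := by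
    rw [div_eq_iff (pow_ne_zero 2 hrc), hn2]
    linear_combination -z.re * k1 - z.im * k2
  have m2 : (n * b.im * z.re - n * b.re * z.im) / (‖z‖ : ℂ) ^ 2 = a.im := by
    rw [div_eq_iff (pow_ne_zero 2 hrc), hn2]
    linear_combination z.im * k1 - z.re * k2
  have t1 : dΦ n ‖z‖ = derivWithin f (Icc 0 ρ) ‖z‖ / f ‖z‖ * Φ n ‖z‖ +
      n * (Ψ n ‖z‖ - Φ n ‖z‖) / ‖z‖ := by
    rw [← s1]; field_simp; ring
  have t2 : dΨ n ‖z‖ = -derivWithin f (Icc 0 ρ) ‖z‖ / f ‖z‖ * Ψ n ‖z‖ +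
      n * (Φ n ‖z‖ - Ψ n ‖z‖) / ‖z‖ := by
    rw [← s2]; field_simp; ring
  rw [t1, t2]
  simp only [mul_one, Complex.one_re, Complex.one_im, Complex.I_re, Complex.I_im, mul_zero,
    zero_add, add_zero, Complex.mul_re, Complex.mul_im, zero_sub]
  push_cast
  constructor
  · linear_combination (Ψ n ‖z‖ - Φ n ‖z‖) * m1
  · linear_combination (Φ n ‖z‖ - Ψ n ‖z‖) * m2

end RadialPowers

/-! ### Formal powers as radial powers. -/

section FormalPowers

open Bicomplex

/-- Homogeneity pulls h(z) out of the integral and leaves the n-th moment of the kernel. -/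
theorem transmute_of_homogeneous {q : ℝ → ℂ} {ρ C : ℝ} {Φ dΦ : ℕ → ℝ → ℂ}
    (hΦ : IsRadialFamily q ρ C Φ dΦ) (n : ℕ) {h : ℂ → ℂ} {z : ℂ} (hz : ‖z‖ ≤ ρ)
    (hh : ∀ s : ℝ, h ((s : ℂ) ^ 2 * z) = ((s : ℂ) ^ 2) ^ n * h z) :
    transmute q ρ h z = Φ n ‖z‖ * h z := by
  rw [transmute, ← hΦ.transmute_eq n ‖z‖ ⟨norm_nonneg z, hz⟩, add_mul, one_mul,
    ← intervalIntegral.integral_mul_const]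
  simp only [hh]
  congr 2
  funext s
  ring

variable {ρ : ℝ} {q q' f : ℝ → ℂ} {C C' : ℝ} {Φ dΦ Ψ dΨ : ℕ → ℝ → ℂ}

/-- Both components of hat(c zⁿ), namely Re(c zⁿ) and Im(c zⁿ), are homogeneous of degree n, so each
transmutation acts by its own radial factor. -/
theorem formalPower_eq (hΦ : IsRadialFamily q ρ C Φ dΦ)
    (hΨ : IsRadialFamily (darbouxPotential f q ρ) ρ C' Ψ dΨ) (n : ℕ) (c : ℂ) {z : ℂ}
    (hz : ‖z‖ ≤ ρ) : formalPower f q ρ n (hat c) z = radialPower (Φ n) (Ψ n) n c z := by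
  have e : ∀ w, hat c * hat w ^ n = hat (c * w ^ n) := fun w => by rw [hat_mul, hat_pow]
  have hs : ∀ s : ℝ, c * ((s : ℂ) ^ 2 * z) ^ n = (((s ^ 2) ^ n : ℝ) : ℂ) * (c * z ^ n) := fun s => by
    push_cast; ring
  unfold formalPower vekuaTransmute radialPower
  simp only [e]
  simp only [hat, sc_ofParts, vec_ofParts]
  rw [transmute_of_homogeneous hΦ n hz, transmute_of_homogeneous hΨ n hz]
  · rfl
  · intro s
    rw [hs, Complex.im_ofReal_mul]
    push_cast; ring
  · intro s
    rw [hs, Complex.re_ofReal_mul]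
    push_cast; ring

theorem continuous_radialPower (hΦ : IsRadialFamily q ρ C Φ dΦ) (hΨ : IsRadialFamily q' ρ C' Ψ dΨ)
    (n : ℕ) (c : ℂ) : Continuous (radialPower (Φ n) (Ψ n) n c) := by
  have h1 := hΦ.continuous n
  have h2 := hΨ.continuous n
  have h3 : Continuous fun z : ℂ => (Φ n ‖z‖ * reL (c * z ^ n), Ψ n ‖z‖ * imL (c * z ^ n)) := by
    fun_prop
  exact ofPartsL.continuous.comp h3

theorem norm_radialPower_le (hΦ : IsRadialFamily q ρ C Φ dΦ) (hΨ : IsRadialFamily q' ρ C' Ψ dΨ)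
    (n : ℕ) (c : ℂ) {z : ℂ} (hz : ‖z‖ ≤ ρ) :
    ‖radialPower (Φ n) (Ψ n) n c z‖ ≤ (C + C') * ‖c‖ * ‖z‖ ^ n := by
  have hr : ‖z‖ ∈ Icc 0 ρ := ⟨norm_nonneg z, hz⟩
  have h1 := hΦ.norm_le n _ hr
  have h2 := hΨ.norm_le n _ hr
  have e : ‖c * z ^ n‖ = ‖c‖ * ‖z‖ ^ n := by rw [norm_mul, norm_pow]
  refine (norm_le_add _).trans ?_
  rw [radialPower, sc_ofParts, vec_ofParts, norm_mul, norm_mul]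
  have h3 := norm_reL_apply_le (c * z ^ n)
  have h4 := norm_imL_apply_le (c * z ^ n)
  rw [e] at h3 h4
  calc _ ≤ C * (‖c‖ * ‖z‖ ^ n) + C' * (‖c‖ * ‖z‖ ^ n) :=
        add_le_add (mul_le_mul h1 h3 (norm_nonneg _) ((norm_nonneg _).trans h1))
          (mul_le_mul h2 h4 (norm_nonneg _) ((norm_nonneg _).trans h2))
    _ = _ := by ring

instance isFiniteMeasure_diskMeasure (ρ : ℝ) : IsFiniteMeasure (diskMeasure ρ) :=
  isFiniteMeasure_restrict.2 measure_ball_lt_top.ne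

theorem memLp_of_continuous {F : ℂ → Bicomplex} (hF : Continuous F) :
    MemLp F 2 (diskMeasure ρ) := by
  obtain ⟨M, hM⟩ := (isCompact_closedBall (0 : ℂ) ρ).exists_bound_of_continuousOn hF.continuousOn
  refine MemLp.of_bound hF.aestronglyMeasurable M ?_
  filter_upwards [ae_restrict_mem measurableSet_ball] with z hz using
    hM z (Metric.ball_subset_closedBall hz)

end FormalPowers

/-! ### Polar coordinates on a disk. -/

section Polar

theorem integral_ball_eq_polar {s : ℝ} (hs : 0 < s) {F : ℂ → ℂ}
    (hF : ContinuousOn F (Metric.closedBall 0 s)) :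
    ∫ z in Metric.ball (0 : ℂ) s, F z = ∫ r in (0 : ℝ)..s, (r : ℂ) *
      ∫ θ in (-Real.pi)..Real.pi, F (r * Complex.exp (θ * Complex.I)) := by
  let H : ℝ × ℝ → ℂ := fun p => (p.1 : ℂ) * F (p.1 * Complex.exp (p.2 * Complex.I))
  have hπ := Real.pi_pos
  have hH : ContinuousOn H (Icc 0 s ×ˢ Icc (-Real.pi) Real.pi) := by
    refine ContinuousOn.mul (by fun_prop) (hF.comp (by fun_prop) fun p hp => ?_)
    rw [mem_closedBall_zero_iff, norm_mul, Complex.norm_exp_ofReal_mul_I, Complex.norm_real,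
      Real.norm_eq_abs, abs_of_nonneg hp.1.1, mul_one]
    exact hp.1.2
  have hHi : IntegrableOn H (Icc 0 s ×ˢ Icc (-Real.pi) Real.pi) (volume.prod volume) :=
    hH.integrableOn_compact (isCompact_Icc.prod isCompact_Icc)
  have e1 : ∫ z in Metric.ball (0 : ℂ) s, F z =
      ∫ p in Ioo 0 s ×ˢ Ioo (-Real.pi) Real.pi, H p ∂(volume.prod volume) := by
    rw [← integral_indicator measurableSet_ball, ← Complex.integral_comp_polarCoord_symm]
    have hset : (Ioo 0 s ×ˢ Ioo (-Real.pi) Real.pi : Set (ℝ × ℝ)) = polarCoord.target ∩ {p | p.1 < s} := by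
      ext p
      simp only [polarCoord_target, mem_prod, mem_Ioo, mem_inter_iff, mem_Ioi, mem_ofPred_eq]
      tauto
    have hm : MeasurableSet {p : ℝ × ℝ | p.1 < s} := measurableSet_lt measurable_fst measurable_const
    rw [hset, ← Measure.volume_eq_prod, inter_comm,
      ← Measure.restrict_restrict hm, ← integral_indicator hm]
    refine setIntegral_congr_fun polarCoord.open_target.measurableSet fun p hp => ?_
    have hn : ‖Complex.polarCoord.symm p‖ = p.1 := by
      rw [Complex.norm_polarCoord_symm, abs_of_pos hp.1]
    by_cases hps : p.1 < s
    · rw [indicator_of_mem (by rw [mem_ball_zero_iff, hn]; exact hps), indicator_of_mem (by exact hps)]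
      simp only [H, Complex.polarCoord_symm_apply, Complex.exp_mul_I, Complex.real_smul,
        Complex.ofReal_cos, Complex.ofReal_sin]
    · rw [indicator_of_notMem (by rw [mem_ball_zero_iff, hn]; exact hps),
        indicator_of_notMem (by exact hps), smul_zero]
  rw [e1, setIntegral_prod _ (hHi.mono_set (prod_mono Ioo_subset_Icc_self Ioo_subset_Icc_self)),
    intervalIntegral.integral_of_le hs.le, ← integral_Ioc_eq_integral_Ioo]
  refine integral_congr_ae (Eventually.of_forall fun r => ?_)
  dsimp only [H]
  rw [intervalIntegral.integral_of_le (by linarith), ← integral_Ioc_eq_integral_Ioo,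
    integral_const_mul]

end Polar

/-! ### Trigonometric integrals over the circle. -/

section Angular

open Complex (exp I)
open scoped ComplexConjugate

theorem integral_exp_int_mul (k : ℤ) :
    ∫ θ in (-Real.pi)..Real.pi, exp (k * (θ * I)) = if k = 0 then (2 * Real.pi : ℂ) else 0 := by
  split_ifs with hk
  · subst hk
    simp
    ring
  · have hc : (k : ℂ) * I ≠ 0 := mul_ne_zero (by exact_mod_cast hk) Complex.I_ne_zero
    have e : ∀ θ : ℝ, exp (k * (θ * I)) = exp ((k * I) * θ) := fun θ => by congr 1; ring
    simp only [e]
    rw [integral_exp_mul_complex hc]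
    have : exp (k * I * (Real.pi : ℝ)) = exp (k * I * ((-Real.pi : ℝ) : ℂ)) := by
      rw [show (k : ℂ) * I * (Real.pi : ℝ) = k * I * ((-Real.pi : ℝ) : ℂ) + k * (2 * Real.pi * I) by
        push_cast; ring, Complex.exp_add, Complex.exp_int_mul_two_pi_mul_I, mul_one]
    rw [this, sub_self, zero_div]

theorem reL_mul_reL (a b : ℂ) : reL a * reL b = 2⁻¹ * (reL (a * b) + reL (a * conj b)) := by
  simp only [reL_apply, Complex.mul_re, Complex.conj_re, Complex.conj_im]
  push_cast; ring

theorem imL_mul_imL (a b : ℂ) : imL a * imL b = 2⁻¹ * (reL (a * conj b) - reL (a * b)) := by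
  simp only [reL_apply, imL_apply, Complex.mul_re, Complex.conj_re, Complex.conj_im]
  push_cast; ring

theorem integral_reL_const_mul_exp (a : ℂ) (k : ℤ) :
    ∫ θ in (-Real.pi)..Real.pi, reL (a * exp (k * (θ * I))) =
      2 * Real.pi * (if k = 0 then reL a else 0) := by
  rw [reL.intervalIntegral_comp_comm (Continuous.intervalIntegrable (by fun_prop) _ _),
    intervalIntegral.integral_const_mul, integral_exp_int_mul]
  split_ifs
  · rw [show a * (2 * (Real.pi : ℂ)) = (2 * Real.pi : ℝ) • a by
      rw [Complex.real_smul]; push_cast; ring, map_smul, Complex.real_smul]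
    push_cast; ring
  · simp

variable (n m : ℕ) (a b : ℂ)

/-- The integral of `Re(a e^{inθ}) Re(b e^{imθ})` over a period, divided by `π`. -/
noncomputable def angularRe : ℂ :=
  (if n + m = 0 then reL (a * b) else 0) + (if n = m then reL (a * conj b) else 0)

/-- The integral of `Im(a e^{inθ}) Im(b e^{imθ})` over a period, divided by `π`. -/
noncomputable def angularIm : ℂ :=
  (if n = m then reL (a * conj b) else 0) - (if n + m = 0 then reL (a * b) else 0)

theorem exp_pow_mul_exp_pow (θ : ℝ) :
    (a * exp (θ * I) ^ n) * (b * exp (θ * I) ^ m) = a * b * exp (((n + m : ℕ) : ℤ) * (θ * I)) ∧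
    (a * exp (θ * I) ^ n) * conj (b * exp (θ * I) ^ m) =
      a * conj b * exp (((n : ℤ) - (m : ℤ) : ℤ) * (θ * I)) := by
  constructor
  · rw [← Complex.exp_nat_mul, ← Complex.exp_nat_mul]
    push_cast
    rw [add_mul, Complex.exp_add]; ring
  · rw [← Complex.exp_nat_mul, ← Complex.exp_nat_mul, map_mul, ← Complex.exp_conj, map_mul,
      map_mul, Complex.conj_ofReal, Complex.conj_I, Complex.conj_natCast]
    push_cast
    rw [sub_mul, Complex.exp_sub, div_eq_mul_inv, ← Complex.exp_neg, mul_neg, mul_neg]; ring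

theorem integral_reL_mul_reL :
    ∫ θ in (-Real.pi)..Real.pi, reL (a * exp (θ * I) ^ n) * reL (b * exp (θ * I) ^ m) =
      Real.pi * angularRe n m a b := by
  simp only [reL_mul_reL, (exp_pow_mul_exp_pow n m a b _).1, (exp_pow_mul_exp_pow n m a b _).2]
  rw [intervalIntegral.integral_const_mul, intervalIntegral.integral_add
    (Continuous.intervalIntegrable (by fun_prop) _ _)
    (Continuous.intervalIntegrable (by fun_prop) _ _), integral_reL_const_mul_exp,
    integral_reL_const_mul_exp, angularRe]
  simp only [Nat.cast_eq_zero, sub_eq_zero, Nat.cast_inj]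
  ring

theorem integral_imL_mul_imL :
    ∫ θ in (-Real.pi)..Real.pi, imL (a * exp (θ * I) ^ n) * imL (b * exp (θ * I) ^ m) =
      Real.pi * angularIm n m a b := by
  simp only [imL_mul_imL, (exp_pow_mul_exp_pow n m a b _).1, (exp_pow_mul_exp_pow n m a b _).2]
  rw [intervalIntegral.integral_const_mul, intervalIntegral.integral_sub
    (Continuous.intervalIntegrable (by fun_prop) _ _)
    (Continuous.intervalIntegrable (by fun_prop) _ _), integral_reL_const_mul_exp,
    integral_reL_const_mul_exp, angularIm]
  simp only [Nat.cast_eq_zero, sub_eq_zero, Nat.cast_inj]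
  ring

end Angular

/-! ### Inner products of the radial powers. -/

section Orthogonality

open Bicomplex
open Complex (exp I)
open scoped ComplexConjugate

theorem reL_mul_polar (n : ℕ) (c : ℂ) (r θ : ℝ) :
    reL (c * (r * exp (θ * I)) ^ n) = (r : ℂ) ^ n * reL (c * exp (θ * I) ^ n) := by
  rw [show c * (r * exp (θ * I)) ^ n = (r ^ n : ℝ) • (c * exp (θ * I) ^ n) by
    rw [Complex.real_smul]; push_cast; ring, map_smul, Complex.real_smul]
  push_cast; ring

theorem imL_mul_polar (n : ℕ) (c : ℂ) (r θ : ℝ) :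
    imL (c * (r * exp (θ * I)) ^ n) = (r : ℂ) ^ n * imL (c * exp (θ * I) ^ n) := by
  rw [show c * (r * exp (θ * I)) ^ n = (r ^ n : ℝ) • (c * exp (θ * I) ^ n) by
    rw [Complex.real_smul]; push_cast; ring, map_smul, Complex.real_smul]
  push_cast; ring

theorem conj_reL (z : ℂ) : conj (reL z) = reL z := Complex.conj_ofReal _
theorem conj_imL (z : ℂ) : conj (imL z) = imL z := Complex.conj_ofReal _

theorem norm_ofReal_mul_exp {r : ℝ} (hr : 0 ≤ r) (θ : ℝ) : ‖(r : ℂ) * exp (θ * I)‖ = r := by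
  rw [norm_mul, Complex.norm_exp_ofReal_mul_I, mul_one, Complex.norm_real, Real.norm_eq_abs,
    abs_of_nonneg hr]

variable {ρ : ℝ} {q q' f : ℝ → ℂ} {C C' : ℝ} {Φ dΦ Ψ dΨ : ℕ → ℝ → ℂ}

theorem continuous_pairing {F G : ℂ → Bicomplex} (hF : Continuous F) (hG : Continuous G) :
    Continuous fun z => pairing (F z) (G z) := by
  simp only [pairing_eq_inner]
  exact hG.inner hF

/-- The inner products of the radial powers. -/
theorem l2Inner_radialPower (hρ : 0 < ρ) (hΦ : IsRadialFamily q ρ C Φ dΦ)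
    (hΨ : IsRadialFamily q' ρ C' Ψ dΨ) (n m : ℕ) (a b : ℂ) :
    l2Inner ρ (radialPower (Φ n) (Ψ n) n a) (radialPower (Φ m) (Ψ m) m b) =
      ∫ r in (0 : ℝ)..ρ, Real.pi * (r : ℂ) ^ (n + m + 1) *
        (angularRe n m a b * (Φ n r * conj (Φ m r)) +
          angularIm n m a b * (Ψ n r * conj (Ψ m r))) := by
  rw [l2Inner, diskMeasure, integral_ball_eq_polar hρ (continuous_pairing
    (continuous_radialPower hΦ hΨ n a) (continuous_radialPower hΦ hΨ m b)).continuousOn]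
  refine intervalIntegral.integral_congr fun r hr => ?_
  rw [uIcc_of_le hρ.le] at hr
  have e : ∀ θ : ℝ, pairing (radialPower (Φ n) (Ψ n) n a (r * exp (θ * I)))
      (radialPower (Φ m) (Ψ m) m b (r * exp (θ * I))) =
      (r : ℂ) ^ (n + m) * (Φ n r * conj (Φ m r)) *
        (reL (a * exp (θ * I) ^ n) * reL (b * exp (θ * I) ^ m)) +
      (r : ℂ) ^ (n + m) * (Ψ n r * conj (Ψ m r)) *
        (imL (a * exp (θ * I) ^ n) * imL (b * exp (θ * I) ^ m)) := fun θ => by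
    rw [pairing_eq]
    simp only [radialPower, sc_ofParts, vec_ofParts, norm_ofReal_mul_exp hr.1, reL_mul_polar,
      imL_mul_polar, map_mul, conj_reL, conj_imL, map_pow, Complex.conj_ofReal]
    ring
  simp only [e]
  rw [intervalIntegral.integral_add (Continuous.intervalIntegrable (by fun_prop) _ _)
    (Continuous.intervalIntegrable (by fun_prop) _ _), intervalIntegral.integral_const_mul,
    intervalIntegral.integral_const_mul, integral_reL_mul_reL, integral_imL_mul_imL]
  ring

theorem l2Inner_congr {F F' G G' : ℂ → Bicomplex} (hF : EqOn F F' (Metric.ball 0 ρ))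
    (hG : EqOn G G' (Metric.ball 0 ρ)) : l2Inner ρ F G = l2Inner ρ F' G' :=
  setIntegral_congr_fun measurableSet_ball fun z hz => by
    simp only [hF hz, hG hz]

theorem IsRadialFamily.weightedNormSq_eq (hρ : 0 < ρ) (hΦ : IsRadialFamily q ρ C Φ dΦ) (n k : ℕ) :
    ((weightedNormSq ρ k (phi q ρ n) : ℝ) : ℂ) =
      ∫ r in (0 : ℝ)..ρ, (r : ℂ) ^ k * (Φ n r * conj (Φ n r)) := by
  rw [weightedNormSq, ← intervalIntegral.integral_ofReal]
  refine intervalIntegral.integral_congr_ae (Eventually.of_forall fun r hr => ?_)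
  rw [uIoc_of_le hρ.le] at hr
  rw [hΦ.phi_eq n r hr, Complex.mul_conj, Complex.normSq_eq_norm_sq]
  push_cast; ring

theorem l2Inner_radialPower_self (hρ : 0 < ρ) (hΦ : IsRadialFamily q ρ C Φ dΦ)
    (hΨ : IsRadialFamily q' ρ C' Ψ dΨ) (n : ℕ) (a b : ℂ) :
    l2Inner ρ (radialPower (Φ n) (Ψ n) n a) (radialPower (Φ n) (Ψ n) n b) =
      Real.pi * (angularRe n n a b * (weightedNormSq ρ (2 * n + 1) (phi q ρ n) : ℝ) +
        angularIm n n a b * (weightedNormSq ρ (2 * n + 1) (phi q' ρ n) : ℝ)) := by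
  have h1 := hΦ.continuous n
  have h2 := hΨ.continuous n
  rw [l2Inner_radialPower hρ hΦ hΨ, hΦ.weightedNormSq_eq hρ, hΨ.weightedNormSq_eq hρ,
    ← intervalIntegral.integral_const_mul, ← intervalIntegral.integral_const_mul,
    ← intervalIntegral.integral_add
      (Continuous.intervalIntegrable (by fun_prop) _ _)
      (Continuous.intervalIntegrable (by fun_prop) _ _), ← intervalIntegral.integral_const_mul]
  refine intervalIntegral.integral_congr fun r _ => ?_
  rw [← two_mul]
  ring

theorem l2Inner_radialPower_eq_zero (hρ : 0 < ρ) (hΦ : IsRadialFamily q ρ C Φ dΦ)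
    (hΨ : IsRadialFamily q' ρ C' Ψ dΨ) {n m : ℕ} {a b : ℂ} (hr : angularRe n m a b = 0)
    (hi : angularIm n m a b = 0) :
    l2Inner ρ (radialPower (Φ n) (Ψ n) n a) (radialPower (Φ m) (Ψ m) m b) = 0 := by
  rw [l2Inner_radialPower hρ hΦ hΨ, hr, hi]
  simp

theorem angularRe_of_ne {n m : ℕ} (h : n ≠ m) (a b : ℂ) : angularRe n m a b = 0 := by
  rw [angularRe, if_neg (by omega), if_neg h, add_zero]

theorem angularIm_of_ne {n m : ℕ} (h : n ≠ m) (a b : ℂ) : angularIm n m a b = 0 := by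
  rw [angularIm, if_neg h, if_neg (by omega), sub_zero]

theorem angularRe_one_I (n m : ℕ) : angularRe n m 1 I = 0 := by simp [angularRe, reL_apply]
theorem angularIm_one_I (n m : ℕ) : angularIm n m 1 I = 0 := by simp [angularIm, reL_apply]
theorem angularRe_I_one (n m : ℕ) : angularRe n m I 1 = 0 := by simp [angularRe, reL_apply]
theorem angularIm_I_one (n m : ℕ) : angularIm n m I 1 = 0 := by simp [angularIm, reL_apply]

theorem angularRe_self {n : ℕ} (hn : 1 ≤ n) {c : ℂ} (hc : ‖c‖ = 1) : angularRe n n c c = 1 := by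
  rw [angularRe, if_neg (by omega), if_pos rfl, Complex.mul_conj, Complex.normSq_eq_norm_sq, hc]
  simp [reL_apply]

theorem angularIm_self {n : ℕ} (hn : 1 ≤ n) {c : ℂ} (hc : ‖c‖ = 1) : angularIm n n c c = 1 := by
  rw [angularIm, if_pos rfl, if_neg (by omega), Complex.mul_conj, Complex.normSq_eq_norm_sq, hc]
  simp [reL_apply]

theorem angularRe_zero_one : angularRe 0 0 1 1 = 2 := by norm_num [angularRe, reL_apply]
theorem angularIm_zero_one : angularIm 0 0 1 1 = 0 := by norm_num [angularIm, reL_apply]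
theorem angularRe_zero_I : angularRe 0 0 I I = 0 := by norm_num [angularRe, reL_apply]
theorem angularIm_zero_I : angularIm 0 0 I I = 2 := by norm_num [angularIm, reL_apply]

end Orthogonality

/-! ### Fourier coefficients on circles. -/

section AngularMean

open Complex (exp I)

/-- The integral of `u(r e^{iθ}) h(θ)` over the circle of radius `r`. -/
noncomputable def angularMean (u : ℂ → ℂ) (h : ℝ → ℂ) (r : ℝ) : ℂ :=
  ∫ θ in (-Real.pi)..Real.pi, u (r * exp (θ * I)) * h θ

variable {u : ℂ → ℂ} {h : ℝ → ℂ} {ρ r : ℝ}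

theorem ofReal_mul_exp_mem_ball (hr : r ∈ Ico 0 ρ) (θ : ℝ) :
    (r : ℂ) * exp (θ * I) ∈ Metric.ball (0 : ℂ) ρ := by
  rw [mem_ball_zero_iff, norm_ofReal_mul_exp hr.1]; exact hr.2

/-- Boundedness of the Fourier coefficients near r = 0 is what later rules out the singular
solutions of the radial system. -/
theorem exists_norm_angularMean_le (hu : ContinuousOn u (Metric.ball 0 ρ)) (hh : Continuous h)
    {s : ℝ} (hs : s < ρ) : ∃ M, ∀ r ∈ Icc 0 s, ‖angularMean u h r‖ ≤ M := by
  obtain ⟨A, hA⟩ := (isCompact_closedBall (0 : ℂ) s).exists_bound_of_continuousOn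
    (hu.mono (Metric.closedBall_subset_ball hs))
  obtain ⟨B, hB⟩ := (isCompact_Icc (a := -Real.pi) (b := Real.pi)).exists_bound_of_continuousOn
    hh.continuousOn
  have hπ := Real.pi_pos
  refine ⟨A * B * |Real.pi - -Real.pi|, fun r hr =>
    intervalIntegral.norm_integral_le_of_norm_le_const fun θ hθ => ?_⟩
  rw [uIoc_of_le (by linarith)] at hθ
  have h1 := hA (r * exp (θ * I)) (by
    rw [mem_closedBall_zero_iff, norm_ofReal_mul_exp hr.1]; exact hr.2)
  rw [norm_mul]
  exact mul_le_mul h1 (hB θ (Ioc_subset_Icc_self hθ)) (norm_nonneg _) ((norm_nonneg _).trans h1)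

theorem hasDerivAt_angularMean (hu : ContDiffOn ℝ 1 u (Metric.ball 0 ρ)) (hh : Continuous h)
    (hr : r ∈ Ioo 0 ρ) : HasDerivAt (angularMean u h)
      (∫ θ in (-Real.pi)..Real.pi, fderiv ℝ u (r * exp (θ * I)) (exp (θ * I)) * h θ) r := by
  have hdu : ContinuousOn (fderiv ℝ u) (Metric.ball 0 ρ) :=
    hu.continuousOn_fderiv_of_isOpen Metric.isOpen_ball le_rfl
  have hmem : ∀ p : ℝ × ℝ, p.1 ∈ Ioo 0 ρ → (p.1 : ℂ) * exp (p.2 * I) ∈ Metric.ball (0 : ℂ) ρ :=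
    fun p hp => ofReal_mul_exp_mem_ball ⟨hp.1.le, hp.2⟩ p.2
  have hc : ∀ s ∈ Ioo 0 ρ, Continuous fun θ : ℝ => u (s * exp (θ * I)) * h θ := fun s hs =>
    (hu.continuousOn.comp_continuous (by fun_prop) fun θ => hmem (s, θ) hs).mul hh
  have hc' : ContinuousOn (fun p : ℝ × ℝ =>
      fderiv ℝ u (p.1 * exp (p.2 * I)) (exp (p.2 * I)) * h p.2) (Ioo 0 ρ ×ˢ univ) := by
    refine ContinuousOn.mul (ContinuousOn.clm_apply (hdu.comp (by fun_prop) fun p hp => ?_)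
      (by fun_prop)) (by fun_prop)
    exact hmem p hp.1
  obtain ⟨ε, hε, hball⟩ := Metric.nhds_basis_closedBall.mem_iff.1 (isOpen_Ioo.mem_nhds hr)
  obtain ⟨M, hM⟩ := ((isCompact_closedBall r ε).prod
    (isCompact_Icc (a := -Real.pi) (b := Real.pi))).exists_bound_of_continuousOn
    (hc'.mono (prod_mono hball (subset_univ _)))
  have hπ := Real.pi_pos
  refine (intervalIntegral.hasDerivAt_integral_of_dominated_loc_of_deriv_le
    (F := fun (s : ℝ) (θ : ℝ) => u (s * exp (θ * I)) * h θ)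
    (F' := fun (s : ℝ) (θ : ℝ) => fderiv ℝ u (s * exp (θ * I)) (exp (θ * I)) * h θ)
    (bound := fun _ => M) (Metric.closedBall_mem_nhds r hε) ?_
    ((hc r hr).intervalIntegrable _ _) ?_ (Eventually.of_forall fun θ hθ s hs => ?_)
    intervalIntegrable_const (Eventually.of_forall fun θ hθ s hs => ?_)).2
  · filter_upwards [isOpen_Ioo.mem_nhds hr] with s hs using (hc s hs).aestronglyMeasurable
  · have : Continuous fun θ : ℝ => fderiv ℝ u (r * exp (θ * I)) (exp (θ * I)) * h θ :=
      hc'.comp_continuous (f := fun θ : ℝ => (r, θ)) (by fun_prop) fun θ => ⟨hr, mem_univ _⟩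
    exact this.aestronglyMeasurable
  · rw [uIoc_of_le (by linarith)] at hθ
    exact hM (s, θ) ⟨hs, Ioc_subset_Icc_self hθ⟩
  · have hd := ((hu.differentiableOn one_ne_zero).differentiableAt
      (Metric.isOpen_ball.mem_nhds (hmem (s, θ) (hball hs)))).hasFDerivAt
    have hl : HasDerivAt (fun t : ℝ => (t : ℂ) * exp (θ * I)) (exp (θ * I)) s := by
      simpa using (Complex.ofRealCLM.hasDerivAt (x := s)).mul_const (exp (θ * I))
    exact (hd.comp_hasDerivAt s hl).mul_const _

theorem exp_neg_pi_mul_I : exp (((-Real.pi : ℝ) : ℂ) * I) = exp ((Real.pi : ℝ) * I) := by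
  rw [Complex.exp_pi_mul_I]; push_cast; rw [neg_mul, Complex.exp_neg, Complex.exp_pi_mul_I]
  norm_num

/-- Integration by parts along a circle. -/
theorem integral_fderiv_rotate (hu : ContDiffOn ℝ 1 u (Metric.ball 0 ρ)) {h' : ℝ → ℂ}
    (hh : ∀ θ, HasDerivAt h (h' θ) θ) (hh' : Continuous h') (hper : h (-Real.pi) = h Real.pi)
    (hr : r ∈ Ioo 0 ρ) :
    r * ∫ θ in (-Real.pi)..Real.pi, fderiv ℝ u (r * exp (θ * I)) (I * exp (θ * I)) * h θ =
      -angularMean u h' r := by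
  have hdu : ContinuousOn (fderiv ℝ u) (Metric.ball 0 ρ) :=
    hu.continuousOn_fderiv_of_isOpen Metric.isOpen_ball le_rfl
  have hmem := ofReal_mul_exp_mem_ball (Ioo_subset_Ico_self hr)
  have hd : ∀ θ : ℝ, HasDerivAt (fun θ : ℝ => u (r * exp (θ * I)))
      (fderiv ℝ u (r * exp (θ * I)) (r * (I * exp (θ * I)))) θ := fun θ => by
    have hd := ((hu.differentiableOn one_ne_zero).differentiableAt
      (Metric.isOpen_ball.mem_nhds (hmem θ))).hasFDerivAt
    have hl : HasDerivAt (fun t : ℝ => (r : ℂ) * exp (t * I)) (r * (I * exp (θ * I))) θ := by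
      have h0 : HasDerivAt (fun t : ℝ => (t : ℂ) * I) I θ := by
        simpa using (Complex.ofRealCLM.hasDerivAt (x := θ)).mul_const I
      exact (h0.cexp.const_mul (r : ℂ)).congr_deriv (by ring)
    exact hd.comp_hasDerivAt θ hl
  have hc : Continuous fun θ : ℝ => fderiv ℝ u (r * exp (θ * I)) (r * (I * exp (θ * I))) :=
    (hdu.comp_continuous (by fun_prop) hmem).clm_apply (by fun_prop)
  have key := intervalIntegral.integral_mul_deriv_eq_deriv_mul (a := -Real.pi) (b := Real.pi)
    (fun θ _ => hd θ) (fun θ _ => hh θ) (hc.intervalIntegrable _ _) (hh'.intervalIntegrable _ _)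
  rw [angularMean, key, hper]
  rw [exp_neg_pi_mul_I, sub_self, zero_sub, neg_neg, ← intervalIntegral.integral_const_mul]
  refine intervalIntegral.integral_congr fun θ _ => ?_
  have : fderiv ℝ u (r * exp (θ * I)) (r * (I * exp (θ * I))) =
      r * fderiv ℝ u (r * exp (θ * I)) (I * exp (θ * I)) := by
    rw [← Complex.real_smul (x := r) (z := I * _), map_smul, Complex.real_smul]
  simp only [this]
  ring

/-- The zero Fourier series is summable, so for a continuous function it converges pointwise to that
function. -/
theorem eq_zero_of_integral_exp_eq_zero {h : ℂ → ℂ} (hc : Continuous fun w : Circle => h w)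
    (hz : ∀ k : ℤ, ∫ θ in (-Real.pi)..Real.pi, exp (k * (θ * I)) * h (exp (θ * I)) = 0) (θ : ℝ) :
    h (exp (θ * I)) = 0 := by
  have : Fact (0 < 2 * Real.pi) := ⟨Real.two_pi_pos⟩
  let F : C(AddCircle (2 * Real.pi), ℂ) :=
    ⟨fun x => h (AddCircle.toCircle x), hc.comp AddCircle.continuous_toCircle⟩
  have hF : ∀ θ : ℝ, F (θ : AddCircle (2 * Real.pi)) = h (exp (θ * I)) := fun θ => by
    change h (AddCircle.toCircle (θ : AddCircle (2 * Real.pi)) : ℂ) = _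
    rw [AddCircle.toCircle_apply_mk, div_self Real.two_pi_pos.ne', one_mul, Circle.coe_exp]
  have hcoef : ∀ k, fourierCoeff F k = 0 := fun k => by
    rw [fourierCoeff_eq_intervalIntegral F k (-Real.pi),
      show -Real.pi + 2 * Real.pi = Real.pi by ring]
    have : ∀ θ : ℝ, fourier (-k) (θ : AddCircle (2 * Real.pi)) • F θ =
        exp ((-k : ℤ) * (θ * I)) * h (exp (θ * I)) := fun θ => by
      rw [fourier_coe_apply, hF, smul_eq_mul]
      congr 2
      have : (Real.pi : ℂ) ≠ 0 := by exact_mod_cast Real.pi_ne_zero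
      push_cast
      field_simp
    simp only [this]
    rw [hz, smul_zero]
  have hs : Summable (fourierCoeff F) := by
    rw [show fourierCoeff F = 0 from funext hcoef]; exact summable_zero
  have := has_pointwise_sum_fourier_series_of_summable hs (θ : AddCircle (2 * Real.pi))
  simp only [hcoef, zero_smul] at this
  rw [← hF]
  exact this.unique hasSum_zero

end AngularMean

/-! ### The Vekua equation in polar coordinates and the system for Fourier coefficients. -/

section PolarSystem

open Bicomplex
open Complex (exp I)

variable {ρ : ℝ} {q f : ℝ → ℂ} {W : ℂ → Bicomplex}

theorem IsVekuaSolution.contDiffOn_sc (hW : IsVekuaSolution f ρ W) :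
    ContDiffOn ℝ 1 (fun z => (W z).sc) (Metric.ball 0 ρ) :=
  scL.contDiff.comp_contDiffOn hW.1

theorem IsVekuaSolution.contDiffOn_vec (hW : IsVekuaSolution f ρ W) :
    ContDiffOn ℝ 1 (fun z => (W z).vec) (Metric.ball 0 ρ) :=
  vecL.contDiff.comp_contDiffOn hW.1

theorem realLinear_apply (L : ℂ →L[ℝ] ℂ) (z : ℂ) : L z = z.re * L 1 + z.im * L I := by
  have e : z = z.re • (1 : ℂ) + z.im • I := by
    rw [Complex.real_smul, Complex.real_smul, mul_one, Complex.re_add_im]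
  conv_lhs => rw [e]
  rw [map_add, map_smul, map_smul, Complex.real_smul, Complex.real_smul]

/-- The Vekua equation in polar coordinates. -/
theorem IsVekuaSolution.polar (h : IsRadialCoefficient ρ q f) (hW : IsVekuaSolution f ρ W)
    {r : ℝ} (hr : r ∈ Ioo 0 ρ) (θ : ℝ) :
    (fderiv ℝ (fun w => (W w).sc) (r * exp (θ * I)) (exp (θ * I)) =
      derivWithin f (Icc 0 ρ) r / f r * (W (r * exp (θ * I))).sc +
        fderiv ℝ (fun w => (W w).vec) (r * exp (θ * I)) (I * exp (θ * I))) ∧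
    (fderiv ℝ (fun w => (W w).vec) (r * exp (θ * I)) (exp (θ * I)) =
      -(derivWithin f (Icc 0 ρ) r / f r) * (W (r * exp (θ * I))).vec -
        fderiv ℝ (fun w => (W w).sc) (r * exp (θ * I)) (I * exp (θ * I))) := by
  have hz := ofReal_mul_exp_mem_ball (Ioo_subset_Ico_self hr) θ
  have hn := norm_ofReal_mul_exp hr.1.le θ
  have hre : ((r : ℂ) * exp (θ * I)).re = r * (exp (θ * I)).re := Complex.re_ofReal_mul _ _
  have him : ((r : ℂ) * exp (θ * I)).im = r * (exp (θ * I)).im := Complex.im_ofReal_mul _ _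
  have hu : ((exp (θ * I)).re : ℂ) ^ 2 + ((exp (θ * I)).im : ℂ) ^ 2 = 1 := by
    have h1 := Complex.sq_norm (exp (θ * I))
    rw [Complex.norm_exp_ofReal_mul_I, Complex.normSq_apply] at h1
    have h2 : (exp (θ * I)).re ^ 2 + (exp (θ * I)).im ^ 2 = 1 := by linarith
    exact_mod_cast h2
  generalize exp (θ * I) = e at *
  generalize hzz : (r : ℂ) * e = z at *
  have hF := h.hasFDerivAt_norm hz
  have hd := (hW.1.differentiableOn one_ne_zero).differentiableAt (Metric.isOpen_ball.mem_nhds hz)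
  obtain ⟨h1, h2⟩ := (vekua_iff hF.differentiableAt hd).1 (hW.2 z hz)
  rw [hF.fderiv] at h1 h2
  simp only [radialFDeriv_apply, hn, hre, him, Complex.one_re, Complex.one_im, Complex.I_re,
    Complex.I_im, mul_one, mul_zero, add_zero, zero_add] at h1 h2
  have hrc : (r : ℂ) ≠ 0 := by exact_mod_cast hr.1.ne'
  have hx : ∀ t : ℝ, ((r * t : ℝ) : ℂ) * (derivWithin f (Icc 0 ρ) r / r) =
      t * derivWithin f (Icc 0 ρ) r := fun t => by push_cast; field_simp
  rw [hx, hx] at h1 h2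
  rw [realLinear_apply _ e, realLinear_apply _ (I * e), realLinear_apply (fderiv ℝ _ z) e,
    realLinear_apply (fderiv ℝ (fun w => (W w).sc) z) (I * e)]
  have i1 : (((I * e).re : ℝ) : ℂ) = -e.im := by simp
  have i2 : (((I * e).im : ℝ) : ℂ) = e.re := by simp
  rw [i1, i2, div_eq_inv_mul]
  constructor
  -- The Cartesian equations are rotated by the unit vector e; `hu` is |e|² = 1.
  · linear_combination e.re * h1 + e.im * h2 +
      (f r)⁻¹ * derivWithin f (Icc 0 ρ) r * (W z).sc * hu
  · linear_combination -e.im * h1 + e.re * h2 -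
      (f r)⁻¹ * derivWithin f (Icc 0 ρ) r * (W z).vec * hu

theorem continuous_reL_exp (n : ℕ) (c : ℂ) : Continuous fun θ : ℝ => reL (c * exp (θ * I) ^ n) := by
  fun_prop

theorem continuous_imL_exp (n : ℕ) (c : ℂ) : Continuous fun θ : ℝ => imL (c * exp (θ * I) ^ n) := by
  fun_prop

theorem hasDerivAt_const_mul_exp_pow (n : ℕ) (c : ℂ) (θ : ℝ) :
    HasDerivAt (fun θ : ℝ => c * exp (θ * I) ^ n) ((n : ℝ) • (I * (c * exp (θ * I) ^ n))) θ := by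
  have e : ∀ θ : ℝ, c * exp (θ * I) ^ n = c * exp (θ * (n * I)) := fun θ => by
    rw [← Complex.exp_nat_mul]; congr 2; ring
  simp only [e]
  have h0 : HasDerivAt (fun t : ℝ => (t : ℂ) * (n * I)) (n * I) θ := by
    simpa using (Complex.ofRealCLM.hasDerivAt (x := θ)).mul_const (n * I)
  refine (h0.cexp.const_mul c).congr_deriv ?_
  rw [Complex.real_smul]
  push_cast
  ring

theorem hasDerivAt_reL_exp (n : ℕ) (c : ℂ) (θ : ℝ) : HasDerivAt
    (fun θ : ℝ => reL (c * exp (θ * I) ^ n)) (-(n * imL (c * exp (θ * I) ^ n))) θ := by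
  refine (reL.hasFDerivAt.comp_hasDerivAt θ (hasDerivAt_const_mul_exp_pow n c θ)).congr_deriv ?_
  rw [map_smul, Complex.real_smul]
  simp [reL_apply, imL_apply]
  ring

theorem hasDerivAt_imL_exp (n : ℕ) (c : ℂ) (θ : ℝ) : HasDerivAt
    (fun θ : ℝ => imL (c * exp (θ * I) ^ n)) (n * reL (c * exp (θ * I) ^ n)) θ := by
  refine (imL.hasFDerivAt.comp_hasDerivAt θ (hasDerivAt_const_mul_exp_pow n c θ)).congr_deriv ?_
  rw [map_smul, Complex.real_smul]
  simp [reL_apply, imL_apply]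

/-- The Fourier coefficient `∫ Sc W(r e^{iθ}) Re(c e^{inθ}) dθ`. -/
noncomputable def scMean (W : ℂ → Bicomplex) (n : ℕ) (c : ℂ) : ℝ → ℂ :=
  angularMean (fun z => (W z).sc) fun θ => reL (c * exp (θ * I) ^ n)

/-- The Fourier coefficient `∫ Vec W(r e^{iθ}) Im(c e^{inθ}) dθ`. -/
noncomputable def vecMean (W : ℂ → Bicomplex) (n : ℕ) (c : ℂ) : ℝ → ℂ :=
  angularMean (fun z => (W z).vec) fun θ => imL (c * exp (θ * I) ^ n)

theorem angularMean_const_mul (u : ℂ → ℂ) (h : ℝ → ℂ) (k : ℂ) (r : ℝ) :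
    angularMean u (fun θ => k * h θ) r = k * angularMean u h r := by
  rw [angularMean, angularMean, ← intervalIntegral.integral_const_mul]
  refine intervalIntegral.integral_congr fun θ _ => ?_
  ring

theorem continuous_comp_circle {u : ℂ → ℂ} (hu : ContinuousOn u (Metric.ball 0 ρ)) {r : ℝ}
    (hr : r ∈ Ico 0 ρ) : Continuous fun θ : ℝ => u (r * exp (θ * I)) :=
  hu.comp_continuous (by fun_prop) (ofReal_mul_exp_mem_ball hr)

theorem continuous_fderiv_comp_circle {u : ℂ → ℂ} (hu : ContDiffOn ℝ 1 u (Metric.ball 0 ρ)) {r : ℝ}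
    (hr : r ∈ Ico 0 ρ) : Continuous fun θ : ℝ => fderiv ℝ u (r * exp (θ * I)) (I * exp (θ * I)) :=
  ((hu.continuousOn_fderiv_of_isOpen Metric.isOpen_ball le_rfl).comp_continuous (by fun_prop)
    (ofReal_mul_exp_mem_ball hr)).clm_apply (by fun_prop)

/-- Integrate the polar Vekua equation against Re(c e^{inθ}). Integrating the tangential derivative
by parts moves it onto the trigonometric factor, which becomes -n Im(c e^{inθ}); hence the scalar
mean couples to the vectorial one. -/
theorem IsVekuaSolution.hasDerivAt_scMean (h : IsRadialCoefficient ρ q f)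
    (hW : IsVekuaSolution f ρ W) (n : ℕ) (c : ℂ) {r : ℝ} (hr : r ∈ Ioo 0 ρ) :
    HasDerivAt (scMean W n c) (derivWithin f (Icc 0 ρ) r / f r * scMean W n c r +
      n / r * vecMean W n c r) r := by
  have hr' := Ioo_subset_Ico_self hr
  refine (hasDerivAt_angularMean hW.contDiffOn_sc (continuous_reL_exp n c) hr).congr_deriv ?_
  have hu := continuous_comp_circle hW.contDiffOn_sc.continuousOn hr'
  have hv := continuous_fderiv_comp_circle hW.contDiffOn_vec hr'
  have hc := continuous_reL_exp n c
  have parts := integral_fderiv_rotate hW.contDiffOn_vec (hasDerivAt_reL_exp n c)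
    (by fun_prop) (by rw [exp_neg_pi_mul_I]) hr
  simp only [(hW.polar h hr _).1, add_mul, mul_assoc]
  rw [intervalIntegral.integral_add (Continuous.intervalIntegrable (by fun_prop) _ _)
    (Continuous.intervalIntegrable (by fun_prop) _ _), intervalIntegral.integral_const_mul]
  congr 1
  have hrc : (r : ℂ) ≠ 0 := by exact_mod_cast hr.1.ne'
  rw [div_mul_eq_mul_div, eq_div_iff hrc, mul_comm, parts]
  simp only [neg_mul_eq_neg_mul]
  rw [angularMean_const_mul, vecMean]
  ring

theorem IsVekuaSolution.hasDerivAt_vecMean (h : IsRadialCoefficient ρ q f)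
    (hW : IsVekuaSolution f ρ W) (n : ℕ) (c : ℂ) {r : ℝ} (hr : r ∈ Ioo 0 ρ) :
    HasDerivAt (vecMean W n c) (-(derivWithin f (Icc 0 ρ) r / f r) * vecMean W n c r +
      n / r * scMean W n c r) r := by
  have hr' := Ioo_subset_Ico_self hr
  refine (hasDerivAt_angularMean hW.contDiffOn_vec (continuous_imL_exp n c) hr).congr_deriv ?_
  have hu := continuous_comp_circle hW.contDiffOn_vec.continuousOn hr'
  have hv := continuous_fderiv_comp_circle hW.contDiffOn_sc hr'
  have hc := continuous_imL_exp n c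
  have parts := integral_fderiv_rotate hW.contDiffOn_sc (hasDerivAt_imL_exp n c)
    (by fun_prop) (by rw [exp_neg_pi_mul_I]) hr
  simp only [(hW.polar h hr _).2, sub_mul, mul_assoc]
  rw [intervalIntegral.integral_sub (Continuous.intervalIntegrable (by fun_prop) _ _)
    (Continuous.intervalIntegrable (by fun_prop) _ _), intervalIntegral.integral_const_mul,
    sub_eq_add_neg]
  congr 1
  have hrc : (r : ℂ) ≠ 0 := by exact_mod_cast hr.1.ne'
  rw [div_mul_eq_mul_div, eq_div_iff hrc, neg_mul, mul_comm, parts, angularMean_const_mul, scMean]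
  ring

end PolarSystem

/-! ### Fourier coefficients of an arbitrary solution. -/

section Completeness

open Bicomplex
open Complex (exp I)
open scoped ComplexConjugate

variable {ρ : ℝ} {q f : ℝ → ℂ} {W : ℂ → Bicomplex} {C C' : ℝ} {Φ dΦ Ψ dΨ : ℕ → ℝ → ℂ}

/-- A solution of the radial system that vanishes at one point vanishes. -/
theorem IsRadialCoefficient.radial_system_eq_zero (h : IsRadialCoefficient ρ q f) {n : ℕ}
    {a b : ℝ → ℂ}
    (ha : ∀ r ∈ Ioo 0 ρ, HasDerivAt a (derivWithin f (Icc 0 ρ) r / f r * a r + n / r * b r) r)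
    (hb : ∀ r ∈ Ioo 0 ρ, HasDerivAt b (-(derivWithin f (Icc 0 ρ) r / f r) * b r + n / r * a r) r)
    {r₀ : ℝ} (hr₀ : r₀ ∈ Ioo 0 ρ) (ha₀ : a r₀ = 0) (hb₀ : b r₀ = 0) {r : ℝ} (hr : r ∈ Ioo 0 ρ) :
    a r = 0 ∧ b r = 0 := by
  have hne : ∀ s ∈ Ioo 0 ρ, f s ≠ 0 := fun s hs => h.ne_zero s (Ioo_subset_Icc_self hs)
  have hrc : ∀ s ∈ Ioo 0 ρ, (s : ℂ) ≠ 0 := fun s hs => by exact_mod_cast hs.1.ne'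
  have hfc : ContinuousOn f (Ioo 0 ρ) := h.contDiffOn.continuousOn.mono Ioo_subset_Icc_self
  -- Dividing a and multiplying b by f removes the diagonal terms of the system.
  have key := linear_system_eq_zero (a := fun s => a s / f s) (b := fun s => f s * b s)
    (α := fun s => n / s / f s ^ 2) (β := fun s => n / s * f s ^ 2) (l := 0) (u := ρ)
    (ContinuousOn.div (continuousOn_const.div (by fun_prop) hrc) (hfc.pow 2)
      fun s hs => pow_ne_zero 2 (hne s hs))
    ((continuousOn_const.div (by fun_prop) hrc).mul (hfc.pow 2))
    (fun s hs => ((ha s hs).div (h.hasDerivAt hs) (hne s hs)).congr_deriv (by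
      have := hne s hs; have := hrc s hs; field_simp; ring))
    (fun s hs => ((h.hasDerivAt hs).mul (hb s hs)).congr_deriv (by
      have := hne s hs; have := hrc s hs; field_simp; ring))
    hr₀ (by simp [ha₀]) (by simp [hb₀]) hr
  exact ⟨(div_eq_zero_iff.1 key.1).resolve_right (hne r hr),
    (mul_eq_zero.1 key.2).resolve_left (hne r hr)⟩

/-- The factor rⁿ absorbs the diagonal terms -nφ/r and -nψ/r of the Darboux system, so these
functions obey the same system as the Fourier coefficients of a solution. -/
theorem IsRadialCoefficient.hasDerivAt_pow_mul (h : IsRadialCoefficient ρ q f)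
    (hΦ : IsRadialFamily q ρ C Φ dΦ) (hΨ : IsRadialFamily (darbouxPotential f q ρ) ρ C' Ψ dΨ)
    (n : ℕ) {r : ℝ} (hr : r ∈ Ioo 0 ρ) :
    HasDerivAt (fun r : ℝ => (r : ℂ) ^ n * Φ n r) (derivWithin f (Icc 0 ρ) r / f r *
      ((r : ℂ) ^ n * Φ n r) + n / r * ((r : ℂ) ^ n * Ψ n r)) r ∧
    HasDerivAt (fun r : ℝ => (r : ℂ) ^ n * Ψ n r) (-(derivWithin f (Icc 0 ρ) r / f r) *
      ((r : ℂ) ^ n * Ψ n r) + n / r * ((r : ℂ) ^ n * Φ n r)) r := by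
  have hrc : (r : ℂ) ≠ 0 := by exact_mod_cast hr.1.ne'
  have hp : HasDerivAt (fun r : ℝ => (r : ℂ) ^ n) (n / r * (r : ℂ) ^ n) r := by
    have h1 := (Complex.ofRealCLM.hasDerivAt (x := r)).pow n
    refine h1.congr_deriv ?_
    rcases n with _ | k
    · simp
    · simp only [Nat.add_sub_cancel, Complex.ofRealCLM_apply, Complex.ofReal_one, mul_one]
      field_simp
      ring
  obtain ⟨s1, s2⟩ := h.system hΦ hΨ (n := n) hr
  constructor
  · refine (hp.mul (hΦ.hasDerivAt n r)).congr_deriv ?_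
    have : dΦ n r = derivWithin f (Icc 0 ρ) r / f r * Φ n r + n * (Ψ n r - Φ n r) / r := by
      rw [← s1, mul_div_cancel_left₀ _ hrc]; ring
    rw [this]; field_simp; ring
  · refine (hp.mul (hΨ.hasDerivAt n r)).congr_deriv ?_
    have : dΨ n r = -(derivWithin f (Icc 0 ρ) r / f r) * Ψ n r + n * (Φ n r - Ψ n r) / r := by
      rw [← s2, mul_div_cancel_left₀ _ hrc]; ring
    rw [this]; field_simp; ring

theorem exists_mem_Ioo_ne_zero (hρ : 0 < ρ) {φ : ℝ → ℂ} (hφ : Continuous φ) (h1 : φ 0 = 1) :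
    ∃ r ∈ Ioo 0 ρ, φ r ≠ 0 := by
  have h2 : ∀ᶠ r in 𝓝[>] (0 : ℝ), φ r ≠ 0 :=
    (hφ.continuousAt.eventually_ne (by rw [h1]; exact one_ne_zero)).filter_mono nhdsWithin_le_nhds
  obtain ⟨r, hr, hr'⟩ := (h2.and (Ioo_mem_nhdsGT hρ)).exists
  exact ⟨r, hr', hr⟩

/-- The Fourier coefficients of positive degree of a solution are multiples of those of a radial
power. -/
theorem IsVekuaSolution.exists_means_eq (h : IsRadialCoefficient ρ q f)
    (hΦ : IsRadialFamily q ρ C Φ dΦ) (hΨ : IsRadialFamily (darbouxPotential f q ρ) ρ C' Ψ dΨ)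
    (hW : IsVekuaSolution f ρ W) {n : ℕ} (hn : 1 ≤ n) (c : ℂ) :
    ∃ κ : ℂ, ∀ r ∈ Ioo 0 ρ, scMean W n c r = κ * ((r : ℂ) ^ n * Φ n r) ∧
      vecMean W n c r = κ * ((r : ℂ) ^ n * Ψ n r) := by
  let A : ℝ → ℂ := fun r => (r : ℂ) ^ n * Φ n r
  let B : ℝ → ℂ := fun r => (r : ℂ) ^ n * Ψ n r
  let a := scMean W n c
  let b := vecMean W n c
  have hA := fun r (hr : r ∈ Ioo 0 ρ) => (h.hasDerivAt_pow_mul hΦ hΨ n hr).1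
  have hB := fun r (hr : r ∈ Ioo 0 ρ) => (h.hasDerivAt_pow_mul hΦ hΨ n hr).2
  have ha := fun r (hr : r ∈ Ioo 0 ρ) => hW.hasDerivAt_scMean h n c hr
  have hb := fun r (hr : r ∈ Ioo 0 ρ) => hW.hasDerivAt_vecMean h n c hr
  have hD : ∀ r ∈ Ioo 0 ρ, HasDerivAt (fun r => a r * B r - b r * A r) 0 r := fun r hr => by
    refine (((ha r hr).mul (hB r hr)).sub ((hb r hr).mul (hA r hr))).congr_deriv ?_
    ring
  -- The determinant of two solutions is constant. Here a and b stay bounded while A and B contain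
  -- rⁿ with n ≥ 1, so the constant is 0 and the two solutions are proportional.
  have hlim : Tendsto (fun r => a r * B r - b r * A r) (𝓝[>] 0) (𝓝 0) := by
    obtain ⟨M, hM⟩ := exists_norm_angularMean_le hW.contDiffOn_sc.continuousOn
      (continuous_reL_exp n c) (half_lt_self h.pos)
    obtain ⟨N, hN⟩ := exists_norm_angularMean_le hW.contDiffOn_vec.continuousOn
      (continuous_imL_exp n c) (half_lt_self h.pos)
    have hev : ∀ᶠ r in 𝓝[>] (0 : ℝ), r ∈ Icc 0 (ρ / 2) := by
      filter_upwards [Ioo_mem_nhdsGT (half_pos h.pos)] with r hr using Ioo_subset_Icc_self hr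
    have hA0 : Tendsto A (𝓝[>] 0) (𝓝 0) := by
      have hc : Continuous A := (by fun_prop : Continuous fun r : ℝ => (r : ℂ) ^ n).mul
        (hΦ.continuous n)
      have := hc.tendsto 0
      simp only [A, Complex.ofReal_zero, zero_pow (by omega : n ≠ 0), zero_mul] at this
      exact this.mono_left nhdsWithin_le_nhds
    have hB0 : Tendsto B (𝓝[>] 0) (𝓝 0) := by
      have hc : Continuous B := (by fun_prop : Continuous fun r : ℝ => (r : ℂ) ^ n).mul
        (hΨ.continuous n)
      have := hc.tendsto 0
      simp only [B, Complex.ofReal_zero, zero_pow (by omega : n ≠ 0), zero_mul] at this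
      exact this.mono_left nhdsWithin_le_nhds
    have t1 := isBoundedUnder_le_mul_tendsto_zero (f := a)
      (isBoundedUnder_of_eventually_le (hev.mono fun r hr => hM r hr)) hB0
    have t2 := isBoundedUnder_le_mul_tendsto_zero (f := b)
      (isBoundedUnder_of_eventually_le (hev.mono fun r hr => hN r hr)) hA0
    simpa using t1.sub t2
  have hD0 : ∀ r ∈ Ioo 0 ρ, a r * B r = b r * A r := fun r hr => by
    refine sub_eq_zero.1 (tendsto_nhds_unique (tendsto_const_nhds.congr' ?_) hlim)
    filter_upwards [Ioo_mem_nhdsGT h.pos] with s hs using eq_of_hasDerivAt_eq_zero_Ioo hD hr hs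
  obtain ⟨r₀, hr₀, hne⟩ := exists_mem_Ioo_ne_zero h.pos (hΦ.continuous n) (hΦ.apply_zero n)
  have hA₀ : A r₀ ≠ 0 := mul_ne_zero (pow_ne_zero n (by exact_mod_cast hr₀.1.ne')) hne
  refine ⟨a r₀ / A r₀, fun r hr => ?_⟩
  -- At `r₀` the first component vanishes by the choice of the factor and the second by the
  -- vanishing determinant.
  have key := h.radial_system_eq_zero (n := n) (a := fun r => a r - a r₀ / A r₀ * A r)
    (b := fun r => b r - a r₀ / A r₀ * B r)
    (fun r hr => ((ha r hr).sub ((hA r hr).const_mul (a r₀ / A r₀))).congr_deriv (by ring))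
    (fun r hr => ((hb r hr).sub ((hB r hr).const_mul (a r₀ / A r₀))).congr_deriv (by ring))
    hr₀ (by field_simp; ring) (by have := hD0 r₀ hr₀; field_simp; rw [this]; ring) hr
  exact ⟨sub_eq_zero.1 key.1, sub_eq_zero.1 key.2⟩

/-- The Fourier coefficients of degree zero of a solution. -/
theorem IsVekuaSolution.exists_means_zero_eq (h : IsRadialCoefficient ρ q f)
    (hΦ : IsRadialFamily q ρ C Φ dΦ) (hΨ : IsRadialFamily (darbouxPotential f q ρ) ρ C' Ψ dΨ)
    (hW : IsVekuaSolution f ρ W) (c : ℂ) :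
    ∃ κ κ' : ℂ, ∀ r ∈ Ioo 0 ρ, scMean W 0 c r = κ * Φ 0 r ∧ vecMean W 0 c r = κ' * Ψ 0 r := by
  have hρ2 : ρ / 2 ∈ Ioo 0 ρ := ⟨half_pos h.pos, half_lt_self h.pos⟩
  -- In degree zero the system decouples: a/f and f b are constant, so their values at any one
  -- radius are the two factors.
  refine ⟨scMean W 0 c (ρ / 2) / f (ρ / 2), f (ρ / 2) * vecMean W 0 c (ρ / 2), fun r hr => ?_⟩
  have hne : ∀ s ∈ Ioo 0 ρ, f s ≠ 0 := fun s hs => h.ne_zero s (Ioo_subset_Icc_self hs)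
  have e1 := eq_of_hasDerivAt_eq_zero_Ioo (f := fun s => scMean W 0 c s / f s)
    (fun s hs => ((hW.hasDerivAt_scMean h 0 c hs).div (h.hasDerivAt hs) (hne s hs)).congr_deriv
      (by have := hne s hs; simp; field_simp; simp)) hr hρ2
  have e2 := eq_of_hasDerivAt_eq_zero_Ioo (f := fun s => f s * vecMean W 0 c s)
    (fun s hs => ((h.hasDerivAt hs).mul (hW.hasDerivAt_vecMean h 0 c hs)).congr_deriv
      (by have := hne s hs; simp; field_simp; simp)) hr hρ2
  have := hne r hr
  rw [h.family_zero hΦ (Ioo_subset_Icc_self hr), h.darboux_family_zero hΨ (Ioo_subset_Icc_self hr),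
    ← e1, ← e2]
  constructor <;> field_simp

/-- The inner product over a smaller disk of a function with a radial power. -/
theorem integral_pairing_radialPower {q' : ℝ → ℂ} (hW : ContinuousOn W (Metric.ball 0 ρ))
    (hΦ : IsRadialFamily q ρ C Φ dΦ) (hΨ : IsRadialFamily q' ρ C' Ψ dΨ) (n : ℕ) (c : ℂ) {s : ℝ}
    (hs : s ∈ Ioo 0 ρ) :
    ∫ z in Metric.ball (0 : ℂ) s, pairing (W z) (radialPower (Φ n) (Ψ n) n c z) =
      ∫ r in (0 : ℝ)..s, (r : ℂ) * (scMean W n c r * conj ((r : ℂ) ^ n * Φ n r) +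
        vecMean W n c r * conj ((r : ℂ) ^ n * Ψ n r)) := by
  have hc : ContinuousOn (fun z => pairing (W z) (radialPower (Φ n) (Ψ n) n c z))
      (Metric.closedBall 0 s) := by
    simp only [pairing_eq_inner]
    exact (continuous_radialPower hΦ hΨ n c).continuousOn.inner
      (hW.mono (Metric.closedBall_subset_ball hs.2))
  rw [integral_ball_eq_polar hs.1 hc]
  refine intervalIntegral.integral_congr fun r hr => ?_
  rw [uIcc_of_le hs.1.le] at hr
  have hr' : r ∈ Ico 0 ρ := ⟨hr.1, hr.2.trans_lt hs.2⟩
  have h1 := continuous_comp_circle (scL.continuous.comp_continuousOn hW) hr'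
  have h2 := continuous_comp_circle (vecL.continuous.comp_continuousOn hW) hr'
  have h1' : Continuous fun θ : ℝ => (W (r * exp (θ * I))).sc := h1
  have h2' : Continuous fun θ : ℝ => (W (r * exp (θ * I))).vec := h2
  have e : ∀ θ : ℝ, pairing (W (r * exp (θ * I))) (radialPower (Φ n) (Ψ n) n c (r * exp (θ * I))) =
      (W (r * exp (θ * I))).sc * reL (c * exp (θ * I) ^ n) * conj ((r : ℂ) ^ n * Φ n r) +
      (W (r * exp (θ * I))).vec * imL (c * exp (θ * I) ^ n) * conj ((r : ℂ) ^ n * Ψ n r) :=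
    fun θ => by
    rw [pairing_eq]
    simp only [radialPower, sc_ofParts, vec_ofParts, norm_ofReal_mul_exp hr.1, reL_mul_polar,
      imL_mul_polar, map_mul, conj_reL, conj_imL, map_pow, Complex.conj_ofReal]
    ring
  simp only [e]
  rw [intervalIntegral.integral_add (Continuous.intervalIntegrable (by fun_prop) _ _)
    (Continuous.intervalIntegrable (by fun_prop) _ _), intervalIntegral.integral_mul_const,
    intervalIntegral.integral_mul_const]
  rfl

end Completeness

/-! ### Solutions orthogonal to all radial powers vanish. -/

section Completeness

open Bicomplex
open Complex (exp I)
open scoped ComplexConjugate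

variable {ρ : ℝ} {q q' f : ℝ → ℂ} {W : ℂ → Bicomplex} {C C' : ℝ} {Φ dΦ Ψ dΨ : ℕ → ℝ → ℂ}

theorem IsRadialFamily.weightedNormSq_phi (hρ : 0 < ρ) (hΦ : IsRadialFamily q ρ C Φ dΦ)
    (n k : ℕ) : weightedNormSq ρ k (phi q ρ n) = ∫ r in (0 : ℝ)..ρ, ‖Φ n r‖ ^ 2 * r ^ k := by
  refine intervalIntegral.integral_congr_ae (Eventually.of_forall fun r hr => ?_)
  rw [uIoc_of_le hρ.le] at hr
  rw [hΦ.phi_eq n r hr]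

/-- The continuous function φ^{(n)} equals 1 at 0, so it is nonzero somewhere in the open interval.
-/
theorem IsRadialFamily.weightedNormSq_pos (hρ : 0 < ρ) (hΦ : IsRadialFamily q ρ C Φ dΦ)
    (n k : ℕ) : 0 < weightedNormSq ρ k (phi q ρ n) := by
  rw [hΦ.weightedNormSq_phi hρ]
  have hc := hΦ.continuous n
  obtain ⟨r, hr, hne⟩ := exists_mem_Ioo_ne_zero hρ hc (hΦ.apply_zero n)
  refine intervalIntegral.integral_pos hρ (by fun_prop)
    (fun r hr => mul_nonneg (sq_nonneg _) (pow_nonneg hr.1.le _))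
    ⟨r, Ioo_subset_Icc_self hr, ?_⟩
  have := norm_pos_iff.2 hne
  have := hr.1
  positivity

theorem integral_of_means_eq (hρ : 0 < ρ) (hW : ContinuousOn W (Metric.ball 0 ρ))
    (hΦ : IsRadialFamily q ρ C Φ dΦ) (hΨ : IsRadialFamily q' ρ C' Ψ dΨ) {n : ℕ} {c κ κ' : ℂ}
    (hint : Integrable (fun z => pairing (W z) (radialPower (Φ n) (Ψ n) n c z)) (diskMeasure ρ))
    (hm : ∀ r ∈ Ioo 0 ρ, scMean W n c r = κ * ((r : ℂ) ^ n * Φ n r) ∧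
      vecMean W n c r = κ' * ((r : ℂ) ^ n * Ψ n r)) :
    l2Inner ρ W (radialPower (Φ n) (Ψ n) n c) =
      κ * (weightedNormSq ρ (2 * n + 1) (phi q ρ n) : ℝ) +
        κ' * (weightedNormSq ρ (2 * n + 1) (phi q' ρ n) : ℝ) := by
  have h1 := hΦ.continuous n
  have h2 := hΨ.continuous n
  let g : ℝ → ℂ := fun r => κ * ((r : ℂ) ^ (2 * n + 1) * (Φ n r * conj (Φ n r))) +
    κ' * ((r : ℂ) ^ (2 * n + 1) * (Ψ n r * conj (Ψ n r)))
  have hg : Continuous g := by fun_prop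
  -- `W` need not extend continuously to the boundary, so polar coordinates are used on smaller
  -- disks and integrability of the pairing gives the limit.
  obtain ⟨s, hs, hsm, hst⟩ := exists_seq_strictMono_tendsto' hρ
  have hU : ⋃ k, Metric.ball (0 : ℂ) (s k) = Metric.ball 0 ρ := by
    refine subset_antisymm (iUnion_subset fun k => Metric.ball_subset_ball (hsm k).2.le)
      fun z hz => ?_
    obtain ⟨k, hk⟩ := (hst.eventually (lt_mem_nhds (mem_ball_zero_iff.1 hz))).exists
    exact mem_iUnion.2 ⟨k, mem_ball_zero_iff.2 hk⟩
  have t1 := tendsto_setIntegral_of_monotone (μ := volume) (fun _ => measurableSet_ball)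
    (fun i j hij => Metric.ball_subset_ball (hs.monotone hij)) (s := fun k => Metric.ball (0 : ℂ) (s k))
    (f := fun z => pairing (W z) (radialPower (Φ n) (Ψ n) n c z)) (by rw [hU]; exact hint)
  rw [hU] at t1
  have t2 : Tendsto (fun k => ∫ r in (0 : ℝ)..s k, g r) atTop (𝓝 (∫ r in (0 : ℝ)..ρ, g r)) :=
    ((intervalIntegral.continuous_primitive (fun a b => hg.intervalIntegrable a b) 0).tendsto
      ρ).comp hst
  have e : ∀ k, ∫ z in Metric.ball (0 : ℂ) (s k), pairing (W z) (radialPower (Φ n) (Ψ n) n c z) =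
      ∫ r in (0 : ℝ)..s k, g r := fun k => by
    rw [integral_pairing_radialPower hW hΦ hΨ n c (hsm k)]
    refine intervalIntegral.integral_congr_ae (Eventually.of_forall fun r hr => ?_)
    rw [uIoc_of_le (hsm k).1.le] at hr
    obtain ⟨e1, e2⟩ := hm r ⟨hr.1, hr.2.trans_lt (hsm k).2⟩
    rw [e1, e2]
    simp only [g, map_mul, map_pow, Complex.conj_ofReal]
    ring
  simp only [e] at t1
  rw [l2Inner, tendsto_nhds_unique t1 t2, hΦ.weightedNormSq_eq hρ, hΨ.weightedNormSq_eq hρ,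
    intervalIntegral.integral_add (Continuous.intervalIntegrable (by fun_prop) _ _)
      (Continuous.intervalIntegrable (by fun_prop) _ _), intervalIntegral.integral_const_mul,
    intervalIntegral.integral_const_mul]

theorem integrable_pairing {F G : ℂ → Bicomplex} (hF : MemLp F 2 (diskMeasure ρ))
    (hG : MemLp G 2 (diskMeasure ρ)) :
    Integrable (fun z => pairing (F z) (G z)) (diskMeasure ρ) := by
  refine (L2.integrable_inner (𝕜 := ℂ) (hG.toLp G) (hF.toLp F)).congr ?_
  filter_upwards [hF.coeFn_toLp, hG.coeFn_toLp] with z h1 h2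
  rw [h1, h2, pairing_eq_inner]

theorem IsVekuaSolution.means_eq_zero (h : IsRadialCoefficient ρ q f)
    (hΦ : IsRadialFamily q ρ C Φ dΦ) (hΨ : IsRadialFamily (darbouxPotential f q ρ) ρ C' Ψ dΨ)
    (hW : IsVekuaSolution f ρ W) (hW2 : MemLp W 2 (diskMeasure ρ)) {n : ℕ} {c : ℂ}
    (hc : c = 1 ∨ c = I) (horth : l2Inner ρ W (radialPower (Φ n) (Ψ n) n c) = 0) {r : ℝ}
    (hr : r ∈ Ioo 0 ρ) : scMean W n c r = 0 ∧ vecMean W n c r = 0 := by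
  have hint := integrable_pairing hW2 (memLp_of_continuous (ρ := ρ) (continuous_radialPower hΦ hΨ n c))
  have hN := hΦ.weightedNormSq_pos h.pos n (2 * n + 1)
  have hN' := hΨ.weightedNormSq_pos h.pos n (2 * n + 1)
  have hNc := Complex.ofReal_ne_zero.2 hN.ne'
  have hNc' := Complex.ofReal_ne_zero.2 hN'.ne'
  rcases Nat.eq_zero_or_pos n with rfl | hn
  · obtain ⟨κ, κ', hm⟩ := hW.exists_means_zero_eq h hΦ hΨ c
    rcases hc with rfl | rfl
    · have hv : ∀ r, vecMean W 0 1 r = 0 := fun r => by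
        simp [vecMean, angularMean, imL_apply]
      -- For n = 0 and c = 1 the vectorial mean vanishes because Im 1 = 0, so its factor may be
      -- taken to be 0 and one relation determines the other factor.
      rw [integral_of_means_eq h.pos hW.1.continuousOn hΦ hΨ (κ := κ) (κ' := 0) hint
        fun r hr => ⟨by simpa using (hm r hr).1, by simp [hv]⟩, zero_mul, add_zero] at horth
      rw [(hm r hr).1, (mul_eq_zero.1 horth).resolve_right hNc, hv, zero_mul]
      exact ⟨rfl, rfl⟩
    · have hv : ∀ r, scMean W 0 I r = 0 := fun r => by
        simp [scMean, angularMean, reL_apply]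
      rw [integral_of_means_eq h.pos hW.1.continuousOn hΦ hΨ (κ := 0) (κ' := κ') hint
        fun r hr => ⟨by simp [hv], by simpa using (hm r hr).2⟩, zero_mul, zero_add] at horth
      rw [(hm r hr).2, (mul_eq_zero.1 horth).resolve_right hNc', hv, zero_mul]
      exact ⟨rfl, rfl⟩
  · obtain ⟨κ, hm⟩ := hW.exists_means_eq h hΦ hΨ hn c
    rw [integral_of_means_eq h.pos hW.1.continuousOn hΦ hΨ hint hm, ← mul_add] at horth
    -- In positive degree both components share one factor, so a single orthogonality relation, with
    -- a sum of two positive norms, kills both.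
    have : κ = 0 := (mul_eq_zero.1 horth).resolve_right (by exact_mod_cast (add_pos hN hN').ne')
    rw [(hm r hr).1, (hm r hr).2, this, zero_mul, zero_mul]
    exact ⟨rfl, rfl⟩

theorem eq_zero_of_angularMean_eq_zero {u : ℂ → ℂ} (hu : ContinuousOn u (Metric.ball 0 ρ)) {r : ℝ}
    (hr : r ∈ Ico 0 ρ) (h1 : ∀ n : ℕ, angularMean u (fun θ => reL (exp (θ * I) ^ n)) r = 0)
    (h2 : ∀ n : ℕ, angularMean u (fun θ => imL (exp (θ * I) ^ n)) r = 0) (θ : ℝ) :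
    u (r * exp (θ * I)) = 0 := by
  refine eq_zero_of_integral_exp_eq_zero (h := fun w => u (r * w)) ?_ (fun k => ?_) θ
  · refine hu.comp_continuous (by fun_prop) fun w => ?_
    rw [mem_ball_zero_iff, norm_mul, Circle.norm_coe, mul_one, Complex.norm_real,
      Real.norm_eq_abs, abs_of_nonneg hr.1]
    exact hr.2
  have hc := continuous_comp_circle hu hr
  have key : ∀ (n : ℕ) (a : ℂ), ∫ θ in (-Real.pi)..Real.pi, (reL (exp (θ * I) ^ n) +
      a * imL (exp (θ * I) ^ n)) * u (r * exp (θ * I)) = 0 := fun n a => by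
    have e : ∀ θ : ℝ, (reL (exp (θ * I) ^ n) + a * imL (exp (θ * I) ^ n)) * u (r * exp (θ * I)) =
        u (r * exp (θ * I)) * reL (exp (θ * I) ^ n) +
          a * (u (r * exp (θ * I)) * imL (exp (θ * I) ^ n)) := fun θ => by ring
    simp only [e]
    have c1 : Continuous fun θ : ℝ => u (r * exp (θ * I)) * reL (exp (θ * I) ^ n) :=
      hc.mul (by fun_prop)
    have c2 : Continuous fun θ : ℝ => a * (u (r * exp (θ * I)) * imL (exp (θ * I) ^ n)) :=
      continuous_const.mul (hc.mul (by fun_prop))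
    rw [intervalIntegral.integral_add (c1.intervalIntegrable _ _) (c2.intervalIntegrable _ _),
      intervalIntegral.integral_const_mul]
    have e1 := h1 n
    have e2 := h2 n
    rw [angularMean] at e1 e2
    rw [e1, e2, mul_zero, add_zero]
  have hz : ∀ z : ℂ, reL z + I * imL z = z := fun z => by
    rw [reL_apply, imL_apply, mul_comm, Complex.re_add_im]
  have hz' : ∀ z : ℂ, reL z + -I * imL z = conj z := fun z => by
    rw [← hz (conj z)]; simp [reL_apply, imL_apply]
  obtain ⟨n, rfl | rfl⟩ := k.eq_nat_or_neg
  · rw [← key n I]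
    refine intervalIntegral.integral_congr fun θ _ => ?_
    rw [hz, ← Complex.exp_nat_mul]
    push_cast
    rfl
  · rw [← key n (-I)]
    refine intervalIntegral.integral_congr fun θ _ => ?_
    rw [hz', ← Complex.exp_nat_mul, ← Complex.exp_conj]
    simp

/-- A square integrable solution that is orthogonal to the radial powers vanishes. -/
theorem IsVekuaSolution.eq_zero_of_orthogonal (h : IsRadialCoefficient ρ q f)
    (hΦ : IsRadialFamily q ρ C Φ dΦ) (hΨ : IsRadialFamily (darbouxPotential f q ρ) ρ C' Ψ dΨ)
    (hW : IsVekuaSolution f ρ W) (hW2 : MemLp W 2 (diskMeasure ρ))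
    (horth : ∀ (n : ℕ) (c : ℂ), c = 1 ∨ c = I → l2Inner ρ W (radialPower (Φ n) (Ψ n) n c) = 0) :
    W =ᵐ[diskMeasure ρ] 0 := by
  have hm : ∀ (n : ℕ) (c : ℂ), c = 1 ∨ c = I → ∀ r ∈ Ioo 0 ρ, scMean W n c r = 0 ∧
      vecMean W n c r = 0 := fun n c hc r hr =>
    hW.means_eq_zero h hΦ hΨ hW2 hc (horth n c hc) hr
  -- Up to sign, c = i exchanges Re and Im, so c = 1 and c = i together test each component against
  -- all cosines and sines.
  have i1 : ∀ z : ℂ, reL (I * z) = -imL z := fun z => by simp [reL_apply, imL_apply]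
  have i2 : ∀ z : ℂ, imL (I * z) = reL z := fun z => by simp [reL_apply, imL_apply]
  have hne : ∀ᵐ z ∂diskMeasure ρ, z ≠ 0 := by
    refine ae_restrict_of_ae ?_
    exact compl_mem_ae_iff.2 (measure_singleton 0)
  filter_upwards [hne, ae_restrict_mem measurableSet_ball] with z hz0 hz
  have hr : ‖z‖ ∈ Ioo 0 ρ := ⟨norm_pos_iff.2 hz0, mem_ball_zero_iff.1 hz⟩
  have hr' := Ioo_subset_Ico_self hr
  rw [← Complex.norm_mul_exp_arg_mul_I z]
  have neg : ∀ (u : ℂ → ℂ) (g : ℝ → ℂ) (s : ℝ), angularMean u (fun θ => -g θ) s =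
      -angularMean u g s := fun u g s => by
    simpa using angularMean_const_mul u g (-1) s
  apply ext'
  · refine eq_zero_of_angularMean_eq_zero hW.contDiffOn_sc.continuousOn hr' (fun n => ?_)
      (fun n => ?_) _
    · simpa [scMean] using (hm n 1 (Or.inl rfl) _ hr).1
    · have := (hm n I (Or.inr rfl) _ hr).1
      simp only [scMean, i1, neg, neg_eq_zero] at this
      exact this
  · refine eq_zero_of_angularMean_eq_zero hW.contDiffOn_vec.continuousOn hr' (fun n => ?_)
      (fun n => ?_) _
    · have := (hm n I (Or.inr rfl) _ hr).2
      simp only [vecMean, i2] at this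
      exact this
    · simpa [vecMean] using (hm n 1 (Or.inl rfl) _ hr).2

end Completeness

/-! ### Locally uniform convergence of series of radial powers. -/

section Series

open Bicomplex
open Complex (exp I)

variable {ρ : ℝ} {q q' f : ℝ → ℂ} {C C' : ℝ} {Φ dΦ Ψ dΨ : ℕ → ℝ → ℂ}

theorem IsVekuaSolution.const_smul {W : ℂ → Bicomplex} (hW : IsVekuaSolution f ρ W) (c : ℂ) :
    IsVekuaSolution f ρ (c • W) := by
  refine ⟨hW.1.const_smul c, fun z hz => ?_⟩
  rw [dbar_smul c ((hW.1.differentiableOn one_ne_zero).differentiableAt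
    (Metric.isOpen_ball.mem_nhds hz)), hW.2 z hz, Pi.smul_apply, bar_smul, mul_smul', smul_comm]

theorem summable_of_norm_le_of_mem_ball {ι : Type*} {w : ι → ℂ → Bicomplex}
    (hb : ∀ s ∈ Ioo 0 ρ, ∃ u : ι → ℝ, Summable u ∧
      ∀ i, ∀ z ∈ Metric.ball (0 : ℂ) s, ‖w i z‖ ≤ u i ∧ ‖fderiv ℝ (w i) z‖ ≤ u i)
    {z : ℂ} (hz : z ∈ Metric.ball (0 : ℂ) ρ) :
    Summable (fun i => w i z) ∧ Summable (fun i => fderiv ℝ (w i) z) := by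
  obtain ⟨s, hs, hs'⟩ := exists_between (mem_ball_zero_iff.1 hz)
  obtain ⟨u, hu, hw⟩ := hb s ⟨(norm_nonneg z).trans_lt hs, hs'⟩
  have hz' := mem_ball_zero_iff.2 hs
  exact ⟨.of_norm_bounded hu fun i => (hw i z hz').1, .of_norm_bounded hu fun i => (hw i z hz').2⟩

/-- A series of solutions that converges locally uniformly with its derivatives is a solution. -/
theorem IsVekuaSolution.tsum {ι : Type*} {w : ι → ℂ → Bicomplex} (h : IsRadialCoefficient ρ q f)
    (hw : ∀ i, IsVekuaSolution f ρ (w i))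
    (hb : ∀ s ∈ Ioo 0 ρ, ∃ u : ι → ℝ, Summable u ∧
      ∀ i, ∀ z ∈ Metric.ball (0 : ℂ) s, ‖w i z‖ ≤ u i ∧ ‖fderiv ℝ (w i) z‖ ≤ u i) :
    IsVekuaSolution f ρ fun z => ∑' i, w i z := by
  have hdiff : ∀ i, ∀ z ∈ Metric.ball (0 : ℂ) ρ, DifferentiableAt ℝ (w i) z := fun i z hz =>
    ((hw i).1.differentiableOn one_ne_zero).differentiableAt (Metric.isOpen_ball.mem_nhds hz)
  have hloc : ∀ z ∈ Metric.ball (0 : ℂ) ρ,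
      HasFDerivAt (fun z => ∑' i, w i z) (∑' i, fderiv ℝ (w i) z) z ∧
      ContinuousAt (fun z => ∑' i, fderiv ℝ (w i) z) z := fun z hz => by
    obtain ⟨s, hs, hs'⟩ := exists_between (mem_ball_zero_iff.1 hz)
    have hz' := mem_ball_zero_iff.2 hs
    have hsub := Metric.ball_subset_ball (x := (0 : ℂ)) hs'.le
    obtain ⟨u, hu, hwu⟩ := hb s ⟨(norm_nonneg z).trans_lt hs, hs'⟩
    refine ⟨hasFDerivAt_tsum_of_isPreconnected hu Metric.isOpen_ball
      (convex_ball (0 : ℂ) s).isPreconnected (fun i x hx => (hdiff i x (hsub hx)).hasFDerivAt)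
      (fun i x hx => (hwu i x hx).2) hz' (summable_of_norm_le_of_mem_ball hb hz).1 hz', ?_⟩
    refine (continuousOn_tsum (fun i => ?_) hu fun i x hx => (hwu i x hx).2).continuousAt
      (Metric.isOpen_ball.mem_nhds hz')
    exact ((hw i).1.continuousOn_fderiv_of_isOpen Metric.isOpen_ball le_rfl).mono hsub
  refine ⟨contDiffOn_one_of_hasFDerivAt Metric.isOpen_ball (fun z hz => (hloc z hz).1)
    fun z hz => (hloc z hz).2.continuousWithinAt, fun z hz => ?_⟩
  have hF := (h.hasFDerivAt_norm hz).differentiableAt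
  obtain ⟨s1, s2⟩ := summable_of_norm_le_of_mem_ball hb hz
  have hV := (hloc z hz).1
  have h0 := s1.hasSum
  have hd : ∀ v, HasSum (fun i => fderiv ℝ (w i) z v) (fderiv ℝ (fun z => ∑' i, w i z) z v) :=
    fun v => by
    rw [hV.fderiv]
    exact (ContinuousLinearMap.apply ℝ Bicomplex v).hasSum s2.hasSum
  have hi := fun i => (vekua_iff hF (hdiff i z hz)).1 ((hw i).2 z hz)
  refine (vekua_iff hF hV.differentiableAt).2 ?_
  simp only [fderiv_sc hV.differentiableAt, fderiv_vec hV.differentiableAt]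
  simp only [fderiv_sc (hdiff _ z hz), fderiv_vec (hdiff _ z hz)] at hi
  constructor
  · refine (((scL.hasSum (hd 1)).sub (vecL.hasSum (hd I))).congr_fun ?_).unique
      ((((scL.hasSum h0).mul_left _).add ((vecL.hasSum h0).mul_left _)).mul_left _)
    exact fun i => (hi i).1.symm
  · refine (((vecL.hasSum (hd 1)).add (scL.hasSum (hd I))).congr_fun ?_).unique
      ((((scL.hasSum h0).mul_left _).sub ((vecL.hasSum h0).mul_left _)).mul_left _)
    exact fun i => (hi i).2.symm

theorem norm_radialTermFDeriv_le {T : ℂ →L[ℝ] ℂ} (hT : ∀ z, ‖T z‖ ≤ ‖z‖) (φ d : ℝ → ℂ) (n : ℕ)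
    (c z : ℂ) : ‖radialTermFDeriv T φ d n c z‖ ≤
      ‖φ ‖z‖‖ * (‖c‖ * (n * ‖z‖ ^ (n - 1))) + ‖c‖ * ‖z‖ ^ n * ‖d ‖z‖‖ := by
  rw [radialTermFDeriv]
  refine (norm_add_le _ _).trans (add_le_add ?_ ?_)
  · rw [norm_smul]
    refine mul_le_mul_of_nonneg_left (ContinuousLinearMap.opNorm_le_bound _ (by positivity)
      fun v => (hT _).trans ?_) (norm_nonneg _)
    change ‖c * (n * z ^ (n - 1)) * v‖ ≤ _
    simp
  · rw [norm_smul]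
    refine mul_le_mul ((hT _).trans ?_) (norm_radialFDeriv_le d z) (norm_nonneg _) (by positivity)
    simp

theorem norm_fderiv_radialPower_le (hΦ : IsRadialFamily q ρ C Φ dΦ)
    (hΨ : IsRadialFamily q' ρ C' Ψ dΨ) (n : ℕ) (c : ℂ) {z : ℂ}
    (hz : z ∈ Metric.ball (0 : ℂ) ρ) :
    ‖fderiv ℝ (radialPower (Φ n) (Ψ n) n c) z‖ ≤
      (C + C') * ‖c‖ * (n * ‖z‖ ^ (n - 1) + ‖z‖ ^ n) := by
  have hr : ‖z‖ ∈ Icc 0 ρ := ⟨norm_nonneg z, (mem_ball_zero_iff.1 hz).le⟩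
  have hb : ∀ {q : ℝ → ℂ} {C : ℝ} {Φ dΦ : ℕ → ℝ → ℂ} {T : ℂ →L[ℝ] ℂ},
      IsRadialFamily q ρ C Φ dΦ → (∀ z, ‖T z‖ ≤ ‖z‖) →
      ‖radialTermFDeriv T (Φ n) (dΦ n) n c z‖ ≤ C * ‖c‖ * (n * ‖z‖ ^ (n - 1) + ‖z‖ ^ n) := by
    intro q C Φ dΦ T h hT
    refine (norm_radialTermFDeriv_le hT _ _ n c z).trans ?_
    have h1 := mul_le_mul_of_nonneg_right (h.norm_le n _ hr)
      (by positivity : 0 ≤ ‖c‖ * (n * ‖z‖ ^ (n - 1)))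
    have h2 := mul_le_mul_of_nonneg_left (h.norm_deriv_le n _ hr)
      (by positivity : 0 ≤ ‖c‖ * ‖z‖ ^ n)
    linarith
  rw [(hasFDerivAt_radialPower hΦ hΨ n c hz).fderiv, radialPowerFDeriv]
  have h1 := hb hΦ norm_reL_apply_le
  have h2 := hb hΨ norm_imL_apply_le
  have hC := (norm_nonneg _).trans h1
  have hC' := (norm_nonneg _).trans h2
  refine ContinuousLinearMap.opNorm_le_bound _ (by linarith) fun v => ?_
  refine (norm_le_add _).trans ?_
  rw [add_mul C, add_mul (C * ‖c‖), add_mul]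
  exact add_le_add (ContinuousLinearMap.le_of_opNorm_le _ h1 v)
    (ContinuousLinearMap.le_of_opNorm_le _ h2 v)

theorem summable_succ_sq_mul_geometric {t : ℝ} (h0 : 0 ≤ t) (h1 : t < 1) :
    Summable fun n : ℕ => ((n : ℝ) + 1) ^ 2 * t ^ n := by
  have ht : ‖t‖ < 1 := by rwa [Real.norm_eq_abs, abs_of_nonneg h0]
  have := ((summable_pow_mul_geometric_of_norm_lt_one 2 ht).add
    ((summable_pow_mul_geometric_of_norm_lt_one 1 ht).mul_left 2)).add
    (summable_pow_mul_geometric_of_norm_lt_one 0 ht)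
  refine this.congr fun n => ?_
  ring

/-- A series of radial powers whose coefficients grow at most like `(n + 1) ρ⁻ⁿ` converges locally
uniformly with its derivatives. -/
theorem summable_bound_radialPower {σ : Type*} [Finite σ] (hρ : 0 < ρ)
    (hΦ : IsRadialFamily q ρ C Φ dΦ) (hΨ : IsRadialFamily q' ρ C' Ψ dΨ) {c : σ → ℂ}
    (hc : ∀ a, ‖c a‖ = 1) {k : ℕ × σ → ℂ} {M : ℝ}
    (hk : ∀ i, ‖k i‖ ≤ M * ((i.1 + 1) / ρ ^ i.1)) {s : ℝ} (hs : s ∈ Ioo 0 ρ) :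
    ∃ u : ℕ × σ → ℝ, Summable u ∧ ∀ i, ∀ z ∈ Metric.ball (0 : ℂ) s,
      ‖(k i • radialPower (Φ i.1) (Ψ i.1) i.1 (c i.2)) z‖ ≤ u i ∧
      ‖fderiv ℝ (k i • radialPower (Φ i.1) (Ψ i.1) i.1 (c i.2)) z‖ ≤ u i := by
  have ht : 0 ≤ s / ρ := div_nonneg hs.1.le hρ.le
  have ht1 : s / ρ < 1 := (div_lt_one hρ).2 hs.2
  -- One factor n + 1 comes from the coefficients and one from differentiating zⁿ; 1/s compensates
  -- the exponent n - 1.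
  refine ⟨fun i => M * ((C + C') * (1 / s + 1)) * (((i.1 : ℝ) + 1) ^ 2 * (s / ρ) ^ i.1), ?_, ?_⟩
  · have h1 : Summable fun x : ℕ × σ => (((x.1 : ℝ) + 1) ^ 2 * (s / ρ) ^ x.1) * (1 : ℝ) :=
      (summable_succ_sq_mul_geometric ht ht1).mul_of_nonneg (g := fun _ : σ => (1 : ℝ))
        (.of_finite) (fun n => by positivity) fun _ => zero_le_one
    simp only [mul_one] at h1
    exact h1.mul_left _
  rintro ⟨n, a⟩ z hz
  have hzs := (mem_ball_zero_iff.1 hz).le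
  have hz' : z ∈ Metric.ball (0 : ℂ) ρ := Metric.ball_subset_ball hs.2.le hz
  have h0 : (0 : ℝ) ∈ Icc 0 ρ := ⟨le_rfl, hρ.le⟩
  have hC : 0 ≤ C + C' :=
    add_nonneg ((norm_nonneg _).trans (hΦ.norm_le 0 0 h0)) ((norm_nonneg _).trans (hΨ.norm_le 0 0 h0))
  have hs0 := hs.1
  have hp : ‖z‖ ^ n ≤ s ^ n := pow_le_pow_left₀ (norm_nonneg z) hzs n
  have hp' : n * ‖z‖ ^ (n - 1) ≤ n * (s ^ n * (1 / s)) := by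
    rcases n with _ | m
    · simp
    · refine mul_le_mul_of_nonneg_left ?_ (Nat.cast_nonneg _)
      rw [pow_succ s, mul_assoc, mul_one_div_cancel hs0.ne', mul_one, Nat.add_sub_cancel]
      exact pow_le_pow_left₀ (norm_nonneg z) hzs m
  have hsn : 0 < s ^ n := pow_pos hs0 n
  have hs1 : 0 < 1 / s := by positivity
  have key : ∀ x : ℝ, x ≤ (C + C') * (n * ‖z‖ ^ (n - 1) + ‖z‖ ^ n) → 0 ≤ x → ‖k (n, a)‖ * x ≤
      M * ((C + C') * (1 / s + 1)) * (((n : ℝ) + 1) ^ 2 * (s / ρ) ^ n) := fun x hx hx0 => by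
    have hx' : x ≤ (C + C') * ((1 / s + 1) * ((n + 1) * s ^ n)) := by
      refine hx.trans (mul_le_mul_of_nonneg_left ?_ hC)
      have hn : (0 : ℝ) ≤ n := n.cast_nonneg
      have : 0 ≤ s ^ n * (1 / s) := by positivity
      have : 0 ≤ n * s ^ n := by positivity
      nlinarith
    calc ‖k (n, a)‖ * x ≤ M * ((n + 1) / ρ ^ n) * ((C + C') * ((1 / s + 1) * ((n + 1) * s ^ n))) :=
          mul_le_mul (hk (n, a)) hx' hx0 ((norm_nonneg _).trans (hk (n, a)))
      _ = _ := by rw [div_pow]; ring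
  have hnn : 0 ≤ n * ‖z‖ ^ (n - 1) := by positivity
  constructor
  · rw [Pi.smul_apply, norm_smul]
    refine key _ ?_ (norm_nonneg _)
    refine (norm_radialPower_le hΦ hΨ n (c a) (hzs.trans hs.2.le)).trans ?_
    rw [hc, mul_one]
    exact mul_le_mul_of_nonneg_left (by linarith) hC
  · rw [fderiv_const_smul (hasFDerivAt_radialPower hΦ hΨ n (c a) hz').differentiableAt, norm_smul]
    refine key _ ?_ (norm_nonneg _)
    refine (norm_fderiv_radialPower_le hΦ hΨ n (c a) hz').trans ?_
    rw [hc, mul_one]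

theorem exists_pos_le_of_eventually {a : ℕ → ℝ} (ha : ∀ n, 0 < a n) {δ : ℝ} (hδ : 0 < δ)
    (h : ∀ᶠ n in atTop, δ ≤ a n) : ∃ ε > 0, ∀ n, ε ≤ a n := by
  obtain ⟨N, hN⟩ := eventually_atTop.1 h
  have hfin : ∀ N : ℕ, ∃ ε > 0, ∀ n < N, ε ≤ a n := fun N => by
    induction N with
    | zero => exact ⟨1, one_pos, fun n hn => absurd hn n.not_lt_zero⟩
    | succ N ih =>
      obtain ⟨ε, hε, h⟩ := ih
      refine ⟨min ε (a N), lt_min hε (ha N), fun n hn => ?_⟩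
      rcases (Nat.lt_succ_iff_lt_or_eq.1 hn) with h1 | rfl
      · exact (min_le_left _ _).trans (h n h1)
      · exact min_le_right _ _
  obtain ⟨ε, hε, h⟩ := hfin N
  refine ⟨min ε δ, lt_min hε hδ, fun n => ?_⟩
  rcases lt_or_ge n N with h1 | h1
  · exact (min_le_left _ _).trans (h n h1)
  · exact (min_le_right _ _).trans (hN n h1)

/-- Once C/(n+1) < 1/2, |φ^{(n)}| ≥ 1/2 and the norm is at least ρ²ⁿ⁺²/(8(n+1)); the finitely many
other norms are positive. The weaker power (n+1)⁻² keeps the bound a perfect square. -/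
theorem IsRadialFamily.exists_le_weightedNormSq (hρ : 0 < ρ) (hΦ : IsRadialFamily q ρ C Φ dΦ) :
    ∃ ε > 0, ∀ n : ℕ, ε * (ρ ^ n / (n + 1)) ^ 2 ≤ weightedNormSq ρ (2 * n + 1) (phi q ρ n) := by
  have hpos : ∀ n : ℕ, 0 < (ρ ^ n / (n + 1)) ^ 2 := fun n => by positivity
  suffices h : ∀ᶠ n : ℕ in atTop,
      ρ ^ 2 / 8 ≤ weightedNormSq ρ (2 * n + 1) (phi q ρ n) / (ρ ^ n / (n + 1)) ^ 2 by
    obtain ⟨ε, hε, h⟩ := exists_pos_le_of_eventually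
      (fun n => div_pos (hΦ.weightedNormSq_pos hρ n _) (hpos n)) (by positivity) h
    exact ⟨ε, hε, fun n => (le_div_iff₀ (hpos n)).1 (h n)⟩
  have hlim : Tendsto (fun n : ℕ => C / ((n : ℝ) + 1)) atTop (𝓝 0) :=
    tendsto_const_nhds.div_atTop (tendsto_natCast_atTop_atTop.atTop_add tendsto_const_nhds)
  filter_upwards [hlim.eventually (gt_mem_nhds (by norm_num : (0 : ℝ) < 1 / 2))] with n hn
  rw [le_div_iff₀ (hpos n), hΦ.weightedNormSq_phi hρ]
  have hc := hΦ.continuous n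
  have h1 : ∫ r in (0 : ℝ)..ρ, 1 / 4 * r ^ (2 * n + 1) ≤
      ∫ r in (0 : ℝ)..ρ, ‖Φ n r‖ ^ 2 * r ^ (2 * n + 1) := by
    refine intervalIntegral.integral_mono_on hρ.le
      (Continuous.intervalIntegrable (by fun_prop) _ _)
      (Continuous.intervalIntegrable (by fun_prop) _ _) fun r hr => ?_
    refine mul_le_mul_of_nonneg_right ?_ (pow_nonneg hr.1 _)
    have h2 := hΦ.norm_sub_one_le n r hr
    have h3 : 1 ≤ ‖Φ n r‖ + ‖Φ n r - 1‖ := by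
      have := norm_sub_le (Φ n r) (Φ n r - 1)
      simpa using this
    nlinarith
  refine le_trans ?_ h1
  rw [intervalIntegral.integral_const_mul, integral_pow]
  push_cast
  rw [zero_pow (by omega), sub_zero, div_pow]
  have hn0 : (0 : ℝ) ≤ n := n.cast_nonneg
  have e1 : ρ ^ 2 / 8 * ((ρ ^ n) ^ 2 / ((n : ℝ) + 1) ^ 2) =
      ρ ^ (2 * n + 2) / 8 * (1 / ((n : ℝ) + 1) ^ 2) := by ring
  have e2 : 1 / 4 * (ρ ^ (2 * n + 1 + 1) / (2 * (n : ℝ) + 1 + 1)) =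
      ρ ^ (2 * n + 2) / 8 * (1 / ((n : ℝ) + 1)) := by
    rw [show 2 * (n : ℝ) + 1 + 1 = 2 * (n + 1) by ring, show 2 * n + 1 + 1 = 2 * n + 2 by ring]
    field_simp; ring
  rw [e1, e2]
  refine mul_le_mul_of_nonneg_left (one_div_le_one_div_of_le (by positivity) ?_) (by positivity)
  nlinarith

end Series

/-! ### Lower bounds for norms, and pointwise sums of L₂ series. -/

section Basis

open Bicomplex
open Complex (I)
open scoped ComplexConjugate

variable {ρ : ℝ} {q q' f : ℝ → ℂ} {C C' : ℝ} {Φ dΦ Ψ dΨ : ℕ → ℝ → ℂ}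

theorem l2Inner_self (F : ℂ → Bicomplex) : l2Inner ρ F F = ((l2Norm ρ F ^ 2 : ℝ) : ℂ) := by
  rw [l2Norm, Real.sq_sqrt (integral_nonneg fun z => sq_nonneg _), l2Inner, ← integral_complex_ofReal]
  refine integral_congr_ae (Eventually.of_forall fun z => ?_)
  simp only [pairing_eq_inner, inner_self_eq_norm_sq_to_K]
  norm_cast

theorem l2Norm_nonneg (F : ℂ → Bicomplex) : 0 ≤ l2Norm ρ F := Real.sqrt_nonneg _

theorem inner_eq_l2Inner {F G : Lp Bicomplex 2 (diskMeasure ρ)} {F' G' : ℂ → Bicomplex}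
    (hF : F =ᵐ[diskMeasure ρ] F') (hG : G =ᵐ[diskMeasure ρ] G') :
    inner ℂ F G = l2Inner ρ G' F' := by
  rw [L2.inner_def, l2Inner]
  refine integral_congr_ae ?_
  filter_upwards [hF, hG] with z h1 h2
  rw [h1, h2, pairing_eq_inner]

/-- The complex number `1` or `i` that corresponds to `1` or `𝐣`. -/
noncomputable def unitOf (Λ : Bicomplex) : ℂ := Λ.sc + I * Λ.vec

theorem unitOf_one : unitOf 1 = 1 := by simp [unitOf, sc_one, vec_one]
theorem unitOf_j : unitOf j = I := by simp [unitOf, j, sc_ofParts, vec_ofParts]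

theorem hat_unitOf {Λ : Bicomplex} (hΛ : Λ ∈ ({1, j} : Set Bicomplex)) : hat (unitOf Λ) = Λ := by
  rcases hΛ with rfl | rfl
  · rw [unitOf_one, hat_one]
  · rw [unitOf_j, hat_I]

theorem unitOf_eq {Λ : Bicomplex} (hΛ : Λ ∈ ({1, j} : Set Bicomplex)) :
    unitOf Λ = 1 ∨ unitOf Λ = I := by
  rcases hΛ with rfl | rfl
  · exact Or.inl unitOf_one
  · exact Or.inr unitOf_j

theorem norm_unitOf {Λ : Bicomplex} (hΛ : Λ ∈ ({1, j} : Set Bicomplex)) : ‖unitOf Λ‖ = 1 := by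
  rcases unitOf_eq hΛ with h | h <;> simp [h]

theorem l2Inner_radialPower_ne (hρ : 0 < ρ) (hΦ : IsRadialFamily q ρ C Φ dΦ)
    (hΨ : IsRadialFamily q' ρ C' Ψ dΨ) {i k : ℕ × ({1, j} : Set Bicomplex)} (hik : i ≠ k) :
    l2Inner ρ (radialPower (Φ i.1) (Ψ i.1) i.1 (unitOf i.2))
      (radialPower (Φ k.1) (Ψ k.1) k.1 (unitOf k.2)) = 0 := by
  obtain ⟨n, Λ, hΛ⟩ := i
  obtain ⟨m, Λ', hΛ'⟩ := k
  by_cases hnm : n = m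
  · subst hnm
    have hne : Λ ≠ Λ' := fun e => hik (by subst e; rfl)
    rcases hΛ with rfl | rfl <;> rcases hΛ' with rfl | rfl
    · exact absurd rfl hne
    · simp only [unitOf_one, unitOf_j]
      exact l2Inner_radialPower_eq_zero hρ hΦ hΨ (angularRe_one_I _ _) (angularIm_one_I _ _)
    · simp only [unitOf_one, unitOf_j]
      exact l2Inner_radialPower_eq_zero hρ hΦ hΨ (angularRe_I_one _ _) (angularIm_I_one _ _)
    · exact absurd rfl hne
  · exact l2Inner_radialPower_eq_zero hρ hΦ hΨ (angularRe_of_ne hnm _ _) (angularIm_of_ne hnm _ _)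

/-- The weights are (1, 1) in positive degree and (2, 0) or (0, 2) in degree zero. Their common sum
2 allows one norm estimate for all degrees. -/
theorem exists_angular_self (n : ℕ) {c : ℂ} (hc : c = 1 ∨ c = I) : ∃ α β : ℝ, 0 ≤ α ∧ 0 ≤ β ∧
    α + β = 2 ∧ angularRe n n c c = α ∧ angularIm n n c c = β := by
  rcases Nat.eq_zero_or_pos n with rfl | hn
  · rcases hc with rfl | rfl
    · exact ⟨2, 0, by norm_num, le_rfl, by norm_num, by simp [angularRe_zero_one],
        by simp [angularIm_zero_one]⟩
    · exact ⟨0, 2, le_rfl, by norm_num, by norm_num, by simp [angularRe_zero_I],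
        by simp [angularIm_zero_I]⟩
  · have h1 : ‖c‖ = 1 := by rcases hc with rfl | rfl <;> simp
    exact ⟨1, 1, by norm_num, by norm_num, by norm_num, by simp [angularRe_self hn h1],
      by simp [angularIm_self hn h1]⟩

theorem exists_le_l2Norm_radialPower (hρ : 0 < ρ) (hΦ : IsRadialFamily q ρ C Φ dΦ)
    (hΨ : IsRadialFamily q' ρ C' Ψ dΨ) : ∃ ε > 0, ∀ (n : ℕ) (c : ℂ), c = 1 ∨ c = I →
      ε * (ρ ^ n / (n + 1)) ≤ l2Norm ρ (radialPower (Φ n) (Ψ n) n c) := by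
  obtain ⟨ε, hε, h⟩ := hΦ.exists_le_weightedNormSq hρ
  obtain ⟨ε', hε', h'⟩ := hΨ.exists_le_weightedNormSq hρ
  have hm := lt_min hε hε'
  refine ⟨√(min ε ε'), Real.sqrt_pos.2 hm, fun n c hc => ?_⟩
  have hx : 0 ≤ ρ ^ n / ((n : ℝ) + 1) := by positivity
  refine (sq_le_sq₀ (by positivity) (l2Norm_nonneg _)).1 ?_
  rw [mul_pow, Real.sq_sqrt hm.le]
  obtain ⟨α, β, hα, hβ, hαβ, e1, e2⟩ := exists_angular_self n hc
  have e := l2Inner_radialPower_self hρ hΦ hΨ n c c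
  rw [l2Inner_self, e1, e2] at e
  have e' : l2Norm ρ (radialPower (Φ n) (Ψ n) n c) ^ 2 = Real.pi *
      (α * weightedNormSq ρ (2 * n + 1) (phi q ρ n) +
        β * weightedNormSq ρ (2 * n + 1) (phi q' ρ n)) := by exact_mod_cast e
  have hy := sq_nonneg (ρ ^ n / ((n : ℝ) + 1))
  have b1 := mul_le_mul_of_nonneg_left
    ((mul_le_mul_of_nonneg_right (min_le_left ε ε') hy).trans (h n)) hα
  have b2 := mul_le_mul_of_nonneg_left
    ((mul_le_mul_of_nonneg_right (min_le_right ε ε') hy).trans (h' n)) hβ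
  have hmy := mul_nonneg hm.le hy
  rw [e']
  have hsum : 2 * (min ε ε' * (ρ ^ n / ((n : ℝ) + 1)) ^ 2) ≤
      α * weightedNormSq ρ (2 * n + 1) (phi q ρ n) +
        β * weightedNormSq ρ (2 * n + 1) (phi q' ρ n) := by
    rw [← hαβ, add_mul]; exact add_le_add b1 b2
  nlinarith [Real.pi_gt_three]

/-- Convergence in L₂ implies convergence in measure, hence almost everywhere along a sequence of
partial sums, where the limit must agree with the pointwise sum. -/
theorem coeFn_eq_of_hasSum {ι : Type*} [Countable ι] {G : ι → Lp Bicomplex 2 (diskMeasure ρ)}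
    {F : Lp Bicomplex 2 (diskMeasure ρ)} (hF : HasSum G F) {w : ι → ℂ → Bicomplex}
    {V : ℂ → Bicomplex} (hw : ∀ i, G i =ᵐ[diskMeasure ρ] w i)
    (hV : ∀ z ∈ Metric.ball (0 : ℂ) ρ, HasSum (fun i => w i z) (V z)) :
    F =ᵐ[diskMeasure ρ] V := by
  obtain ⟨t, ht, hae⟩ := (tendstoInMeasure_of_tendsto_Lp (f := fun s : Finset ι => ∑ i ∈ s, G i)
    hF).exists_seq_tendsto_ae'
  have hs : ∀ᵐ z ∂diskMeasure ρ, ∀ k, (∑ i ∈ t k, G i : Lp Bicomplex 2 (diskMeasure ρ)) z =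
      ∑ i ∈ t k, (G i : ℂ → Bicomplex) z := ae_all_iff.2 fun k => Lp.coeFn_fun_finsetSum _ _
  filter_upwards [hae, hs, ae_all_iff.2 hw, ae_restrict_mem measurableSet_ball] with z h1 h2 h3 h4
  refine tendsto_nhds_unique h1 (((hV z h4).comp ht).congr fun k => ?_)
  rw [h2 k, Function.comp]
  exact Finset.sum_congr rfl fun i _ => (h3 i).symm

end Basis

/-! ### The Bergman space as the isometric image of ℓ². -/

section Basis

open Bicomplex
open Complex (I)
open scoped ComplexConjugate

variable {ρ : ℝ} {q f : ℝ → ℂ} {C C' : ℝ} {Φ dΦ Ψ dΨ : ℕ → ℝ → ℂ}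

/-- The normalised radial powers as elements of `L₂`. -/
noncomputable def normalizedPower {q q' : ℝ → ℂ} (hΦ : IsRadialFamily q ρ C Φ dΦ)
    (hΨ : IsRadialFamily q' ρ C' Ψ dΨ)
    (i : ℕ × ({1, j} : Set Bicomplex)) : Lp Bicomplex 2 (diskMeasure ρ) :=
  ((l2Norm ρ (radialPower (Φ i.1) (Ψ i.1) i.1 (unitOf i.2)) : ℂ))⁻¹ •
    (memLp_of_continuous (ρ := ρ) (continuous_radialPower hΦ hΨ i.1 (unitOf i.2))).toLp
      (radialPower (Φ i.1) (Ψ i.1) i.1 (unitOf i.2))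

theorem coeFn_normalizedPower {q q' : ℝ → ℂ} (hΦ : IsRadialFamily q ρ C Φ dΦ)
    (hΨ : IsRadialFamily q' ρ C' Ψ dΨ) (i : ℕ × ({1, j} : Set Bicomplex)) :
    normalizedPower hΦ hΨ i =ᵐ[diskMeasure ρ]
      ((l2Norm ρ (radialPower (Φ i.1) (Ψ i.1) i.1 (unitOf i.2)) : ℂ))⁻¹ •
        radialPower (Φ i.1) (Ψ i.1) i.1 (unitOf i.2) := by
  filter_upwards [Lp.coeFn_smul ((l2Norm ρ (radialPower (Φ i.1) (Ψ i.1) i.1 (unitOf i.2)) : ℂ))⁻¹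
    ((memLp_of_continuous (ρ := ρ) (continuous_radialPower hΦ hΨ i.1 (unitOf i.2))).toLp _),
    (memLp_of_continuous (ρ := ρ) (continuous_radialPower hΦ hΨ i.1 (unitOf i.2))).coeFn_toLp]
    with z h1 h2
  rw [normalizedPower, h1, Pi.smul_apply, h2, Pi.smul_apply]

theorem l2Norm_radialPower_pos {q q' : ℝ → ℂ} (hρ : 0 < ρ) (hΦ : IsRadialFamily q ρ C Φ dΦ)
    (hΨ : IsRadialFamily q' ρ C' Ψ dΨ) (n : ℕ) {c : ℂ} (hc : c = 1 ∨ c = I) :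
    0 < l2Norm ρ (radialPower (Φ n) (Ψ n) n c) := by
  obtain ⟨ε, hε, h⟩ := exists_le_l2Norm_radialPower hρ hΦ hΨ
  exact lt_of_lt_of_le (by positivity) (h n c hc)

theorem orthonormal_normalizedPower {q q' : ℝ → ℂ} (hρ : 0 < ρ) (hΦ : IsRadialFamily q ρ C Φ dΦ)
    (hΨ : IsRadialFamily q' ρ C' Ψ dΨ) : Orthonormal ℂ (normalizedPower hΦ hΨ) := by
  classical
  rw [orthonormal_iff_ite]
  intro i k
  rw [normalizedPower, normalizedPower, inner_smul_left, inner_smul_right,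
    inner_eq_l2Inner (MemLp.coeFn_toLp _) (MemLp.coeFn_toLp _)]
  split_ifs with hik
  · subst hik
    have hN := l2Norm_radialPower_pos hρ hΦ hΨ i.1 (unitOf_eq i.2.2)
    have hN' := Complex.ofReal_ne_zero.2 hN.ne'
    rw [l2Inner_self, map_inv₀, Complex.conj_ofReal]
    push_cast
    field_simp
  · rw [l2Inner_radialPower_ne hρ hΦ hΨ (Ne.symm hik), mul_zero, mul_zero]

variable (h : IsRadialCoefficient ρ q f) (hΦ : IsRadialFamily q ρ C Φ dΦ)
  (hΨ : IsRadialFamily (darbouxPotential f q ρ) ρ C' Ψ dΨ)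

include h

theorem normalizedPower_mem (i : ℕ × ({1, j} : Set Bicomplex)) :
    normalizedPower hΦ hΨ i ∈ bergmanSpace f ρ :=
  ⟨_, (isVekuaSolution_radialPower h hΦ hΨ i.1 (unitOf i.2)).const_smul _,
    coeFn_normalizedPower hΦ hΨ i⟩

/-- Convergent series of normalised radial powers lie in the Bergman space. -/
theorem mem_bergmanSpace_of_hasSum {g : ℕ × ({1, j} : Set Bicomplex) → ℂ} {M : ℝ}
    (hg : ∀ i, ‖g i‖ ≤ M) {F : Lp Bicomplex 2 (diskMeasure ρ)}
    (hF : HasSum (fun i => g i • normalizedPower hΦ hΨ i) F) : F ∈ bergmanSpace f ρ := by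
  let N : ℕ × ({1, j} : Set Bicomplex) → ℝ := fun i =>
    l2Norm ρ (radialPower (Φ i.1) (Ψ i.1) i.1 (unitOf i.2))
  let k : ℕ × ({1, j} : Set Bicomplex) → ℂ := fun i => g i * (N i : ℂ)⁻¹
  obtain ⟨ε, hε, hN⟩ := exists_le_l2Norm_radialPower h.pos hΦ hΨ
  have hρ := h.pos
  -- Bounded coefficients divided by norms of size at least ερⁿ/(n+1) grow slowly enough for
  -- convergence on every smaller disk.
  have hk : ∀ i, ‖k i‖ ≤ M * ε⁻¹ * ((i.1 + 1) / ρ ^ i.1) := fun i => by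
    have h2 : (N i)⁻¹ ≤ (ε * (ρ ^ i.1 / (i.1 + 1)))⁻¹ :=
      inv_anti₀ (by positivity) (hN i.1 _ (unitOf_eq i.2.2))
    rw [norm_mul, norm_inv, Complex.norm_real, Real.norm_eq_abs, abs_of_nonneg (l2Norm_nonneg _)]
    refine (mul_le_mul (hg i) h2 (inv_nonneg.2 (l2Norm_nonneg _))
      ((norm_nonneg _).trans (hg i))).trans_eq ?_
    rw [mul_inv, inv_div, mul_assoc]
  have hfin : Finite ({1, j} : Set Bicomplex) := (toFinite ({1, j} : Set Bicomplex)).to_subtype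
  let w : ℕ × ({1, j} : Set Bicomplex) → ℂ → Bicomplex := fun i =>
    k i • radialPower (Φ i.1) (Ψ i.1) i.1 (unitOf i.2)
  have hw : ∀ i, IsVekuaSolution f ρ (w i) := fun i =>
    (isVekuaSolution_radialPower h hΦ hΨ i.1 (unitOf i.2)).const_smul (k i)
  have hb : ∀ s ∈ Ioo 0 ρ, ∃ u : ℕ × ({1, j} : Set Bicomplex) → ℝ, Summable u ∧
      ∀ i, ∀ z ∈ Metric.ball (0 : ℂ) s, ‖w i z‖ ≤ u i ∧ ‖fderiv ℝ (w i) z‖ ≤ u i :=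
    fun s hs => summable_bound_radialPower h.pos hΦ hΨ
      (c := fun Λ : ({1, j} : Set Bicomplex) => unitOf Λ) (fun Λ => norm_unitOf Λ.2) hk hs
  have hG : ∀ i, (g i • normalizedPower hΦ hΨ i : Lp Bicomplex 2 (diskMeasure ρ))
      =ᵐ[diskMeasure ρ] w i := fun i => by
    filter_upwards [Lp.coeFn_smul (g i) (normalizedPower hΦ hΨ i), coeFn_normalizedPower hΦ hΨ i]
      with z h1 h2
    rw [h1, Pi.smul_apply, h2, Pi.smul_apply, smul_smul]
    rfl
  exact ⟨fun z => ∑' i, w i z, IsVekuaSolution.tsum h hw hb, coeFn_eq_of_hasSum hF hG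
    fun z hz => (summable_of_norm_le_of_mem_ball hb hz).1.hasSum⟩

/-- An element of the Bergman space that is orthogonal to the radial powers vanishes. -/
theorem eq_zero_of_mem_bergmanSpace {F : Lp Bicomplex 2 (diskMeasure ρ)}
    (hF : F ∈ bergmanSpace f ρ) (horth : ∀ i, inner ℂ (normalizedPower hΦ hΨ i) F = 0) : F = 0 := by
  obtain ⟨W, hW, hFW⟩ := hF
  have hW2 : MemLp W 2 (diskMeasure ρ) := (memLp_congr_ae hFW).1 (Lp.memLp F)
  refine (Lp.eq_zero_iff_ae_eq_zero).2 (hFW.trans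
    (hW.eq_zero_of_orthogonal h hΦ hΨ hW2 fun n c hc => ?_))
  have key : ∀ Λ : ({1, j} : Set Bicomplex),
      l2Inner ρ W (radialPower (Φ n) (Ψ n) n (unitOf Λ)) = 0 := fun Λ => by
    have h1 := horth (n, Λ)
    rw [normalizedPower, inner_smul_left, inner_eq_l2Inner (MemLp.coeFn_toLp _) hFW] at h1
    refine (mul_eq_zero.1 h1).resolve_left ?_
    have hN := l2Norm_radialPower_pos h.pos hΦ hΨ n (unitOf_eq Λ.2)
    rw [map_inv₀, Complex.conj_ofReal]
    exact inv_ne_zero (Complex.ofReal_ne_zero.2 hN.ne')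
  rcases hc with rfl | rfl
  · simpa only [unitOf_one] using key ⟨1, Or.inl rfl⟩
  · simpa only [unitOf_j] using key ⟨j, Or.inr rfl⟩

include hΦ hΨ in
-- The isometry from ℓ² given by the orthonormal system has complete range, and the Bergman space
-- turns out to be that range.
theorem completeSpace_bergmanSpace : CompleteSpace (bergmanSpace f ρ) := by
  classical
  have hon := orthonormal_normalizedPower h.pos hΦ hΨ
  set T := hon.orthogonalFamily.linearIsometry with hT
  have hmem : ∀ g, T g ∈ bergmanSpace f ρ := fun g =>
    mem_bergmanSpace_of_hasSum h hΦ hΨ (g := g) (M := ‖g‖)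
      (fun i => lp.norm_apply_le_norm (by norm_num) g i)
      (hon.orthogonalFamily.hasSum_linearIsometry g)
  have hcomp : IsComplete (range T) := T.isometry.isUniformInducing.isComplete_range
  have hc : CompleteSpace (LinearMap.range T.toLinearMap) := hcomp.completeSpace_coe
  have heq : (bergmanSpace f ρ : Set (Lp Bicomplex 2 (diskMeasure ρ))) = range T := by
    refine subset_antisymm (fun F hF => ?_) (range_subset_iff.2 hmem)
    -- The projection exists because the range is complete. It lies in the Bergman space, so the
    -- difference is a solution orthogonal to all powers.
    let P := (LinearMap.range T.toLinearMap).starProjection F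
    obtain ⟨g, hg⟩ : P ∈ LinearMap.range T.toLinearMap := Submodule.starProjection_apply_mem _ _
    have hP : P ∈ bergmanSpace f ρ := by rw [← hg]; exact hmem g
    have h0 : F - P = 0 := by
      refine eq_zero_of_mem_bergmanSpace h hΦ hΨ (Submodule.sub_mem _ hF hP) fun i => ?_
      refine (Submodule.sub_starProjection_mem_orthogonal F) _ ⟨lp.single 2 i (1 : ℂ), ?_⟩
      change T (lp.single 2 i (1 : ℂ)) = _
      rw [hT, OrthogonalFamily.linearIsometry_apply_single, LinearIsometry.toSpanSingleton_apply,
        one_smul]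
    exact ⟨g, by rw [sub_eq_zero.1 h0]; exact hg⟩
  exact IsComplete.completeSpace_coe (heq ▸ hcomp)

/-- The normalised radial powers form a Hilbert basis of the Bergman space. -/
theorem exists_hilbertBasis_bergmanSpace :
    ∃ b : HilbertBasis (ℕ × ({1, j} : Set Bicomplex)) ℂ (bergmanSpace f ρ),
      ∀ i, (b i : Lp Bicomplex 2 (diskMeasure ρ)) = normalizedPower hΦ hΨ i := by
  have := completeSpace_bergmanSpace h hΦ hΨ
  let v : ℕ × ({1, j} : Set Bicomplex) → bergmanSpace f ρ := fun i =>
    ⟨normalizedPower hΦ hΨ i, normalizedPower_mem h hΦ hΨ i⟩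
  have hv : Orthonormal ℂ v :=
    ((bergmanSpace f ρ).subtypeₗᵢ.orthonormal_comp_iff).1 (orthonormal_normalizedPower h.pos hΦ hΨ)
  have hsp : (Submodule.span ℂ (range v))ᗮ = ⊥ := by
    refine (Submodule.eq_bot_iff _).2 fun F hF => Subtype.ext ?_
    refine eq_zero_of_mem_bergmanSpace h hΦ hΨ F.2 fun i => ?_
    exact hF (v i) (Submodule.subset_span (mem_range_self i))
  exact ⟨HilbertBasis.mkOfOrthogonalEqBot hv hsp, fun i => by
    rw [HilbertBasis.coe_mkOfOrthogonalEqBot]⟩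

end Basis
-- Assembly of the theorem.
theorem mainTheorem2 (ρ : ℝ) (hρ : 0 < ρ) (q f : ℝ → ℂ)
    (hq : ContDiffOn ℝ 1 q (Icc 0 ρ)) (hf : ContDiffOn ℝ 2 f (Icc 0 ρ))
    (hfq : ∀ r ∈ Ioo 0 ρ, deriv (deriv f) r + 1 / (r : ℂ) * deriv f r - q r * f r = 0)
    (hf0 : ∀ r ∈ Icc 0 ρ, f r ≠ 0) (hf1 : f 0 = 1) :
    -- the kernels and the functions `φ^{(n)}` for `f` and `1/f` are well defined
    WellDefined q ρ ∧ WellDefined (darbouxPotential f q ρ) ρ ∧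
    -- the formal powers are square integrable solutions of the Vekua equation
    (∀ n : ℕ, ∀ Λ ∈ ({1, Bicomplex.j} : Set Bicomplex),
      IsVekuaSolution f ρ (formalPower f q ρ n Λ) ∧
        MemLp (formalPower f q ρ n Λ) 2 (diskMeasure ρ)) ∧
    -- orthogonality relations
    (∀ n m : ℕ,
      l2Inner ρ (formalPower f q ρ n 1) (formalPower f q ρ m Bicomplex.j) = 0) ∧
    (∀ n m : ℕ, 1 ≤ n → 1 ≤ m → ∀ Λ ∈ ({1, Bicomplex.j} : Set Bicomplex),
      l2Inner ρ (formalPower f q ρ n Λ) (formalPower f q ρ m Λ) =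
        if n = m then
          ((Real.pi * (weightedNormSq ρ (2 * n + 1) (phi q ρ n) +
            weightedNormSq ρ (2 * n + 1) (phi (darbouxPotential f q ρ) ρ n)) : ℝ) : ℂ)
        else 0) ∧
    (∀ m : ℕ, 1 ≤ m → ∀ Λ ∈ ({1, Bicomplex.j} : Set Bicomplex),
      l2Inner ρ (formalPower f q ρ 0 1) (formalPower f q ρ m Λ) = 0 ∧
        l2Inner ρ (formalPower f q ρ 0 Bicomplex.j) (formalPower f q ρ m Λ) = 0) ∧
    -- the norms in degree zero
    l2Inner ρ (formalPower f q ρ 0 1) (formalPower f q ρ 0 1) =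
      ((2 * Real.pi * weightedNormSq ρ 1 (phi q ρ 0) : ℝ) : ℂ) ∧
    l2Inner ρ (formalPower f q ρ 0 Bicomplex.j) (formalPower f q ρ 0 Bicomplex.j) =
      ((2 * Real.pi * weightedNormSq ρ 1 (phi (darbouxPotential f q ρ) ρ 0) : ℝ) : ℂ) ∧
    -- the normalised formal powers form a Hilbert basis of the Bergman space
    ∃ b : HilbertBasis (ℕ × ({1, Bicomplex.j} : Set Bicomplex)) ℂ (bergmanSpace f ρ),
      ∀ (n : ℕ) (Λ : ({1, Bicomplex.j} : Set Bicomplex)),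
        ((b (n, Λ) : Lp Bicomplex 2 (diskMeasure ρ)) : ℂ → Bicomplex) =ᵐ[diskMeasure ρ]
          fun z => ((l2Norm ρ (formalPower f q ρ n Λ) : ℂ))⁻¹ • formalPower f q ρ n Λ z := by
  have h : IsRadialCoefficient ρ q f := ⟨hρ, hq, hf, hfq, hf0, hf1⟩
  obtain ⟨wd, C, Φ, dΦ, hΦ⟩ := wellDefined_and_exists_radialFamily hρ hq
  obtain ⟨wd', C', Ψ, dΨ, hΨ⟩ :=
    wellDefined_and_exists_radialFamily hρ h.contDiffOn_darbouxPotential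
  -- The identification is confined to the disk, since the chosen kernel is determined only for r in
  -- [0, ρ].
  have hZ : ∀ (n : ℕ), ∀ Λ ∈ ({1, Bicomplex.j} : Set Bicomplex), EqOn (formalPower f q ρ n Λ)
      (radialPower (Φ n) (Ψ n) n (unitOf Λ)) (Metric.ball 0 ρ) := fun n Λ hΛ z hz => by
    conv_lhs => rw [← hat_unitOf hΛ]
    exact formalPower_eq hΦ hΨ n (unitOf Λ) (mem_ball_zero_iff.1 hz).le
  have h1 : (1 : Bicomplex) ∈ ({1, Bicomplex.j} : Set Bicomplex) := Or.inl rfl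
  have hj : Bicomplex.j ∈ ({1, Bicomplex.j} : Set Bicomplex) := Or.inr rfl
  have hZae : ∀ (n : ℕ), ∀ Λ ∈ ({1, Bicomplex.j} : Set Bicomplex),
      formalPower f q ρ n Λ =ᵐ[diskMeasure ρ] radialPower (Φ n) (Ψ n) n (unitOf Λ) :=
    fun n Λ hΛ => by
    filter_upwards [ae_restrict_mem measurableSet_ball] with z hz using hZ n Λ hΛ hz
  have hne : ∀ {n m : ℕ} {Λ Λ' : Bicomplex} (hΛ : Λ ∈ ({1, Bicomplex.j} : Set Bicomplex))
      (hΛ' : Λ' ∈ ({1, Bicomplex.j} : Set Bicomplex)), (n ≠ m ∨ Λ ≠ Λ') →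
      l2Inner ρ (formalPower f q ρ n Λ) (formalPower f q ρ m Λ') = 0 := by
    intro n m Λ Λ' hΛ hΛ' hd
    rw [l2Inner_congr (hZ n Λ hΛ) (hZ m Λ' hΛ')]
    refine l2Inner_radialPower_ne hρ hΦ hΨ (i := (n, ⟨Λ, hΛ⟩)) (k := (m, ⟨Λ', hΛ'⟩)) fun e => ?_
    simp only [Prod.mk.injEq, Subtype.mk.injEq] at e
    exact hd.elim (· e.1) (· e.2)
  refine ⟨wd, wd', fun n Λ hΛ => ⟨(isVekuaSolution_radialPower h hΦ hΨ n (unitOf Λ)).congr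
      (hZ n Λ hΛ), (memLp_congr_ae (hZae n Λ hΛ)).2
        (memLp_of_continuous (continuous_radialPower hΦ hΨ n (unitOf Λ)))⟩,
    fun n m => hne h1 hj (Or.inr Bicomplex.one_ne_j), fun n m hn hm Λ hΛ => ?_,
    fun m hm Λ hΛ => ⟨hne h1 hΛ (Or.inl (by omega)), hne hj hΛ (Or.inl (by omega))⟩, ?_, ?_, ?_⟩
  · split_ifs with hnm
    · subst hnm
      rw [l2Inner_congr (hZ n Λ hΛ) (hZ n Λ hΛ), l2Inner_radialPower_self hρ hΦ hΨ,
        angularRe_self hn (norm_unitOf hΛ), angularIm_self hn (norm_unitOf hΛ)]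
      push_cast
      ring
    · exact hne hΛ hΛ (Or.inl hnm)
  · rw [l2Inner_congr (hZ 0 1 h1) (hZ 0 1 h1), l2Inner_radialPower_self hρ hΦ hΨ, unitOf_one,
      angularRe_zero_one, angularIm_zero_one]
    push_cast
    ring
  · rw [l2Inner_congr (hZ 0 _ hj) (hZ 0 _ hj), l2Inner_radialPower_self hρ hΦ hΨ, unitOf_j,
      angularRe_zero_I, angularIm_zero_I]
    push_cast
    ring
  · obtain ⟨b, hb⟩ := exists_hilbertBasis_bergmanSpace h hΦ hΨ
    refine ⟨b, fun n Λ => ?_⟩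
    have hN : l2Norm ρ (formalPower f q ρ n Λ) =
        l2Norm ρ (radialPower (Φ n) (Ψ n) n (unitOf Λ)) := by
      rw [l2Norm, l2Norm]
      congr 1
      refine integral_congr_ae ?_
      filter_upwards [hZae n Λ Λ.2] with z hz
      rw [hz]
    rw [hb, hN]
    filter_upwards [coeFn_normalizedPower hΦ hΨ (n, Λ), hZae n Λ Λ.2] with z e1 e2
    rw [e1, e2]
    rfl
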